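/- Let $X$ be a compact complex manifold of dimension $n$ with two Kähler forms $\chi$ and $\omega$. For a smooth function $\varphi: X\to\mathbb{R}$ put $\chi_\varphi=\chi+\sqrt{-1}\,\partial\bar\partial\varphi$, let $\mathcal{H}_\chi=\{\varphi\in C^\infty(X,\mathbb{R}) : \chi_\varphi>0\}$, let $\Lambda_{\chi_\varphi}\omega$ denote the trace of $\omega$ with respect to $\chi_\varphi$, and let $$c=\frac{\int_X n\,\omega\wedge\chi^{n-1}}{\int_X\chi^n}.$$ For $\varphi\in\mathcal{H}_\chi$ define $$\mathcal{J}(\varphi)=\int_0^1\int_X \varphi\,\bigl(\Lambda_{\chi_{s\varphi}}\omega-c\bigr)\,\chi_{s\varphi}^n\,ds .$$ Then $\mathcal{J}$ is the unique functional on $\mathcal{H}_\chi$ with $$\mathcal{J}(0)=0,\qquad d\mathcal{J}(\varphi)(\psi)=\left.\frac{d}{ds}\right|_{s=0}\mathcal{J}(\varphi+s\psi)=\int_X\psi\,\bigl(\Lambda_{\chi_\varphi}\omega-c\bigr)\,\chi_\varphi^n\qquad(\varphi\in\mathcal{H}_\chi,\ \psi\in C^\infty(X,\mathbb{R})),$$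 and $\mathcal{J}$ is convex along the $J$-flow: if $T\in(0,\infty]$ and $(\varphi_t)_{t\in[0,T)}$ is a solution, smooth on $[0,T)\times X$ and with $\varphi_t\in\mathcal{H}_\chi$ for all $t$, of $$\frac{\partial\varphi_t}{\partial t}=c-\Lambda_{\chi_{\varphi_t}}\omega ,$$ then $t\mapsto\mathcal{J}(\varphi_t)$ is a convex function on $[0,T)$. -/

import Mathlib

open Set MeasureTheory
open scoped Manifold ContDiff ComplexOrder

noncomputable section

namespace JFlow

/-- The Wirtinger derivative `∂f/∂z_j`. -/
def dz {n : ℕ} (j : Fin n) (f : (Fin n → ℂ) → ℂ) (z : Fin n → ℂ) : ℂ :=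
  (fderiv ℝ f z (Pi.single j 1) - Complex.I * fderiv ℝ f z (Pi.single j Complex.I)) / 2

/-- The Wirtinger derivative `∂f/∂z̄_j`. -/
def dzbar {n : ℕ} (j : Fin n) (f : (Fin n → ℂ) → ℂ) (z : Fin n → ℂ) : ℂ :=
  (fderiv ℝ f z (Pi.single j 1) + Complex.I * fderiv ℝ f z (Pi.single j Complex.I)) / 2

/-- The matrix `(∂²f/∂z_j∂z̄_k)`, i.e. the coefficients of `√-1 ∂∂̄f` with respect to
`√-1 dz_j ∧ dz̄_k`. -/
def ddbar {n : ℕ} (f : (Fin n → ℂ) → ℂ) (z : Fin n → ℂ) : Matrix (Fin n) (Fin n) ℂ :=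
  Matrix.of fun j k => dz j (dzbar k f) z

/-- The local data of a form of type `(1,1)`: for a chart `e` of `X` and a point `z` of its image,
`α e z` is the matrix `(a_{jk})` such that the form is `√-1 ∑ a_{jk} dz_j ∧ dz̄_k` in the chart `e`
at `z`. Only the values at charts `e` of the atlas and at points `z ∈ e.target` matter. -/
abbrev LocalCoeff (n : ℕ) (X : Type*) [TopologicalSpace X] : Type _ :=
  OpenPartialHomeomorph X (Fin n → ℂ) → (Fin n → ℂ) → Matrix (Fin n) (Fin n) ℂ

/-- The holomorphic Jacobian matrix `(∂w_a/∂z_i)_{a,i}` at `z` of the coordinate change from the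
chart `e` (coordinates `z`) to the chart `e'` (coordinates `w`). -/
def jacobian {n : ℕ} {X : Type*} [TopologicalSpace X]
    (e e' : OpenPartialHomeomorph X (Fin n → ℂ)) (z : Fin n → ℂ) : Matrix (Fin n) (Fin n) ℂ :=
  LinearMap.toMatrix' (fderiv ℂ (fun w => e' (e.symm w)) z : (Fin n → ℂ) →ₗ[ℂ] (Fin n → ℂ))

/-- A Kähler form: local coefficients that are smooth, that glue to a global form (the rule
`a_{ij} = ∑ (∂w_a/∂z_i) a'_{ab} conj (∂w_b/∂z_j)` on the overlap of two charts), that are Hermitian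
and positive definite, and such that the form is closed. As the form is real, `d = 0` amounts to
the vanishing of the `(2,1)`-part of the differential, `∂_k a_{ij} = ∂_i a_{kj}`. -/
structure IsKahlerForm {n : ℕ} {X : Type*} [TopologicalSpace X] [ChartedSpace (Fin n → ℂ) X]
    (α : LocalCoeff n X) : Prop where
  smooth : ∀ e ∈ atlas (Fin n → ℂ) X, ∀ i j, ContDiffOn ℝ ∞ (fun z => α e z i j) e.target
  glue : ∀ e ∈ atlas (Fin n → ℂ) X, ∀ e' ∈ atlas (Fin n → ℂ) X, ∀ x ∈ e.source ∩ e'.source,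
    α e (e x) = (jacobian e e' (e x)).transpose * α e' (e' x) *
      (jacobian e e' (e x)).transpose.conjTranspose
  posDef : ∀ e ∈ atlas (Fin n → ℂ) X, ∀ z ∈ e.target, (α e z).PosDef
  closed : ∀ e ∈ atlas (Fin n → ℂ) X, ∀ z ∈ e.target, ∀ i j k,
    dz k (fun w => α e w i j) z = dz i (fun w => α e w k j) z

/-- The positive measure on `X` given by a top degree form that is equal to `ρ e` times Lebesgue
measure in the chart `e`. For a `ρ` that transforms as a density, the local measures agree on
overlaps and the supremum is the measure glued from them. -/
def glueMeasure {n : ℕ} {X : Type*} [TopologicalSpace X] [ChartedSpace (Fin n → ℂ) X]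
    [MeasurableSpace X] (ρ : OpenPartialHomeomorph X (Fin n → ℂ) → (Fin n → ℂ) → ℝ) : Measure X :=
  ⨆ e ∈ atlas (Fin n → ℂ) X,
    ((volume.restrict e.target).withDensity fun z => ENNReal.ofReal (ρ e z)).map e.symm

/-- The measure `χⁿ`: in a chart, `χⁿ = n! det(g) ∏ (√-1 dz_j ∧ dz̄_j)` and `√-1 dz ∧ dz̄` is twice
Lebesgue measure on `ℂ`. -/
def topPower {n : ℕ} {X : Type*} [TopologicalSpace X] [ChartedSpace (Fin n → ℂ) X]
    [MeasurableSpace X] (χ : LocalCoeff n X) : Measure X :=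
  glueMeasure fun e z => 2 ^ n * (n.factorial : ℝ) * (χ e z).det.re

/-- The measure `n ω ∧ χⁿ⁻¹`: in a chart, the polarization of the determinant in `χⁿ`, i.e. the
sum over `j` of the determinants with the `j`-th column of `χ` replaced by that of `ω`. -/
def mixedPower {n : ℕ} {X : Type*} [TopologicalSpace X] [ChartedSpace (Fin n → ℂ) X]
    [MeasurableSpace X] (χ Ω : LocalCoeff n X) : Measure X :=
  glueMeasure fun e z => 2 ^ n * (n.factorial : ℝ) *
    (∑ j, ((χ e z).updateCol j fun i => Ω e z i j).det).re

/-- The constant `c = ∫ n ω ∧ χⁿ⁻¹ / ∫ χⁿ`. -/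
def slope {n : ℕ} {X : Type*} [TopologicalSpace X] [ChartedSpace (Fin n → ℂ) X]
    [MeasurableSpace X] (χ Ω : LocalCoeff n X) : ℝ :=
  (mixedPower χ Ω).real univ / (topPower χ).real univ

/-- The trace `Λ_χ ω`, the trace of `χ⁻¹ ω` in any chart at `x`. -/
def traceForm {n : ℕ} {X : Type*} [TopologicalSpace X] [ChartedSpace (Fin n → ℂ) X]
    (χ Ω : LocalCoeff n X) (x : X) : ℝ :=
  ((χ (chartAt (Fin n → ℂ) x) (chartAt (Fin n → ℂ) x x))⁻¹ *
    Ω (chartAt (Fin n → ℂ) x) (chartAt (Fin n → ℂ) x x)).trace.re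

/-- `χ_φ = χ + √-1 ∂∂̄φ`. -/
def deform {n : ℕ} {X : Type*} [TopologicalSpace X] (χ : LocalCoeff n X) (φ : X → ℝ) :
    LocalCoeff n X :=
  fun e z => χ e z + ddbar (fun w => (φ (e.symm w) : ℂ)) z

/-- Smooth real functions on `X`. -/
def IsSmooth (n : ℕ) {X : Type*} [TopologicalSpace X] [ChartedSpace (Fin n → ℂ) X]
    (φ : X → ℝ) : Prop :=
  ContMDiff 𝓘(ℝ, Fin n → ℂ) 𝓘(ℝ, ℝ) ∞ φ

/-- The space of Kähler potentials: smooth `φ` with `χ_φ > 0`. -/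
def potentials {n : ℕ} {X : Type*} [TopologicalSpace X] [ChartedSpace (Fin n → ℂ) X]
    (χ : LocalCoeff n X) : Set (X → ℝ) :=
  {φ | IsSmooth n φ ∧ ∀ e ∈ atlas (Fin n → ℂ) X, ∀ z ∈ e.target, (deform χ φ e z).PosDef}

/-- The 1-form `ψ ↦ ∫ ψ (Λ_{χ_φ} ω - c) χ_φⁿ` at `φ`. -/
def jForm {n : ℕ} {X : Type*} [TopologicalSpace X] [ChartedSpace (Fin n → ℂ) X]
    [MeasurableSpace X] (χ Ω : LocalCoeff n X) (φ ψ : X → ℝ) : ℝ :=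
  ∫ x, ψ x * (traceForm (deform χ φ) Ω x - slope χ Ω) ∂(topPower (deform χ φ))

/-- `J(0) = 0` and `dJ(φ)(ψ) = ∫ ψ (Λ_{χ_φ} ω - c) χ_φⁿ` on the space of Kähler potentials. -/
structure IsJFunctional {n : ℕ} {X : Type*} [TopologicalSpace X] [ChartedSpace (Fin n → ℂ) X]
    [MeasurableSpace X] (χ Ω : LocalCoeff n X) (J : (X → ℝ) → ℝ) : Prop where
  zero : J 0 = 0
  deriv : ∀ φ ∈ potentials χ, ∀ ψ : X → ℝ, IsSmooth n ψ →
    HasDerivAt (fun s : ℝ => J (φ + s • ψ)) (jForm χ Ω φ ψ) 0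

/-- The `J`-functional, by integrating its differential along the segment from `0` to `φ`. -/
def jFunctional {n : ℕ} {X : Type*} [TopologicalSpace X] [ChartedSpace (Fin n → ℂ) X]
    [MeasurableSpace X] (χ Ω : LocalCoeff n X) (φ : X → ℝ) : ℝ :=
  ∫ s in (0 : ℝ)..1, jForm χ Ω (s • φ) φ

/-- The time interval `[0, T)`, where `T = ∞` is allowed. -/
def timeInterval (T : EReal) : Set ℝ := {t | 0 ≤ t ∧ (t : EReal) < T}

/-- A (smooth) solution of the `J`-flow `∂φ/∂t = c - Λ_{χ_φ} ω` on `[0, T)`, in the space of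
Kähler potentials. The derivative at `t = 0` is one-sided. -/
structure IsJFlow {n : ℕ} {X : Type*} [TopologicalSpace X] [ChartedSpace (Fin n → ℂ) X]
    [MeasurableSpace X] (χ Ω : LocalCoeff n X) (T : EReal) (φ : ℝ → X → ℝ) : Prop where
  smooth : ContMDiffOn (𝓘(ℝ, ℝ).prod 𝓘(ℝ, Fin n → ℂ)) 𝓘(ℝ, ℝ) ∞ (fun p : ℝ × X => φ p.1 p.2)
    (timeInterval T ×ˢ univ)
  mem : ∀ t ∈ timeInterval T, φ t ∈ potentials χ
  flow : ∀ t ∈ timeInterval T, ∀ x, HasDerivWithinAt (fun s => φ s x)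
    (slope χ Ω - traceForm (deform χ (φ t)) Ω x) (timeInterval T) t

end JFlow

end

/-! On Kähler potentials the 1-form `jForm` is `ψ ↦ ∫ ψ (n ω ∧ χ_φⁿ⁻¹ - c χ_φⁿ)`. In a chart its
density is a first differential of the determinant minus `c` times the determinant. It is therefore
polynomial in the second derivatives of `φ` and makes sense for every smooth `φ`. Dividing by `det
χ` gives global functions (`detRatio`, `detRatio₁`, `detRatio₂`), so every integral is taken against
the fixed finite measure `χⁿ` and can be differentiated under the integral sign.

Existence of `J` means that this 1-form is closed, i.e. that its derivative is a symmetric bilinear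
form in the two directions (`integral_jDensity₁_comm`). The symmetry is an integration by parts. For
a closed (1,1)-form `g` the cofactor matrix is divergence free (`sum_dz_cofactor`), hence `v ↦ det g
· tr (g⁻¹ √-1 ∂∂̄v)` is symmetric, first in a chart and then on `X` by a partition of unity.
Replacing `g` by `g + s ω` and differentiating in `s` gives the symmetry of the term with `ω`. A
symmetric derivative makes the integral along rays a primitive on all paths
(`hasDerivAt_jPrimitive`). Uniqueness holds because `[0, 1] · φ` stays in the space of potentials.

For convexity put `u = ∂φ/∂t = c - Λω`. Write `R₁(h)` and `R₂(ω, h)` for `detRatio₁` and `detRatio₂`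
at `g = χ_φ`, and `D₁(h) = R₂(ω, h) - c R₁(h)`. The flow equation eliminates `∂²φ/∂t²` and gives
`J'' = ∫ (2 u D₁(∂∂̄u) + u² R₁(∂∂̄u)) χⁿ`. Now `∂∂̄(u²) = 2u ∂∂̄u + 2 ∂u ∧ ∂̄u`, and by symmetry `∫
D₁(∂∂̄u²) = 0` and `∫ u R₁(∂∂̄u²) = ∫ u² R₁(∂∂̄u)`. Subtracting these two relations leaves,
pointwise, `2 (Λω · R₁(∂u ∧ ∂̄u) - R₂(ω, ∂u ∧ ∂̄u))`. This is a positive multiple of `tr (g⁻¹ ω g⁻¹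
a a*)` with `a = ∂u`, hence nonnegative (`detDeriv₂_vecMulVec_le`, `second_variation_nonneg`). -/

section Development

open Filter Topology

noncomputable section

namespace JFlow

/-! ### First and second differentials of the determinant. -/

section Determinant

variable {n : ℕ}

/-- The determinant as a function on the normed space of arrays. -/
def detFun (M : Fin n → Fin n → ℂ) : ℂ := (Matrix.of M).det

/-- The differential of the determinant. -/
def detDeriv (g h : Matrix (Fin n) (Fin n) ℂ) : ℂ :=
  fderiv ℝ detFun (Matrix.of.symm g) (Matrix.of.symm h)

/-- The second differential of the determinant. -/
def detDeriv₂ (g k h : Matrix (Fin n) (Fin n) ℂ) : ℂ :=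
  fderiv ℝ (fderiv ℝ detFun) (Matrix.of.symm g) (Matrix.of.symm k) (Matrix.of.symm h)

lemma contDiffOn_array {E : Type*} [NormedAddCommGroup E] [NormedSpace ℝ E] {k : WithTop ℕ∞}
    {s : Set E} {f : E → Matrix (Fin n) (Fin n) ℂ}
    (h : ∀ i j, ContDiffOn ℝ k (fun x => f x i j) s) :
    ContDiffOn ℝ k (fun x => Matrix.of.symm (f x)) s :=
  contDiffOn_pi.2 fun i => contDiffOn_pi.2 fun j => h i j

lemma hasDerivAt_array {f : ℝ → Matrix (Fin n) (Fin n) ℂ} {f' : Matrix (Fin n) (Fin n) ℂ}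
    {t : ℝ} (h : ∀ i j, HasDerivAt (fun x => f x i j) (f' i j) t) :
    HasDerivAt (fun x => Matrix.of.symm (f x)) (Matrix.of.symm f') t :=
  hasDerivAt_pi.2 fun i => hasDerivAt_pi.2 fun j => h i j

lemma contDiff_detFun : ContDiff ℝ ω (detFun : (Fin n → Fin n → ℂ) → ℂ) := by
  unfold detFun
  simp only [Matrix.det_apply]
  exact ContDiff.sum fun σ _ => ContDiff.const_smul _ (contDiff_prod fun i _ =>
    contDiff_apply_apply ℝ ℂ (σ i) i)

lemma contDiff_fderiv_detFun :
    ContDiff ℝ ω (fderiv ℝ (detFun : (Fin n → Fin n → ℂ) → ℂ)) :=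
  contDiff_detFun.fderiv_right (by simp)

lemma contDiff_fderiv_fderiv_detFun :
    ContDiff ℝ ω (fderiv ℝ (fderiv ℝ (detFun : (Fin n → Fin n → ℂ) → ℂ))) :=
  contDiff_fderiv_detFun.fderiv_right (by simp)

section Smooth

variable {E : Type*} [NormedAddCommGroup E] [NormedSpace ℝ E] {s : Set E}
  {g h k : E → Matrix (Fin n) (Fin n) ℂ}

lemma contDiffOn_det (hg : ∀ i j, ContDiffOn ℝ ∞ (fun x => g x i j) s) :
    ContDiffOn ℝ ∞ (fun x => (g x).det) s :=
  (contDiff_detFun.of_le le_top).comp_contDiffOn (contDiffOn_array hg)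

lemma contDiffOn_detDeriv (hg : ∀ i j, ContDiffOn ℝ ∞ (fun x => g x i j) s)
    (hh : ∀ i j, ContDiffOn ℝ ∞ (fun x => h x i j) s) :
    ContDiffOn ℝ ∞ (fun x => detDeriv (g x) (h x)) s :=
  ((contDiff_fderiv_detFun.of_le le_top).comp_contDiffOn (contDiffOn_array hg)).clm_apply
    (contDiffOn_array hh)

lemma contDiffOn_detDeriv₂ (hg : ∀ i j, ContDiffOn ℝ ∞ (fun x => g x i j) s)
    (hk : ∀ i j, ContDiffOn ℝ ∞ (fun x => k x i j) s)
    (hh : ∀ i j, ContDiffOn ℝ ∞ (fun x => h x i j) s) :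
    ContDiffOn ℝ ∞ (fun x => detDeriv₂ (g x) (k x) (h x)) s :=
  (((contDiff_fderiv_fderiv_detFun.of_le le_top).comp_contDiffOn
    (contDiffOn_array hg)).clm_apply (contDiffOn_array hk)).clm_apply (contDiffOn_array hh)

end Smooth

lemma detDeriv_add (g h k : Matrix (Fin n) (Fin n) ℂ) :
    detDeriv g (h + k) = detDeriv g h + detDeriv g k :=
  map_add (fderiv ℝ detFun (Matrix.of.symm g)) _ _

lemma detDeriv_smul (g h : Matrix (Fin n) (Fin n) ℂ) (c : ℝ) :
    detDeriv g (c • h) = c * detDeriv g h :=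
  map_smul (fderiv ℝ detFun (Matrix.of.symm g)) _ _

@[simp] lemma detDeriv_zero (g : Matrix (Fin n) (Fin n) ℂ) : detDeriv g 0 = 0 :=
  map_zero (fderiv ℝ detFun (Matrix.of.symm g))

lemma detDeriv_sum {ι : Type*} (s : Finset ι) (g : Matrix (Fin n) (Fin n) ℂ)
    (h : ι → Matrix (Fin n) (Fin n) ℂ) : detDeriv g (∑ i ∈ s, h i) = ∑ i ∈ s, detDeriv g (h i) :=
  map_sum (fderiv ℝ detFun (Matrix.of.symm g)) _ _

lemma detDeriv₂_add_left (g k l h : Matrix (Fin n) (Fin n) ℂ) :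
    detDeriv₂ g (k + l) h = detDeriv₂ g k h + detDeriv₂ g l h := by
  have := map_add (fderiv ℝ (fderiv ℝ detFun) (Matrix.of.symm g)) (Matrix.of.symm k)
    (Matrix.of.symm l)
  exact congrArg (fun f => f (Matrix.of.symm h)) this

lemma detDeriv₂_smul_left (g k h : Matrix (Fin n) (Fin n) ℂ) (c : ℝ) :
    detDeriv₂ g (c • k) h = c * detDeriv₂ g k h := by
  have := map_smul (fderiv ℝ (fderiv ℝ detFun) (Matrix.of.symm g)) c (Matrix.of.symm k)
  exact congrArg (fun f => f (Matrix.of.symm h)) this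

lemma detDeriv₂_sum_left {ι : Type*} (s : Finset ι) (g h : Matrix (Fin n) (Fin n) ℂ)
    (k : ι → Matrix (Fin n) (Fin n) ℂ) :
    detDeriv₂ g (∑ i ∈ s, k i) h = ∑ i ∈ s, detDeriv₂ g (k i) h := by
  have := map_sum (fderiv ℝ (fderiv ℝ detFun) (Matrix.of.symm g)) (fun i => Matrix.of.symm (k i)) s
  have h2 := congrArg (fun f => f (Matrix.of.symm h)) this
  simp only [sum_apply] at h2
  exact h2

lemma hasFDerivAt_detFun (g : Fin n → Fin n → ℂ) :
    HasFDerivAt detFun (fderiv ℝ detFun g) g :=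
  (contDiff_detFun.differentiable (by simp)).differentiableAt.hasFDerivAt

lemma hasFDerivAt_fderiv_detFun (g : Fin n → Fin n → ℂ) :
    HasFDerivAt (fderiv ℝ detFun) (fderiv ℝ (fderiv ℝ detFun) g) g :=
  (contDiff_fderiv_detFun.differentiable (by simp)).differentiableAt.hasFDerivAt

lemma hasDerivAt_det {g : ℝ → Matrix (Fin n) (Fin n) ℂ} {g' : Matrix (Fin n) (Fin n) ℂ} {t : ℝ}
    (hg : ∀ i j, HasDerivAt (fun s => g s i j) (g' i j) t) :
    HasDerivAt (fun s => (g s).det) (detDeriv (g t) g') t :=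
  (hasFDerivAt_detFun (Matrix.of.symm (g t))).comp_hasDerivAt t (hasDerivAt_array hg)

lemma hasDerivAt_detDeriv {g h : ℝ → Matrix (Fin n) (Fin n) ℂ}
    {g' h' : Matrix (Fin n) (Fin n) ℂ} {t : ℝ}
    (hg : ∀ i j, HasDerivAt (fun s => g s i j) (g' i j) t)
    (hh : ∀ i j, HasDerivAt (fun s => h s i j) (h' i j) t) :
    HasDerivAt (fun s => detDeriv (g s) (h s))
      (detDeriv₂ (g t) g' (h t) + detDeriv (g t) h') t :=
  ((hasFDerivAt_fderiv_detFun (Matrix.of.symm (g t))).comp_hasDerivAt t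
    (hasDerivAt_array hg)).clm_apply (hasDerivAt_array hh)

lemma hasDerivAt_add_smul (g h : Matrix (Fin n) (Fin n) ℂ) (t : ℝ) (i j : Fin n) :
    HasDerivAt (fun s : ℝ => (g + s • h) i j) (h i j) t := by
  simpa using ((hasDerivAt_id t).smul_const (h i j)).const_add (g i j)

lemma detDeriv₂_comm (g k h : Matrix (Fin n) (Fin n) ℂ) :
    detDeriv₂ g k h = detDeriv₂ g h k :=
  second_derivative_symmetric (fun y => hasFDerivAt_detFun y)
    (hasFDerivAt_fderiv_detFun (Matrix.of.symm g)) _ _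

/-- The matrix whose row `i` is `v` and whose other rows vanish. -/
def rowMatrix (i : Fin n) (v : Fin n → ℂ) : Matrix (Fin n) (Fin n) ℂ :=
  Matrix.updateRow 0 i v

lemma add_smul_rowMatrix (g : Matrix (Fin n) (Fin n) ℂ) (i : Fin n) (v : Fin n → ℂ) (s : ℝ) :
    g + s • rowMatrix i v = Matrix.updateRow g i (g i + (s : ℂ) • v) := by
  ext a b
  by_cases h : a = i
  · subst h; simp [rowMatrix]
  · simp [rowMatrix, Matrix.updateRow_ne h]

/-- The determinant is linear in row `i`, so it is affine along this line and the derivative is the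
coefficient of `s`. -/
lemma detDeriv_rowMatrix (g : Matrix (Fin n) (Fin n) ℂ) (i : Fin n) (v : Fin n → ℂ) :
    detDeriv g (rowMatrix i v) = (Matrix.updateRow g i v).det := by
  have h1 := hasDerivAt_det (hasDerivAt_add_smul g (rowMatrix i v) 0)
  have h2 : HasDerivAt (fun s : ℝ => (g + s • rowMatrix i v).det)
      (Matrix.updateRow g i v).det 0 := by
    simp only [add_smul_rowMatrix, Matrix.det_updateRow_add, Matrix.det_updateRow_smul]
    simpa using ((Complex.ofRealCLM.hasDerivAt (x := 0)).mul_const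
      (Matrix.updateRow g i v).det).const_add ((Matrix.updateRow g i (g i)).det)
  simpa using h1.unique h2

lemma hasDerivAt_detDeriv_rowMatrix (g k : Matrix (Fin n) (Fin n) ℂ) (j : Fin n) (w : Fin n → ℂ) :
    HasDerivAt (fun s : ℝ => (Matrix.updateRow (g + s • k) j w).det)
      (detDeriv₂ g k (rowMatrix j w)) 0 := by
  have h1 := hasDerivAt_detDeriv (hasDerivAt_add_smul g k 0) (fun _ _ => hasDerivAt_const 0 _)
    (h := fun _ => rowMatrix j w) (h' := 0)
  simpa [detDeriv_rowMatrix] using h1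

/-- Overwriting row `j` by `w` erases a perturbation of row `j`, so the function being
differentiated is constant. -/
lemma detDeriv₂_rowMatrix_same (g : Matrix (Fin n) (Fin n) ℂ) (j : Fin n) (v w : Fin n → ℂ) :
    detDeriv₂ g (rowMatrix j v) (rowMatrix j w) = 0 := by
  have h1 := hasDerivAt_detDeriv_rowMatrix g (rowMatrix j v) j w
  simp only [add_smul_rowMatrix, Matrix.updateRow_idem] at h1
  exact h1.unique (hasDerivAt_const _ _)

lemma detDeriv₂_rowMatrix_ne (g : Matrix (Fin n) (Fin n) ℂ) {l j : Fin n} (hlj : l ≠ j)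
    (v w : Fin n → ℂ) : detDeriv₂ g (rowMatrix l v) (rowMatrix j w) =
      (Matrix.updateRow (Matrix.updateRow g l v) j w).det := by
  have h1 := hasDerivAt_detDeriv_rowMatrix g (rowMatrix l v) j w
  simp only [add_smul_rowMatrix, Matrix.updateRow_comm g hlj, Matrix.det_updateRow_add,
    Matrix.det_updateRow_smul] at h1
  have h2 := ((Complex.ofRealCLM.hasDerivAt (x := 0)).mul_const
      ((g.updateRow j w).updateRow l v).det).const_add (((g.updateRow j w).updateRow l (g l)).det)
  rw [Matrix.updateRow_comm g hlj]
  simpa using h1.unique h2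

/-- The second differential of the determinant is alternating in the rows. -/
lemma detDeriv₂_rowMatrix_swap (g : Matrix (Fin n) (Fin n) ℂ) (l j : Fin n) (v w : Fin n → ℂ) :
    detDeriv₂ g (rowMatrix l v) (rowMatrix j w) = -detDeriv₂ g (rowMatrix j v) (rowMatrix l w) := by
  by_cases h : l = j
  · subst h; simp [detDeriv₂_rowMatrix_same]
  · rw [detDeriv₂_rowMatrix_ne g h, detDeriv₂_rowMatrix_ne g (Ne.symm h)]
    -- The two matrices differ by exchanging rows `l` and `j`, which costs the sign of a
    -- transposition.
    have hs : (Matrix.updateRow (Matrix.updateRow g l v) j w) =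
        (Matrix.updateRow (Matrix.updateRow g j v) l w).submatrix (Equiv.swap l j) id := by
      ext a b
      rcases eq_or_ne a l with rfl | hl
      · simp [Matrix.updateRow_apply, h, Ne.symm h]
      · rcases eq_or_ne a j with rfl | hj
        · simp [Matrix.updateRow_apply]
        · simp [Matrix.updateRow_apply, Equiv.swap_apply_of_ne_of_ne hl hj, hl, hj]
    rw [hs, Matrix.det_permute, Equiv.Perm.sign_swap h]
    simp

lemma eq_sum_rowMatrix (h : Matrix (Fin n) (Fin n) ℂ) : h = ∑ j, rowMatrix j (h j) := by
  ext a b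
  rw [Matrix.sum_apply, Finset.sum_eq_single a]
  · simp [rowMatrix]
  · intro c _ hc; simp [rowMatrix, Matrix.updateRow_ne (Ne.symm hc)]
  · simp

/-- Jacobi's formula, obtained by splitting `h` into rows and applying Cramer's rule to each. It
needs no invertibility of `g`. -/
lemma detDeriv_eq_trace (g h : Matrix (Fin n) (Fin n) ℂ) :
    detDeriv g h = (g.adjugate * h).trace := by
  have h1 : detDeriv g h = ∑ j, detDeriv g (rowMatrix j (h j)) := by
    conv_lhs => rw [eq_sum_rowMatrix h]
    exact detDeriv_sum _ _ _
  have h2 : ∀ j, detDeriv g (rowMatrix j (h j)) = ∑ k, g.adjugate k j * h j k := fun j => by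
    rw [detDeriv_rowMatrix, ← Matrix.cramer_transpose_apply, Matrix.cramer_eq_adjugate_mulVec,
      ← Matrix.adjugate_transpose]
    rfl
  rw [h1, Matrix.trace]
  simp only [h2, Matrix.diag_apply, Matrix.mul_apply]
  exact Finset.sum_comm

lemma detDeriv_of_isUnit {g : Matrix (Fin n) (Fin n) ℂ} (hg : IsUnit g.det)
    (h : Matrix (Fin n) (Fin n) ℂ) : detDeriv g h = g.det * (g⁻¹ * h).trace := by
  rw [detDeriv_eq_trace, Matrix.inv_def, Matrix.smul_mul, Matrix.trace_smul, smul_eq_mul,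
    ← mul_assoc, Ring.mul_inverse_cancel _ hg, one_mul]

lemma detDeriv_self_mul (g m : Matrix (Fin n) (Fin n) ℂ) :
    detDeriv g (g * m) = g.det * m.trace := by
  rw [detDeriv_eq_trace, ← mul_assoc, Matrix.adjugate_mul, Matrix.smul_mul, one_mul,
    Matrix.trace_smul, smul_eq_mul]

/-- Fix `m = g⁻¹ h` and differentiate the identity `detDeriv g (g * m) = det g · tr m` in `g` along
`k`. The left side yields the second differential plus `detDeriv g (k * m)`, which is the subtracted
trace. -/
lemma detDeriv₂_of_isUnit {g : Matrix (Fin n) (Fin n) ℂ} (hg : IsUnit g.det)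
    (k h : Matrix (Fin n) (Fin n) ℂ) : detDeriv₂ g k h =
      g.det * ((g⁻¹ * k).trace * (g⁻¹ * h).trace - (g⁻¹ * k * (g⁻¹ * h)).trace) := by
  set m := g⁻¹ * h with hm
  have hgm : g * m = h := by rw [hm, ← mul_assoc, Matrix.mul_nonsing_inv _ hg, one_mul]
  have h1 : ∀ i j, HasDerivAt (fun s : ℝ => ((g + s • k) * m) i j) ((k * m) i j) 0 := by
    simp only [add_mul, Matrix.smul_mul]
    exact hasDerivAt_add_smul (g * m) (k * m) 0
  have h2 := hasDerivAt_detDeriv (hasDerivAt_add_smul g k 0) h1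
  simp only [detDeriv_self_mul] at h2
  have h3 := (hasDerivAt_det (hasDerivAt_add_smul g k 0)).mul_const m.trace
  have h4 := h2.unique h3
  simp only [zero_smul, add_zero, hgm, detDeriv_of_isUnit hg, ← mul_assoc] at h4
  rw [eq_sub_of_add_eq h4]
  simp only [mul_assoc]
  ring

lemma hasDerivAt_conj_mul (P Q : Matrix (Fin n) (Fin n) ℂ)
    {g : ℝ → Matrix (Fin n) (Fin n) ℂ} {g' : Matrix (Fin n) (Fin n) ℂ} {t : ℝ}
    (hg : ∀ i j, HasDerivAt (fun s => g s i j) (g' i j) t) (i j : Fin n) :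
    HasDerivAt (fun s => (P * g s * Q) i j) ((P * g' * Q) i j) t := by
  simp only [Matrix.mul_apply]
  exact HasDerivAt.fun_sum fun a _ => (HasDerivAt.fun_sum fun b _ =>
    (hg b a).const_mul (P i b)).mul_const (Q a j)

/-- Differentiates `det (P g Q) = det P · det Q · det g`. The common factor is what cancels in
quotients by `det χ`, making them independent of the chart. -/
lemma detDeriv_congr (P Q g h : Matrix (Fin n) (Fin n) ℂ) :
    detDeriv (P * g * Q) (P * h * Q) = P.det * Q.det * detDeriv g h := by
  have h1 := hasDerivAt_det (hasDerivAt_conj_mul P Q (hasDerivAt_add_smul g h 0))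
  have h2 := (hasDerivAt_det (hasDerivAt_add_smul g h 0)).const_mul (P.det * Q.det)
  have h3 : (fun s : ℝ => (P * (g + s • h) * Q).det) =
      fun s : ℝ => P.det * Q.det * (g + s • h).det := by
    funext s; simp only [Matrix.det_mul]; ring
  rw [h3] at h1
  simpa using h1.unique h2

lemma detDeriv₂_congr (P Q g k h : Matrix (Fin n) (Fin n) ℂ) :
    detDeriv₂ (P * g * Q) (P * k * Q) (P * h * Q) = P.det * Q.det * detDeriv₂ g k h := by
  have h1 := hasDerivAt_detDeriv (hasDerivAt_conj_mul P Q (hasDerivAt_add_smul g k 0))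
    (fun _ _ => hasDerivAt_const 0 _)
    (h := fun _ => P * h * Q) (h' := 0)
  have h2 := (hasDerivAt_detDeriv (hasDerivAt_add_smul g k 0)
    (fun _ _ => hasDerivAt_const 0 _)
    (h := fun _ => h) (h' := 0)).const_mul (P.det * Q.det)
  simp only [detDeriv_congr] at h1
  simpa using h1.unique h2

/-- The differential is taken over `ℝ`; complex linearity is needed because Wirtinger derivatives
are complex combinations of real ones. -/
lemma detDeriv_smul_complex (g h : Matrix (Fin n) (Fin n) ℂ) (c : ℂ) :
    detDeriv g (c • h) = c * detDeriv g h := by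
  simp [detDeriv_eq_trace]

lemma detDeriv₂_eq_of_hasDerivAt {g k h : Matrix (Fin n) (Fin n) ℂ} {d : ℂ}
    (hd : HasDerivAt (fun s : ℝ => detDeriv (g + s • k) h) d 0) : detDeriv₂ g k h = d := by
  have h1 := hasDerivAt_detDeriv (hasDerivAt_add_smul g k 0)
    (fun _ _ => hasDerivAt_const 0 _)
    (h := fun _ => h) (h' := 0)
  simpa using h1.unique hd

lemma hasDerivAt_detDeriv_add_smul (g k h : Matrix (Fin n) (Fin n) ℂ) :
    HasDerivAt (fun s : ℝ => detDeriv (g + s • k) h) (detDeriv₂ g k h) 0 := by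
  have h1 := hasDerivAt_detDeriv (hasDerivAt_add_smul g k 0)
    (fun _ _ => hasDerivAt_const 0 _)
    (h := fun _ => h) (h' := 0)
  simpa using h1

lemma detDeriv₂_smul_complex (g k h : Matrix (Fin n) (Fin n) ℂ) (c : ℂ) :
    detDeriv₂ g (c • k) h = c * detDeriv₂ g k h := by
  rw [detDeriv₂_comm, detDeriv₂_comm g k]
  refine detDeriv₂_eq_of_hasDerivAt ?_
  simp only [detDeriv_smul_complex]
  exact (hasDerivAt_detDeriv_add_smul g h k).const_mul c

lemma detDeriv_transpose (g h : Matrix (Fin n) (Fin n) ℂ) :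
    detDeriv g.transpose h.transpose = detDeriv g h := by
  rw [detDeriv_eq_trace, detDeriv_eq_trace, ← Matrix.adjugate_transpose, ← Matrix.transpose_mul,
    Matrix.trace_transpose, Matrix.trace_mul_comm]

lemma detDeriv₂_transpose (g k h : Matrix (Fin n) (Fin n) ℂ) :
    detDeriv₂ g.transpose k.transpose h.transpose = detDeriv₂ g k h := by
  refine detDeriv₂_eq_of_hasDerivAt ?_
  have h1 : ∀ s : ℝ, g.transpose + s • k.transpose = (g + s • k).transpose := fun s => by
    simp
  simp only [h1, detDeriv_transpose]
  exact hasDerivAt_detDeriv_add_smul g k h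

/-- An alternating expression is summed against a symmetric one. Splitting each `s j` into rows and
exchanging `j` and `l` shows that the sum equals its own negative. With `s j = ∂_j g` the symmetry
`hs` is closedness of the form. -/
lemma sum_detDeriv₂_rowMatrix (g : Matrix (Fin n) (Fin n) ℂ) (s : Fin n → Matrix (Fin n) (Fin n) ℂ)
    (hs : ∀ j l i, s j l i = s l j i) (w : Fin n → ℂ) :
    ∑ j, detDeriv₂ g (s j) (rowMatrix j w) = 0 := by
  have h1 : ∀ j, detDeriv₂ g (s j) (rowMatrix j w) =
      ∑ l, detDeriv₂ g (rowMatrix l (s j l)) (rowMatrix j w) := fun j => by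
    conv_lhs => rw [eq_sum_rowMatrix (s j)]
    exact detDeriv₂_sum_left _ _ _ _
  have h2 : ∑ j, detDeriv₂ g (s j) (rowMatrix j w) = -∑ j, detDeriv₂ g (s j) (rowMatrix j w) := by
    simp only [h1]
    conv_lhs => rw [Finset.sum_comm]
    rw [← Finset.sum_neg_distrib]
    refine Finset.sum_congr rfl fun j _ => ?_
    rw [← Finset.sum_neg_distrib]
    refine Finset.sum_congr rfl fun l _ => ?_
    rw [detDeriv₂_rowMatrix_swap, funext (hs l j)]
  exact self_eq_neg.1 h2

/-- The coefficient of the differential of the determinant with respect to the entry `(j, k)`. -/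
def cofactor (g : Matrix (Fin n) (Fin n) ℂ) (j k : Fin n) : ℂ :=
  detDeriv g (rowMatrix j (Pi.single k 1))

lemma detDeriv_eq_sum_cofactor (g h : Matrix (Fin n) (Fin n) ℂ) :
    detDeriv g h = ∑ j, ∑ k, cofactor g j k * h j k := by
  have h0 : h = ∑ j, ∑ k, h j k • rowMatrix j (Pi.single k 1) := by
    ext a b
    simp only [Matrix.sum_apply, Matrix.smul_apply, smul_eq_mul]
    rw [Finset.sum_eq_single a, Finset.sum_eq_single b]
    · simp [rowMatrix]
    · intro c _ hc; simp [rowMatrix, Ne.symm hc]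
    · simp
    · intro c _ hc; simp [rowMatrix, Matrix.updateRow_ne (Ne.symm hc)]
    · simp
  conv_lhs => rw [h0]
  simp only [detDeriv_sum, detDeriv_smul_complex, cofactor, mul_comm]

lemma sum_detDeriv₂_transpose_rowMatrix (g : Matrix (Fin n) (Fin n) ℂ)
    (s : Fin n → Matrix (Fin n) (Fin n) ℂ) (hs : ∀ k j i, s k i j = s j i k) (j : Fin n) :
    ∑ k, detDeriv₂ g (s k) (rowMatrix j (Pi.single k 1)) = 0 := by
  have h1 : ∀ k, rowMatrix j (Pi.single k (1 : ℂ)) =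
      (rowMatrix k (Pi.single j 1)).transpose := fun k => by
    ext a b
    simp only [rowMatrix, Matrix.transpose_apply, Matrix.updateRow_apply, Pi.single_apply,
      Matrix.zero_apply]
    split_ifs <;> rfl
  have h2 := sum_detDeriv₂_rowMatrix g.transpose (fun k => (s k).transpose)
    (fun k l i => hs k l i) (Pi.single j 1)
  rw [← h2]
  refine Finset.sum_congr rfl fun k _ => ?_
  rw [h1, ← detDeriv₂_transpose, Matrix.transpose_transpose]

end Determinant

/-! ### Wirtinger calculus, with and without parameters. -/

section Wirtinger

variable {n : ℕ}

/-- The common form of the two Wirtinger derivatives: `ε = -√-1` gives `∂/∂z_j` and `ε = √-1`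
gives `∂/∂z̄_j`. -/
def wirt (ε : ℂ) (j : Fin n) (f : (Fin n → ℂ) → ℂ) (z : Fin n → ℂ) : ℂ :=
  (fderiv ℝ f z (Pi.single j 1) + ε * fderiv ℝ f z (Pi.single j Complex.I)) / 2

lemma dz_eq_wirt (j : Fin n) : dz j = wirt (n := n) (-Complex.I) j := by
  funext f z
  simp only [dz, wirt]
  ring

lemma dzbar_eq_wirt (j : Fin n) : dzbar j = wirt (n := n) Complex.I j := rfl

lemma wirt_congr {ε : ℂ} {j : Fin n} {f g : (Fin n → ℂ) → ℂ} {z : Fin n → ℂ} (h : f =ᶠ[𝓝 z] g) :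
    wirt ε j f z = wirt ε j g z := by
  simp only [wirt, h.fderiv_eq]

lemma wirt_add {ε : ℂ} {j : Fin n} {f g : (Fin n → ℂ) → ℂ} {z : Fin n → ℂ}
    (hf : DifferentiableAt ℝ f z) (hg : DifferentiableAt ℝ g z) :
    wirt ε j (fun w => f w + g w) z = wirt ε j f z + wirt ε j g z := by
  simp only [wirt, fderiv_fun_add hf hg, add_apply]
  ring

lemma wirt_mul {ε : ℂ} {j : Fin n} {f g : (Fin n → ℂ) → ℂ} {z : Fin n → ℂ}
    (hf : DifferentiableAt ℝ f z) (hg : DifferentiableAt ℝ g z) :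
    wirt ε j (fun w => f w * g w) z = f z * wirt ε j g z + wirt ε j f z * g z := by
  simp only [wirt, fderiv_fun_mul hf hg, add_apply, smul_apply, smul_eq_mul]
  ring

lemma wirt_const {ε : ℂ} {j : Fin n} {c : ℂ} {z : Fin n → ℂ} :
    wirt ε j (fun _ => c) z = 0 := by
  simp [wirt]

lemma wirt_const_mul {ε : ℂ} {j : Fin n} {c : ℂ} {f : (Fin n → ℂ) → ℂ} {z : Fin n → ℂ}
    (hf : DifferentiableAt ℝ f z) :
    wirt ε j (fun w => c * f w) z = c * wirt ε j f z := by
  rw [wirt_mul (differentiableAt_const c) hf, wirt_const]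
  ring

lemma wirt_sum {ι : Type*} {s : Finset ι} {ε : ℂ} {j : Fin n} {f : ι → (Fin n → ℂ) → ℂ}
    {z : Fin n → ℂ} (hf : ∀ i ∈ s, DifferentiableAt ℝ (f i) z) :
    wirt ε j (fun w => ∑ i ∈ s, f i w) z = ∑ i ∈ s, wirt ε j (f i) z := by
  simp only [wirt, fderiv_fun_sum hf, sum_apply, Finset.mul_sum,
    ← Finset.sum_add_distrib, ← Finset.sum_div]

lemma wirt_conj {ε : ℂ} {j : Fin n} {f : (Fin n → ℂ) → ℂ} {z : Fin n → ℂ}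
    (hf : DifferentiableAt ℝ f z) :
    wirt ε j (fun w => (starRingEnd ℂ) (f w)) z =
      (starRingEnd ℂ) (wirt ((starRingEnd ℂ) ε) j f z) := by
  have h : HasFDerivAt (fun w => (starRingEnd ℂ) (f w))
      ((Complex.conjCLE : ℂ →L[ℝ] ℂ).comp (fderiv ℝ f z)) z :=
    (Complex.conjCLE : ℂ →L[ℝ] ℂ).hasFDerivAt.comp z hf.hasFDerivAt
  have h2 : (starRingEnd ℂ) 2 = 2 := Complex.conj_ofNat 2
  simp [wirt, h.fderiv, h2]

lemma dz_conj {j : Fin n} {f : (Fin n → ℂ) → ℂ} {z : Fin n → ℂ} (hf : DifferentiableAt ℝ f z) :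
    dz j (fun w => (starRingEnd ℂ) (f w)) z = (starRingEnd ℂ) (dzbar j f z) := by
  rw [dz_eq_wirt, wirt_conj hf, dzbar_eq_wirt]
  simp

lemma dzbar_conj {j : Fin n} {f : (Fin n → ℂ) → ℂ} {z : Fin n → ℂ} (hf : DifferentiableAt ℝ f z) :
    dzbar j (fun w => (starRingEnd ℂ) (f w)) z = (starRingEnd ℂ) (dz j f z) := by
  rw [dz_eq_wirt, dzbar_eq_wirt, wirt_conj hf]
  simp

/-- A real linear map is determined by the Wirtinger derivatives. -/
lemma fderiv_eq_sum_dz (f : (Fin n → ℂ) → ℂ) (z v : Fin n → ℂ) :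
    fderiv ℝ f z v = ∑ a, (dz a f z * v a + dzbar a f z * (starRingEnd ℂ) (v a)) := by
  have hv : v = ∑ a, ((v a).re • (Pi.single a 1 : Fin n → ℂ) +
      (v a).im • (Pi.single a Complex.I : Fin n → ℂ)) := by
    funext b
    simp only [Finset.sum_apply, Pi.add_apply, Pi.smul_apply]
    rw [Finset.sum_eq_single b]
    · simp [Complex.re_add_im]
    · intro c _ hc; simp [Pi.single_eq_of_ne (Ne.symm hc)]
    · simp
  conv_lhs => rw [hv]
  rw [map_sum]
  refine Finset.sum_congr rfl fun a _ => ?_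
  rw [map_add, map_smul, map_smul]
  simp only [dz, dzbar, Complex.real_smul]
  set p := fderiv ℝ f z (Pi.single a 1)
  set q := fderiv ℝ f z (Pi.single a Complex.I)
  have h1 : v a = (v a).re + (v a).im * Complex.I := (Complex.re_add_im _).symm
  have h2 : (starRingEnd ℂ) (v a) = (v a).re - (v a).im * Complex.I :=
      Complex.ext (by simp) (by simp)
  rw [h2]
  nth_rewrite 3 [h1]
  ring_nf
  rw [Complex.I_sq]
  ring

/-- Only the variable in the open set `U` is differentiated, so `S` may be arbitrary; in particular
it may be a time interval containing its left end. -/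
lemma contDiffOn_wirt_param {P : Type*} [NormedAddCommGroup P] [NormedSpace ℝ P] {S : Set P}
    {U : Set (Fin n → ℂ)} (hU : IsOpen U) {F : P → (Fin n → ℂ) → ℂ}
    (hF : ContDiffOn ℝ ∞ (fun p : P × (Fin n → ℂ) => F p.1 p.2) (S ×ˢ U)) (ε : ℂ) (j : Fin n) :
    ContDiffOn ℝ ∞ (fun p : P × (Fin n → ℂ) => wirt ε j (F p.1) p.2) (S ×ˢ U) := by
  have key : ∀ v : Fin n → ℂ, ContDiffOn ℝ ∞
      (fun p : P × (Fin n → ℂ) => fderiv ℝ (F p.1) p.2 v) (S ×ˢ U) := by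
    intro v p hp
    have h1 : ContDiffWithinAt ℝ ∞ (fun q : P × (Fin n → ℂ) => fderivWithin ℝ (F q.1) U q.2 v)
        (S ×ˢ U) p := by
      refine ContDiffWithinAt.fderivWithin_apply (f := fun q : P × (Fin n → ℂ) => F q.1)
        (g := Prod.snd) (k := fun _ => v) (n := ∞) ?_ contDiffWithinAt_snd contDiffWithinAt_const
        hU.uniqueDiffOn (by simp) hp (fun q hq => hq.2)
      exact ContDiffWithinAt.comp (t := S ×ˢ U) (p, p.2)
        (g := fun p : P × (Fin n → ℂ) => F p.1 p.2)
        (f := fun q : (P × (Fin n → ℂ)) × (Fin n → ℂ) => (q.1.1, q.2)) (hF p hp)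
        (by fun_prop) (fun q hq => ⟨hq.1.1, hq.2⟩)
    refine h1.congr (fun q hq => ?_) ?_
    · rw [fderivWithin_of_isOpen hU hq.2]
    · rw [fderivWithin_of_isOpen hU hp.2]
  exact ((key _).add (contDiffOn_const.mul (key _))).div_const 2

lemma contDiffOn_wirt {U : Set (Fin n → ℂ)} (hU : IsOpen U) {f : (Fin n → ℂ) → ℂ}
    (hf : ContDiffOn ℝ ∞ f U) (ε : ℂ) (j : Fin n) : ContDiffOn ℝ ∞ (wirt ε j f) U := by
  have h1 : ∀ v : Fin n → ℂ, ContDiffOn ℝ ∞ (fun z => fderiv ℝ f z v) U := fun v =>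
    (hf.fderiv_of_isOpen hU (by simp)).clm_apply contDiffOn_const
  exact ((h1 _).add (contDiffOn_const.mul (h1 _))).div_const 2

lemma contDiffOn_ddbar_param {P : Type*} [NormedAddCommGroup P] [NormedSpace ℝ P] {S : Set P}
    {U : Set (Fin n → ℂ)} (hU : IsOpen U) {F : P → (Fin n → ℂ) → ℂ}
    (hF : ContDiffOn ℝ ∞ (fun p : P × (Fin n → ℂ) => F p.1 p.2) (S ×ˢ U)) (i j : Fin n) :
    ContDiffOn ℝ ∞ (fun p : P × (Fin n → ℂ) => ddbar (F p.1) p.2 i j) (S ×ˢ U) := by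
  simp only [ddbar, Matrix.of_apply, dz_eq_wirt, dzbar_eq_wirt]
  exact contDiffOn_wirt_param (F := fun p => wirt Complex.I j (F p)) hU
    (contDiffOn_wirt_param hU hF _ _) _ _

lemma contDiffOn_ddbar {U : Set (Fin n → ℂ)} (hU : IsOpen U) {f : (Fin n → ℂ) → ℂ}
    (hf : ContDiffOn ℝ ∞ f U) (i j : Fin n) : ContDiffOn ℝ ∞ (fun z => ddbar f z i j) U := by
  simp only [ddbar, Matrix.of_apply, dz_eq_wirt, dzbar_eq_wirt]
  exact contDiffOn_wirt hU (contDiffOn_wirt hU hf _ _) _ _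

lemma _root_.ContDiffOn.differentiableAt_of_isOpen {E F : Type*} [NormedAddCommGroup E]
    [NormedSpace ℝ E] [NormedAddCommGroup F] [NormedSpace ℝ F] {U : Set E} (hU : IsOpen U)
    {f : E → F} (hf : ContDiffOn ℝ ∞ f U) {z : E} (hz : z ∈ U) : DifferentiableAt ℝ f z :=
  (hf.contDiffAt (hU.mem_nhds hz)).differentiableAt (by simp)

lemma fderiv_fderiv_apply_comm {E F : Type*} [NormedAddCommGroup E]
    [NormedSpace ℝ E] [NormedAddCommGroup F] [NormedSpace ℝ F] {f : E → F} {z : E}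
    (hf : ContDiffAt ℝ ∞ f z) (v w : E) :
    fderiv ℝ (fun y => fderiv ℝ f y v) z w = fderiv ℝ (fun y => fderiv ℝ f y w) z v := by
  have hd : DifferentiableAt ℝ (fderiv ℝ f) z :=
    (hf.fderiv_right (m := ∞) (by simp)).differentiableAt (by simp)
  have hs : IsSymmSndFDerivAt ℝ f z := hf.isSymmSndFDerivAt (by
    rw [minSmoothness_of_isRCLikeNormedField]; exact ENat.LEInfty.out)
  rw [fderiv_clm_apply hd (differentiableAt_const v),
    fderiv_clm_apply hd (differentiableAt_const w)]
  simpa using hs w v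

lemma wirt_comm {ε ε' : ℂ} {j k : Fin n} {f : (Fin n → ℂ) → ℂ} {z : Fin n → ℂ}
    (hf : ContDiffAt ℝ ∞ f z) : wirt ε j (wirt ε' k f) z = wirt ε' k (wirt ε j f) z := by
  have hd : ∀ v : Fin n → ℂ, DifferentiableAt ℝ (fun y => fderiv ℝ f y v) z := fun v =>
    ((hf.fderiv_right (m := ∞) (by simp)).differentiableAt (by simp)).clm_apply
      (differentiableAt_const v)
  have h1 : ∀ (ε : ℂ) (k : Fin n) (v : Fin n → ℂ), fderiv ℝ (wirt ε k f) z v =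
      (fderiv ℝ (fun y => fderiv ℝ f y (Pi.single k 1)) z v +
        ε * fderiv ℝ (fun y => fderiv ℝ f y (Pi.single k Complex.I)) z v) / 2 := by
    intro ε k v
    have h2 : HasFDerivAt (wirt ε k f)
        ((2 : ℂ)⁻¹ • (fderiv ℝ (fun y => fderiv ℝ f y (Pi.single k 1)) z
        + ε • fderiv ℝ (fun y => fderiv ℝ f y (Pi.single k Complex.I)) z)) z := by
      have := ((hd (Pi.single k 1)).hasFDerivAt.add
        ((hd (Pi.single k Complex.I)).hasFDerivAt.const_mul ε)).const_mul ((2 : ℂ)⁻¹)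
      refine this.congr_of_eventuallyEq (Eventually.of_forall fun y => ?_)
      simp only [wirt, Pi.add_apply]
      ring
    rw [h2.fderiv]
    simp only [smul_apply, add_apply, smul_eq_mul]
    ring
  simp only [wirt] at h1 ⊢
  rw [h1, h1, h1, h1]
  rw [fderiv_fderiv_apply_comm hf (Pi.single k 1) (Pi.single j 1),
    fderiv_fderiv_apply_comm hf (Pi.single k 1) (Pi.single j Complex.I),
    fderiv_fderiv_apply_comm hf (Pi.single k Complex.I) (Pi.single j 1),
    fderiv_fderiv_apply_comm hf (Pi.single k Complex.I) (Pi.single j Complex.I)]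
  ring

/-- A Wirtinger derivative commutes with the derivative in a real parameter. -/
lemma hasDerivAt_wirt_param {I : Set ℝ} (hI : IsOpen I) {U : Set (Fin n → ℂ)} (hU : IsOpen U)
    {F : ℝ → (Fin n → ℂ) → ℂ}
    (hF : ContDiffOn ℝ ∞ (fun p : ℝ × (Fin n → ℂ) => F p.1 p.2) (I ×ˢ U)) (ε : ℂ) (j : Fin n)
    {t : ℝ} (ht : t ∈ I) {z : Fin n → ℂ} (hz : z ∈ U) :
    HasDerivAt (fun s => wirt ε j (F s) z) (wirt ε j (fun w => deriv (fun s => F s w) t) z) t := by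
  set Φ : ℝ × (Fin n → ℂ) → ℂ := fun p => F p.1 p.2
  have hopen : IsOpen (I ×ˢ U) := hI.prod hU
  have hΦ : ∀ p ∈ I ×ˢ U, HasFDerivAt Φ (fderiv ℝ Φ p) p := fun p hp =>
    (hF.differentiableAt_of_isOpen hopen hp).hasFDerivAt
  have hs : ∀ s ∈ I, ∀ w ∈ U, ∀ v, fderiv ℝ (F s) w v = fderiv ℝ Φ (s, w) (0, v) := by
    intro s hs w hw v
    have := (hΦ (s, w) ⟨hs, hw⟩).comp w (hasFDerivAt_prodMk_right s w)
    have h2 : fderiv ℝ (F s) w = _ := this.fderiv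
    rw [h2]; simp
  have hd : ∀ s ∈ I, ∀ w ∈ U, deriv (fun s => F s w) s = fderiv ℝ Φ (s, w) (1, 0) := by
    intro s hs w hw
    have := HasFDerivAt.comp (𝕜 := ℝ) s (hΦ (s, w) ⟨hs, hw⟩)
      (hasFDerivAt_prodMk_left s w)
    have h2 : HasDerivAt (fun s => F s w) _ s := this.hasDerivAt
    rw [h2.deriv]; simp
  have hΦt : ContDiffAt ℝ ∞ Φ (t, z) := hF.contDiffAt (hopen.mem_nhds ⟨ht, hz⟩)
  have hdiff : ∀ v, DifferentiableAt ℝ (fun p => fderiv ℝ Φ p v) (t, z) := fun v =>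
    ((hΦt.fderiv_right (m := ∞) (by simp)).differentiableAt (by simp)).clm_apply
      (differentiableAt_const v)
  have key : ∀ v, HasDerivAt (fun s => fderiv ℝ (F s) z v)
      (fderiv ℝ (fun w => deriv (fun s => F s w) t) z v) t := by
    intro v
    have h1 : HasDerivAt (fun s => fderiv ℝ Φ (s, z) (0, v))
        (fderiv ℝ (fun p => fderiv ℝ Φ p (0, v)) (t, z) (1, 0)) t := by
      have := ((hdiff (0, v)).hasFDerivAt.comp t (hasFDerivAt_prodMk_left t z)).hasDerivAt
      simpa using! this
    have h2 : fderiv ℝ (fun w => deriv (fun s => F s w) t) z v =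
        fderiv ℝ (fun p => fderiv ℝ Φ p (1, 0)) (t, z) (0, v) := by
      have := (hdiff (1, 0)).hasFDerivAt.comp z (hasFDerivAt_prodMk_right t z)
      have h3 := this.congr_of_eventuallyEq (f₁ := fun w => deriv (fun s => F s w) t) (by
        filter_upwards [hU.mem_nhds hz] with w hw
        simp [hd t ht w hw])
      rw [h3.fderiv]; simp
    -- Both sides are mixed second derivatives of `Φ`, in the directions `(1, 0)` and `(0, v)`.
    rw [h2, fderiv_fderiv_apply_comm hΦt]
    refine h1.congr_of_eventuallyEq ?_
    filter_upwards [hI.mem_nhds ht] with s hs'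
    exact hs s hs' z hz v
  exact ((key _).add ((key _).const_mul ε)).div_const 2

lemma hasDerivAt_ddbar_param {I : Set ℝ} (hI : IsOpen I) {U : Set (Fin n → ℂ)} (hU : IsOpen U)
    {F : ℝ → (Fin n → ℂ) → ℂ}
    (hF : ContDiffOn ℝ ∞ (fun p : ℝ × (Fin n → ℂ) => F p.1 p.2) (I ×ˢ U)) (i j : Fin n)
    {t : ℝ} (ht : t ∈ I) {z : Fin n → ℂ} (hz : z ∈ U) :
    HasDerivAt (fun s => ddbar (F s) z i j)
      (ddbar (fun w => deriv (fun s => F s w) t) z i j) t := by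
  simp only [ddbar, Matrix.of_apply, dz_eq_wirt, dzbar_eq_wirt]
  have h1 := hasDerivAt_wirt_param (F := fun s => wirt Complex.I j (F s)) hI hU
    (contDiffOn_wirt_param hU hF Complex.I j)
    (-Complex.I) i ht hz
  refine h1.congr_deriv (wirt_congr ?_)
  filter_upwards [hU.mem_nhds hz] with w hw
  exact (hasDerivAt_wirt_param hI hU hF _ _ ht hw).deriv

end Wirtinger

/-! ### Integration by parts in one chart. -/

section LocalStokes

variable {n : ℕ}

/-- Extension by zero: near a point outside `U` the function vanishes, since such a point lies in
the open complement of `K`. -/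
lemma contDiff_indicator_of_compact {E F : Type*} [NormedAddCommGroup E] [NormedSpace ℝ E]
    [NormedAddCommGroup F] [NormedSpace ℝ F] {U K : Set E} (hU : IsOpen U) (hK : IsCompact K)
    (hKU : K ⊆ U) {f : E → F} (hf : ContDiffOn ℝ ∞ f U) (h0 : ∀ z ∈ U, z ∉ K → f z = 0) :
    ContDiff ℝ ∞ (U.indicator f) ∧ HasCompactSupport (U.indicator f) := by
  have h0' : ∀ z, z ∉ K → U.indicator f z = 0 := fun z hz => by
    by_cases hzU : z ∈ U
    · rw [indicator_of_mem hzU, h0 z hzU hz]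
    · exact indicator_of_notMem hzU f
  refine ⟨contDiff_iff_contDiffAt.2 fun z => ?_, HasCompactSupport.intro hK h0'⟩
  by_cases hz : z ∈ U
  · refine (hf.contDiffAt (hU.mem_nhds hz)).congr_of_eventuallyEq ?_
    filter_upwards [hU.mem_nhds hz] with w hw using indicator_of_mem hw f
  · have hzK : z ∉ K := fun h => hz (hKU h)
    refine contDiffAt_const.congr_of_eventuallyEq (f := fun _ => (0 : F)) ?_
    filter_upwards [hK.isClosed.isOpen_compl.mem_nhds hzK] with w hw using h0' w hw

lemma integral_fderiv_eq_zero {f : (Fin n → ℂ) → ℂ} (hf : ContDiff ℝ ∞ f)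
    (hc : HasCompactSupport f) (v : Fin n → ℂ) : ∫ z, fderiv ℝ f z v = 0 := by
  have h1 : Continuous (fun z => fderiv ℝ f z v) :=
    (hf.continuous_fderiv (by simp)).clm_apply continuous_const
  have h2 : HasCompactSupport (fun z => fderiv ℝ f z v) := hc.fderiv_apply (𝕜 := ℝ) v
  -- Integration by parts against the constant function `1`, whose derivative vanishes.
  have h3 := integral_mul_fderiv_eq_neg_fderiv_mul_of_integrable (μ := volume) (v := v)
    (f := fun _ : Fin n → ℂ => (1 : ℂ)) (g := f) (by simp)
    (by simpa using h1.integrable_of_hasCompactSupport h2)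
    (by simpa using hf.continuous.integrable_of_hasCompactSupport hc)
    (fun _ _ => differentiableAt_const _) (fun z _ => (hf.differentiable (by simp)) z)
  simpa using h3

lemma setIntegral_wirt_eq_zero {U K : Set (Fin n → ℂ)} (hU : IsOpen U) (hK : IsCompact K)
    (hKU : K ⊆ U) {f : (Fin n → ℂ) → ℂ} (hf : ContDiffOn ℝ ∞ f U)
    (h0 : ∀ z ∈ U, z ∉ K → f z = 0) (ε : ℂ) (j : Fin n) :
    IntegrableOn (wirt ε j f) U ∧ ∫ z in U, wirt ε j f z = 0 := by
  obtain ⟨h1, h2⟩ := contDiff_indicator_of_compact hU hK hKU hf h0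
  set F := U.indicator f with hF
  have h3 : EqOn (wirt ε j f) (wirt ε j F) U := fun z hz => wirt_congr (by
    filter_upwards [hU.mem_nhds hz] with w hw using (indicator_of_mem hw f).symm)
  have hc : ∀ v : Fin n → ℂ, Integrable (fun z => fderiv ℝ F z v) := fun v =>
    ((h1.continuous_fderiv (by simp)).clm_apply continuous_const).integrable_of_hasCompactSupport
      (h2.fderiv_apply (𝕜 := ℝ) v)
  have hi : Integrable (wirt ε j F) := ((hc _).add ((hc _).const_mul ε)).div_const 2
  refine ⟨hi.integrableOn.congr_fun h3.symm hU.measurableSet, ?_⟩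
  rw [setIntegral_congr_fun hU.measurableSet h3, setIntegral_eq_integral_of_forall_compl_eq_zero]
  · simp only [wirt]
    rw [integral_div, integral_add (hc _) ((hc _).const_mul ε), integral_const_mul,
      integral_fderiv_eq_zero h1 h2, integral_fderiv_eq_zero h1 h2]
    simp
  · intro z hz
    have hzK : z ∉ K := fun h => hz (hKU h)
    have : F =ᶠ[𝓝 z] fun _ => 0 := by
      filter_upwards [hK.isClosed.isOpen_compl.mem_nhds hzK] with w hw
      by_cases hwU : w ∈ U
      · rw [hF, indicator_of_mem hwU, h0 w hwU hw]
      · exact indicator_of_notMem hwU f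
    rw [wirt_congr this, wirt_const]

lemma contDiffOn_cofactor {E : Type*} [NormedAddCommGroup E] [NormedSpace ℝ E] {s : Set E}
    {g : E → Matrix (Fin n) (Fin n) ℂ} (hg : ∀ i j, ContDiffOn ℝ ∞ (fun x => g x i j) s)
    (j k : Fin n) : ContDiffOn ℝ ∞ (fun x => cofactor (g x) j k) s :=
  contDiffOn_detDeriv hg fun _ _ => contDiffOn_const

/-- The chain rule is applied along real lines; the two real directions are then combined by complex
linearity of `detDeriv₂` in the direction of differentiation. -/
lemma wirt_cofactor {g : (Fin n → ℂ) → Matrix (Fin n) (Fin n) ℂ} {U : Set (Fin n → ℂ)}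
    (hU : IsOpen U) (hg : ∀ i j, ContDiffOn ℝ ∞ (fun x => g x i j) U) {z : Fin n → ℂ}
    (hz : z ∈ U) (ε : ℂ) (l j k : Fin n) :
    wirt ε l (fun w => cofactor (g w) j k) z =
      detDeriv₂ (g z) (Matrix.of fun a b => wirt ε l (fun w => g w a b) z)
        (rowMatrix j (Pi.single k 1)) := by
  have hd : ∀ v : Fin n → ℂ, fderiv ℝ (fun w => cofactor (g w) j k) z v =
      detDeriv₂ (g z) (Matrix.of fun a b => fderiv ℝ (fun w => g w a b) z v)
        (rowMatrix j (Pi.single k 1)) := by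
    intro v
    have hline : HasDerivAt (fun t : ℝ => z + t • v) v 0 := by
      simpa using ((hasDerivAt_id (0 : ℝ)).smul_const v).const_add z
    have h1 : ∀ a b, HasDerivAt (fun t : ℝ => g (z + t • v) a b)
        ((Matrix.of fun a b => fderiv ℝ (fun w => g w a b) z v) a b) 0 := fun a b =>
      HasFDerivAt.comp_hasDerivAt_of_eq (0 : ℝ)
        ((hg a b).differentiableAt_of_isOpen hU hz).hasFDerivAt hline (by simp)
    have h2 := hasDerivAt_detDeriv h1 (fun _ _ => hasDerivAt_const 0 _)
      (h := fun _ => rowMatrix j (Pi.single k 1)) (h' := 0)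
    have h3 : HasDerivAt (fun t : ℝ => cofactor (g (z + t • v)) j k)
        (fderiv ℝ (fun w => cofactor (g w) j k) z v) 0 :=
      HasFDerivAt.comp_hasDerivAt_of_eq (0 : ℝ)
        ((contDiffOn_cofactor hg j k).differentiableAt_of_isOpen hU hz).hasFDerivAt hline (by simp)
    simpa using h3.unique h2
  simp only [wirt]
  rw [hd, hd, ← detDeriv₂_smul_complex, ← detDeriv₂_add_left, div_eq_inv_mul,
    ← detDeriv₂_smul_complex]
  congr 1
  ext a b
  simp [div_eq_inv_mul]

/-- For a closed form, the cofactor matrix is divergence free. -/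
lemma sum_dz_cofactor {g : (Fin n → ℂ) → Matrix (Fin n) (Fin n) ℂ} {U : Set (Fin n → ℂ)}
    (hU : IsOpen U) (hg : ∀ i j, ContDiffOn ℝ ∞ (fun x => g x i j) U)
    (hcl : ∀ z ∈ U, ∀ i j k, dz k (fun w => g w i j) z = dz i (fun w => g w k j) z)
    {z : Fin n → ℂ} (hz : z ∈ U) (k : Fin n) :
    ∑ j, dz j (fun w => cofactor (g w) j k) z = 0 := by
  simp only [dz_eq_wirt] at hcl ⊢
  simp only [wirt_cofactor hU hg hz]
  exact sum_detDeriv₂_rowMatrix _ _ (fun j l i => hcl z hz l i j) _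

lemma sum_dzbar_cofactor {g : (Fin n → ℂ) → Matrix (Fin n) (Fin n) ℂ} {U : Set (Fin n → ℂ)}
    (hU : IsOpen U) (hg : ∀ i j, ContDiffOn ℝ ∞ (fun x => g x i j) U)
    (hcl : ∀ z ∈ U, ∀ i j k, dzbar k (fun w => g w i j) z = dzbar j (fun w => g w i k) z)
    {z : Fin n → ℂ} (hz : z ∈ U) (j : Fin n) :
    ∑ k, dzbar k (fun w => cofactor (g w) j k) z = 0 := by
  simp only [dzbar_eq_wirt] at hcl ⊢
  simp only [wirt_cofactor hU hg hz]
  exact sum_detDeriv₂_transpose_rowMatrix _ _ (fun k j i => hcl z hz i j k) _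

/-- Conjugating a Hermitian matrix exchanges its indices and turns `∂` into `∂̄`, so the conjugate
of `dz`-closedness is the closedness in the other index. -/
lemma dzbar_closed {g : (Fin n → ℂ) → Matrix (Fin n) (Fin n) ℂ} {U : Set (Fin n → ℂ)}
    (hU : IsOpen U) (hg : ∀ i j, ContDiffOn ℝ ∞ (fun x => g x i j) U)
    (hherm : ∀ z ∈ U, (g z).IsHermitian)
    (hcl : ∀ z ∈ U, ∀ i j k, dz k (fun w => g w i j) z = dz i (fun w => g w k j) z) :
    ∀ z ∈ U, ∀ i j k, dzbar k (fun w => g w i j) z = dzbar j (fun w => g w i k) z := by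
  intro z hz i j k
  have h1 : ∀ i j k, dzbar k (fun w => g w i j) z =
      (starRingEnd ℂ) (dz k (fun w => g w j i) z) := by
    intro i j k
    rw [← dzbar_conj ((hg j i).differentiableAt_of_isOpen hU hz)]
    refine wirt_congr ?_
    filter_upwards [hU.mem_nhds hz] with w hw
    exact ((hherm w hw).apply i j).symm
  rw [h1, h1, hcl z hz]

/-- The operator `v ↦ det g · tr (g⁻¹ √-1 ∂∂̄v)` of a closed form is symmetric. -/
lemma setIntegral_detDeriv_ddbar_comm {g : (Fin n → ℂ) → Matrix (Fin n) (Fin n) ℂ}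
    {U K : Set (Fin n → ℂ)} (hU : IsOpen U) (hK : IsCompact K) (hKU : K ⊆ U)
    (hg : ∀ i j, ContDiffOn ℝ ∞ (fun x => g x i j) U)
    (hherm : ∀ z ∈ U, (g z).IsHermitian)
    (hcl : ∀ z ∈ U, ∀ i j k, dz k (fun w => g w i j) z = dz i (fun w => g w k j) z)
    {u v : (Fin n → ℂ) → ℂ} (hu : ContDiffOn ℝ ∞ u U) (hv : ContDiffOn ℝ ∞ v U)
    (h0 : ∀ z ∈ U, z ∉ K → u z = 0) :
    IntegrableOn (fun z => u z * detDeriv (g z) (ddbar v z) - v z * detDeriv (g z) (ddbar u z)) U ∧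
    ∫ z in U, (u z * detDeriv (g z) (ddbar v z) - v z * detDeriv (g z) (ddbar u z)) = 0 := by
  -- The integrand is `∑ (∂_j W_{jk} - ∂̄_k V_{jk})`: the cross terms `∂_j u · cof_{jk} · ∂̄_k v`
  -- cancel, and the terms with a derivative of the cofactors sum to zero. Compact support of `u`
  -- alone makes both fields compactly supported.
  set W : Fin n → Fin n → (Fin n → ℂ) → ℂ :=
    fun j k z => u z * (cofactor (g z) j k * dzbar k v z) with hW
  set V : Fin n → Fin n → (Fin n → ℂ) → ℂ :=
    fun j k z => v z * (cofactor (g z) j k * dz j u z) with hV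
  have hdu : ∀ j, ContDiffOn ℝ ∞ (dz j u) U := fun j => by
    rw [dz_eq_wirt]; exact contDiffOn_wirt hU hu _ _
  have hdv : ∀ j, ContDiffOn ℝ ∞ (dzbar j v) U := fun j => contDiffOn_wirt hU hv _ _
  have hco := contDiffOn_cofactor hg
  have hWs : ∀ j k, ContDiffOn ℝ ∞ (W j k) U := fun j k => hu.mul ((hco j k).mul (hdv k))
  have hVs : ∀ j k, ContDiffOn ℝ ∞ (V j k) U := fun j k => hv.mul ((hco j k).mul (hdu j))
  have hW0 : ∀ j k, ∀ z ∈ U, z ∉ K → W j k z = 0 := fun j k z hz hzK => by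
    simp [hW, h0 z hz hzK]
  have hV0 : ∀ j k, ∀ z ∈ U, z ∉ K → V j k z = 0 := fun j k z hz hzK => by
    have h1 : u =ᶠ[𝓝 z] fun _ => 0 := by
      filter_upwards [hU.mem_nhds hz, hK.isClosed.isOpen_compl.mem_nhds hzK] with w hw hwK
      exact h0 w hw hwK
    have h2 : dz j u z = 0 := by rw [dz_eq_wirt, wirt_congr h1, wirt_const]
    simp [hV, h2]
  have hWi := fun j k => setIntegral_wirt_eq_zero hU hK hKU (hWs j k) (hW0 j k) (-Complex.I) j
  have hVi := fun j k => setIntegral_wirt_eq_zero hU hK hKU (hVs j k) (hV0 j k) Complex.I k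
  have hpt : EqOn (fun z => u z * detDeriv (g z) (ddbar v z) - v z * detDeriv (g z) (ddbar u z))
      (fun z => ∑ j, ∑ k, (wirt (-Complex.I) j (W j k) z - wirt Complex.I k (V j k) z)) U := by
    intro z hz
    have d {f : (Fin n → ℂ) → ℂ} (hf : ContDiffOn ℝ ∞ f U) : DifferentiableAt ℝ f z :=
      hf.differentiableAt_of_isOpen hU hz
    have e1 : ∀ j k, wirt (-Complex.I) j (W j k) z =
        u z * (cofactor (g z) j k * ddbar v z j k) +
        u z * (dz j (fun w => cofactor (g w) j k) z * dzbar k v z) +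
        dz j u z * (cofactor (g z) j k * dzbar k v z) := by
      intro j k
      have hm : DifferentiableAt ℝ (fun w => cofactor (g w) j k * dzbar k v w) z :=
        d ((hco j k).mul (hdv k))
      simp only [hW]
      rw [wirt_mul (d hu) hm, wirt_mul (d (hco j k)) (d (hdv k))]
      simp only [ddbar, Matrix.of_apply, dz_eq_wirt]
      ring
    have e2 : ∀ j k, wirt Complex.I k (V j k) z =
        v z * (cofactor (g z) j k * ddbar u z j k) +
        v z * (dzbar k (fun w => cofactor (g w) j k) z * dz j u z) +
        dz j u z * (cofactor (g z) j k * dzbar k v z) := by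
      intro j k
      have e3 : ddbar u z j k = wirt Complex.I k (dz j u) z := by
        simp only [ddbar, Matrix.of_apply, dz_eq_wirt, dzbar_eq_wirt]
        exact wirt_comm (hu.contDiffAt (hU.mem_nhds hz))
      have hm : DifferentiableAt ℝ (fun w => cofactor (g w) j k * dz j u w) z :=
        d ((hco j k).mul (hdu j))
      simp only [hV]
      rw [wirt_mul (d hv) hm, wirt_mul (d (hco j k)) (d (hdu j)), e3]
      simp only [dzbar_eq_wirt]
      ring
    have s1 : ∑ j, ∑ k, u z * (dz j (fun w => cofactor (g w) j k) z * dzbar k v z) = 0 := by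
      rw [Finset.sum_comm]
      refine Finset.sum_eq_zero fun k _ => ?_
      rw [← Finset.mul_sum, ← Finset.sum_mul, sum_dz_cofactor hU hg hcl hz]
      simp
    have s2 : ∑ j, ∑ k, v z * (dzbar k (fun w => cofactor (g w) j k) z * dz j u z) = 0 := by
      refine Finset.sum_eq_zero fun k _ => ?_
      rw [← Finset.mul_sum, ← Finset.sum_mul,
        sum_dzbar_cofactor hU hg (dzbar_closed hU hg hherm hcl) hz]
      simp
    simp only [e1, e2, Finset.sum_sub_distrib, Finset.sum_add_distrib, s1, s2,
      detDeriv_eq_sum_cofactor, Finset.mul_sum]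
    ring
  refine ⟨IntegrableOn.congr_fun (integrable_finsetSum _ fun j _ => integrable_finsetSum _
    fun k _ => (hWi j k).1.sub (hVi j k).1) hpt.symm hU.measurableSet, ?_⟩
  rw [setIntegral_congr_fun hU.measurableSet hpt, integral_finsetSum]
  · refine Finset.sum_eq_zero fun j _ => ?_
    rw [integral_finsetSum]
    · refine Finset.sum_eq_zero fun k _ => ?_
      rw [integral_sub (hWi j k).1 (hVi j k).1, (hWi j k).2, (hVi j k).2, sub_zero]
    · exact fun k _ => (hWi j k).1.sub (hVi j k).1
  · exact fun j _ => integrable_finsetSum _ fun k _ => (hWi j k).1.sub (hVi j k).1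

end LocalStokes

/-! ### Chain rule for holomorphic coordinate changes. -/

section Holomorphic

variable {n : ℕ}

/-- The two factors `(1 ± ε √-1) / 2` are `1` and `0` for `ε = -√-1`, and `0` and `1` for `ε = √-1`.
So `∂` and `∂̄` do not mix under a holomorphic `T`. -/
lemma wirt_comp {T : (Fin n → ℂ) → Fin n → ℂ} {f : (Fin n → ℂ) → ℂ} {z : Fin n → ℂ}
    (hT : DifferentiableAt ℂ T z) (hf : DifferentiableAt ℝ f (T z)) (ε : ℂ) (j : Fin n) :
    wirt ε j (fun w => f (T w)) z = ∑ a,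
      (dz a f (T z) * ((1 + ε * Complex.I) / 2 * fderiv ℂ T z (Pi.single j 1) a) +
        dzbar a f (T z) * ((1 - ε * Complex.I) / 2 *
          (starRingEnd ℂ) (fderiv ℂ T z (Pi.single j 1) a))) := by
  have h1 : ∀ v, fderiv ℝ (fun w => f (T w)) z v = fderiv ℝ f (T z) (fderiv ℂ T z v) := by
    intro v
    have := (hf.hasFDerivAt.comp z (hT.hasFDerivAt.restrictScalars ℝ))
    have h2 : fderiv ℝ (fun w => f (T w)) z = _ := this.fderiv
    rw [h2]; rfl
  have h2 : (Pi.single j Complex.I : Fin n → ℂ) = Complex.I • Pi.single j 1 := by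
    rw [← Pi.single_smul]; simp
  simp only [wirt, h1]
  rw [h2, map_smul, fderiv_eq_sum_dz, fderiv_eq_sum_dz, Finset.mul_sum, ← Finset.sum_add_distrib,
    Finset.sum_div]
  refine Finset.sum_congr rfl fun a _ => ?_
  simp only [Pi.smul_apply, smul_eq_mul, map_mul, Complex.conj_I]
  ring

lemma dz_comp {T : (Fin n → ℂ) → Fin n → ℂ} {f : (Fin n → ℂ) → ℂ} {z : Fin n → ℂ}
    (hT : DifferentiableAt ℂ T z) (hf : DifferentiableAt ℝ f (T z)) (j : Fin n) :
    dz j (fun w => f (T w)) z = ∑ a, dz a f (T z) * fderiv ℂ T z (Pi.single j 1) a := by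
  rw [dz_eq_wirt, wirt_comp hT hf]
  refine Finset.sum_congr rfl fun a _ => ?_
  rw [dz_eq_wirt]
  simp

lemma dzbar_comp {T : (Fin n → ℂ) → Fin n → ℂ} {f : (Fin n → ℂ) → ℂ} {z : Fin n → ℂ}
    (hT : DifferentiableAt ℂ T z) (hf : DifferentiableAt ℝ f (T z)) (j : Fin n) :
    dzbar j (fun w => f (T w)) z =
      ∑ a, dzbar a f (T z) * (starRingEnd ℂ) (fderiv ℂ T z (Pi.single j 1) a) := by
  rw [dzbar_eq_wirt, wirt_comp hT hf]
  refine Finset.sum_congr rfl fun a _ => ?_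
  simp

lemma dzbar_eq_zero {f : (Fin n → ℂ) → ℂ} {z : Fin n → ℂ} (hf : DifferentiableAt ℂ f z)
    (j : Fin n) : dzbar j f z = 0 := by
  have h2 : (Pi.single j Complex.I : Fin n → ℂ) = Complex.I • Pi.single j 1 := by
    rw [← Pi.single_smul]; simp
  rw [dzbar, hf.fderiv_restrictScalars ℝ, h2]
  simp only [ContinuousLinearMap.coe_restrictScalars', map_smul, smul_eq_mul]
  rw [← mul_assoc, Complex.I_mul_I]
  simp

/-- The chain rule for `√-1 ∂∂̄` and a holomorphic map. -/
lemma ddbar_comp {O U : Set (Fin n → ℂ)} (hO : IsOpen O) (hU : IsOpen U)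
    {T : (Fin n → ℂ) → Fin n → ℂ} (hT : ContDiffOn ℂ ω T O) (hTU : MapsTo T O U)
    {f : (Fin n → ℂ) → ℂ} (hf : ContDiffOn ℝ ∞ f U) {z : Fin n → ℂ} (hz : z ∈ O) :
    ddbar (fun w => f (T w)) z =
      (LinearMap.toMatrix' (fderiv ℂ T z : (Fin n → ℂ) →ₗ[ℂ] Fin n → ℂ)).transpose *
        ddbar f (T z) *
      (LinearMap.toMatrix' (fderiv ℂ T z :
        (Fin n → ℂ) →ₗ[ℂ] Fin n → ℂ)).transpose.conjTranspose := by
  have hTd : ∀ w ∈ O, DifferentiableAt ℂ T w := fun w hw =>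
    (hT.contDiffAt (hO.mem_nhds hw)).differentiableAt (by simp)
  have hJ : ∀ a j, DifferentiableAt ℂ (fun w => fderiv ℂ T w (Pi.single j 1) a) z := by
    intro a j
    have h1 : DifferentiableAt ℂ (fderiv ℂ T) z :=
      ((hT.contDiffAt (hO.mem_nhds hz)).fderiv_right (m := ω) (by simp)).differentiableAt (by simp)
    exact differentiableAt_pi.1 (h1.clm_apply (differentiableAt_const _)) a
  have hJr : ∀ a j, DifferentiableAt ℝ
      (fun w => (starRingEnd ℂ) (fderiv ℂ T w (Pi.single j 1) a)) z := fun a j =>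
    (Complex.conjCLE : ℂ →L[ℝ] ℂ).differentiableAt.comp z ((hJ a j).restrictScalars ℝ)
  have hdf : ∀ b, ContDiffOn ℝ ∞ (dzbar b f) U := fun b => contDiffOn_wirt hU hf _ _
  have hdfT : ∀ b, DifferentiableAt ℝ (fun w => dzbar b f (T w)) z := fun b =>
    ((hdf b).differentiableAt_of_isOpen hU (hTU hz)).comp z ((hTd z hz).restrictScalars ℝ)
  ext j k
  have e1 : dzbar k (fun w => f (T w)) =ᶠ[𝓝 z]
      fun w => ∑ b, dzbar b f (T w) * (starRingEnd ℂ) (fderiv ℂ T w (Pi.single k 1) b) := by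
    filter_upwards [hO.mem_nhds hz] with w hw
    exact dzbar_comp (hTd w hw) (hf.differentiableAt_of_isOpen hU (hTU hw)) k
  have e2 : ∀ b, dz j (fun w => dzbar b f (T w) *
      (starRingEnd ℂ) (fderiv ℂ T w (Pi.single k 1) b)) z =
      (∑ a, dz a (dzbar b f) (T z) * fderiv ℂ T z (Pi.single j 1) a) *
        (starRingEnd ℂ) (fderiv ℂ T z (Pi.single k 1) b) := by
    intro b
    -- The conjugate Jacobian is antiholomorphic, so `∂_j` does not see it and no term with second
    -- derivatives of `T` appears.
    have e3 : dz j (fun w => (starRingEnd ℂ) (fderiv ℂ T w (Pi.single k 1) b)) z = 0 := by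
      rw [dz_conj ((hJ b k).restrictScalars ℝ), dzbar_eq_zero (hJ b k), map_zero]
    rw [← dz_comp (hTd z hz) ((hdf b).differentiableAt_of_isOpen hU (hTU hz))]
    rw [dz_eq_wirt] at e3 ⊢
    rw [wirt_mul (hdfT b) (hJr b k), e3]
    ring
  simp only [ddbar, Matrix.of_apply]
  rw [dz_eq_wirt, wirt_congr e1, wirt_sum fun b _ => (hdfT b).fun_mul (hJr b k), ← dz_eq_wirt]
  simp only [e2, Matrix.mul_apply, Matrix.of_apply, Matrix.conjTranspose_apply,
    Matrix.transpose_apply, LinearMap.toMatrix'_apply, ContinuousLinearMap.coe_coe]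
  refine Finset.sum_congr rfl fun b _ => ?_
  congr 1
  exact Finset.sum_congr rfl fun a _ => mul_comm _ _

end Holomorphic

/-! ### Functions and (1,1)-forms on `X`, and their smooth families, read in charts. -/

/-- The form `√-1 ∂∂̄φ`. -/
def ddbarForm {n : ℕ} {X : Type*} [TopologicalSpace X] (φ : X → ℝ) : LocalCoeff n X :=
  fun e z => ddbar (fun w => (φ (e.symm w) : ℂ)) z

lemma deform_eq {n : ℕ} {X : Type*} [TopologicalSpace X] (χ : LocalCoeff n X) (φ : X → ℝ) :
    deform χ φ = χ + ddbarForm φ := rfl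

section Charts

variable {n : ℕ} {X : Type*} [TopologicalSpace X] [ChartedSpace (Fin n → ℂ) X]

lemma contDiffOn_transition [IsManifold 𝓘(ℂ, Fin n → ℂ) ω X]
    {e e' : OpenPartialHomeomorph X (Fin n → ℂ)} (he : e ∈ atlas (Fin n → ℂ) X)
    (he' : e' ∈ atlas (Fin n → ℂ) X) :
    ContDiffOn ℂ ω (fun w => e' (e.symm w)) (e.symm.trans e').source := by
  have h := (contDiffGroupoid ω 𝓘(ℂ, Fin n → ℂ)).compatible he he'
  rw [contDiffGroupoid, mem_groupoid_of_pregroupoid, contDiffPregroupoid] at h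
  simpa using! h.1

lemma isManifold_real [IsManifold 𝓘(ℂ, Fin n → ℂ) ω X] : IsManifold 𝓘(ℝ, Fin n → ℂ) ∞ X := by
  refine isManifold_of_contDiffOn _ _ _ fun e e' he he' => ?_
  have := ((contDiffOn_transition he he').restrict_scalars ℝ).of_le (m := ∞) le_top
  simpa using! this

/-- Functions that are smooth in every chart, with a parameter in a set `S`. -/
def SmoothFamily {P : Type*} [NormedAddCommGroup P] [NormedSpace ℝ P] (n : ℕ) {X : Type*}
    [TopologicalSpace X] [ChartedSpace (Fin n → ℂ) X] (S : Set P) (f : P → X → ℝ) : Prop :=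
  ∀ e ∈ atlas (Fin n → ℂ) X,
    ContDiffOn ℝ ∞ (fun p : P × (Fin n → ℂ) => f p.1 (e.symm p.2)) (S ×ˢ e.target)

/-- Functions that are smooth in every chart. -/
def ChartSmooth (n : ℕ) {X : Type*} [TopologicalSpace X] [ChartedSpace (Fin n → ℂ) X]
    (f : X → ℝ) : Prop :=
  ∀ e ∈ atlas (Fin n → ℂ) X, ContDiffOn ℝ ∞ (fun z => f (e.symm z)) e.target

/-- The transformation rule of a form of type `(1,1)`. -/
def Glues (α : LocalCoeff n X) : Prop :=
  ∀ e ∈ atlas (Fin n → ℂ) X, ∀ e' ∈ atlas (Fin n → ℂ) X, ∀ x ∈ e.source ∩ e'.source,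
    α e (e x) = (jacobian e e' (e x)).transpose * α e' (e' x) *
      (jacobian e e' (e x)).transpose.conjTranspose

/-- A family of smooth forms of type `(1,1)`. -/
structure FormFamily {P : Type*} [NormedAddCommGroup P] [NormedSpace ℝ P] (S : Set P)
    (α : P → LocalCoeff n X) : Prop where
  smooth : ∀ e ∈ atlas (Fin n → ℂ) X, ∀ i j,
    ContDiffOn ℝ ∞ (fun p : P × (Fin n → ℂ) => α p.1 e p.2 i j) (S ×ˢ e.target)
  glues : ∀ p ∈ S, Glues (α p)

variable {P : Type*} [NormedAddCommGroup P] [NormedSpace ℝ P] {S : Set P}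

lemma IsSmooth.chartSmooth [IsManifold 𝓘(ℂ, Fin n → ℂ) ω X] {φ : X → ℝ} (h : IsSmooth n φ) :
    ChartSmooth n φ := by
  have : IsManifold 𝓘(ℝ, Fin n → ℂ) ∞ X := isManifold_real
  intro e he
  have h1 := contMDiffOn_symm_of_mem_maximalAtlas (I := 𝓘(ℝ, Fin n → ℂ)) (n := ∞)
    (IsManifold.subset_maximalAtlas he)
  exact (h.comp_contMDiffOn h1).contDiffOn

lemma smoothFamily_of_contMDiffOn [IsManifold 𝓘(ℂ, Fin n → ℂ) ω X] {S : Set ℝ} {φ : ℝ → X → ℝ}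
    (h : ContMDiffOn (𝓘(ℝ, ℝ).prod 𝓘(ℝ, Fin n → ℂ)) 𝓘(ℝ, ℝ) ∞ (fun p : ℝ × X => φ p.1 p.2)
      (S ×ˢ univ)) : SmoothFamily n S φ := by
  have : IsManifold 𝓘(ℝ, Fin n → ℂ) ∞ X := isManifold_real
  intro e he
  have h1 := contMDiffOn_symm_of_mem_maximalAtlas (I := 𝓘(ℝ, Fin n → ℂ)) (n := ∞)
    (IsManifold.subset_maximalAtlas he)
  have h2 : ContMDiffOn (𝓘(ℝ, ℝ).prod 𝓘(ℝ, Fin n → ℂ)) (𝓘(ℝ, ℝ).prod 𝓘(ℝ, Fin n → ℂ)) ∞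
      (fun p : ℝ × (Fin n → ℂ) => (p.1, e.symm p.2)) (S ×ˢ e.target) :=
    ContMDiffOn.prodMk contMDiffOn_fst (h1.comp contMDiffOn_snd fun p hp => hp.2)
  have h3 := h.comp h2 (fun p hp => ⟨hp.1, mem_univ _⟩)
  rw [← modelWithCornersSelf_prod, chartedSpaceSelf_prod] at h3
  exact h3.contDiffOn

lemma ChartSmooth.smoothFamily {f : X → ℝ} (hf : ChartSmooth n f) :
    SmoothFamily n S (fun _ => f) := fun e he =>
  (hf e he).comp contDiffOn_snd fun _ hp => hp.2

lemma SmoothFamily.chartSmooth {f : P → X → ℝ} (hf : SmoothFamily n S f) {p : P} (hp : p ∈ S) :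
    ChartSmooth n (f p) := fun e he =>
  ContDiffOn.comp (t := S ×ˢ e.target) (f := fun z => (p, z)) (hf e he)
    (contDiffOn_const.prodMk contDiffOn_id) fun _ hz => ⟨hp, hz⟩

lemma SmoothFamily.comp {Q : Type*} [NormedAddCommGroup Q] [NormedSpace ℝ Q] {R : Set Q}
    {f : P → X → ℝ} (hf : SmoothFamily n S f) {a : Q → P} (ha : ContDiff ℝ ∞ a)
    (hR : MapsTo a R S) : SmoothFamily n R (fun q => f (a q)) := fun e he =>
  ContDiffOn.comp (t := S ×ˢ e.target) (f := fun q : Q × (Fin n → ℂ) => (a q.1, q.2)) (hf e he)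
    ((ha.comp contDiff_fst).prodMk contDiff_snd).contDiffOn fun _ hq => ⟨hR hq.1, hq.2⟩

lemma SmoothFamily.mul {f g : P → X → ℝ} (hf : SmoothFamily n S f) (hg : SmoothFamily n S g) :
    SmoothFamily n S (fun p x => f p x * g p x) := fun e he => (hf e he).mul (hg e he)

lemma SmoothFamily.add {f g : P → X → ℝ} (hf : SmoothFamily n S f) (hg : SmoothFamily n S g) :
    SmoothFamily n S (fun p x => f p x + g p x) := fun e he => (hf e he).add (hg e he)

lemma SmoothFamily.sub {f g : P → X → ℝ} (hf : SmoothFamily n S f) (hg : SmoothFamily n S g) :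
    SmoothFamily n S (fun p x => f p x - g p x) := fun e he => (hf e he).sub (hg e he)

lemma smoothFamily_param {a : P → ℝ} (ha : ContDiff ℝ ∞ a) :
    SmoothFamily n S (fun p (_ : X) => a p) := fun _ _ => (ha.comp contDiff_fst).contDiffOn

lemma ChartSmooth.mul {f g : X → ℝ} (hf : ChartSmooth n f) (hg : ChartSmooth n g) :
    ChartSmooth n (fun x => f x * g x) := fun e he => (hf e he).mul (hg e he)

lemma chartSmooth_const (c : ℝ) : ChartSmooth n (fun _ : X => c) := fun _ _ => contDiffOn_const

lemma SmoothFamily.continuousOn {f : P → X → ℝ} (hf : SmoothFamily n S f) :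
    ContinuousOn (fun p : P × X => f p.1 p.2) (S ×ˢ univ) := by
  rintro ⟨p, x⟩ hp
  set e := chartAt (Fin n → ℂ) x
  have hx : x ∈ e.source := mem_chart_source _ x
  have h1 : ContinuousWithinAt (fun q : P × X => (q.1, e q.2)) (S ×ˢ e.source) (p, x) :=
    continuousWithinAt_fst.prodMk
      ((e.continuousAt hx).comp_continuousWithinAt continuousWithinAt_snd)
  have h2 := ContinuousWithinAt.comp (f := fun q : P × X => (q.1, e q.2)) (x := (p, x))
    ((hf e (chart_mem_atlas _ x)).continuousOn (p, e x) ⟨hp.1, e.map_source hx⟩) h1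
    (fun q hq => ⟨hq.1, e.map_source hq.2⟩)
  have h3 : ContinuousWithinAt (fun q : P × X => f q.1 q.2) (S ×ˢ e.source) (p, x) :=
    h2.congr (fun q hq => by simp [e.left_inv hq.2]) (by simp [e.left_inv hx])
  refine h3.mono_of_mem_nhdsWithin ?_
  refine mem_nhdsWithin.2 ⟨univ ×ˢ e.source, isOpen_univ.prod e.open_source, ⟨mem_univ _, hx⟩, ?_⟩
  rintro q ⟨hq1, hq2⟩
  exact ⟨hq2.1, hq1.2⟩

lemma ChartSmooth.continuous {f : X → ℝ} (hf : ChartSmooth n f) : Continuous f := by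
  have h := (hf.smoothFamily (S := (univ : Set ℝ))).continuousOn
  rw [univ_prod_univ, continuousOn_univ] at h
  exact h.comp (Continuous.prodMk_right (0 : ℝ))

/-- Near `e x` the function `φ ∘ e.symm` is `φ ∘ e'.symm` composed with the holomorphic transition
map, so the rule is `ddbar_comp`. -/
lemma glues_ddbarForm [IsManifold 𝓘(ℂ, Fin n → ℂ) ω X] {φ : X → ℝ} (hφ : ChartSmooth n φ) :
    Glues (ddbarForm (n := n) φ) := by
  intro e he e' he' x hx
  have hz : e x ∈ (e.symm.trans e').source := by
    simp [e.map_source hx.1, e.left_inv hx.1, hx.2]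
  have hmaps : MapsTo (fun w => e' (e.symm w)) (e.symm.trans e').source e'.target := by
    intro w hw
    simp only [OpenPartialHomeomorph.trans_source, OpenPartialHomeomorph.symm_source,
      mem_inter_iff, mem_preimage] at hw
    exact e'.map_source hw.2
  have h1 := ddbar_comp (e.symm.trans e').open_source e'.open_target
    (contDiffOn_transition he he') hmaps
    (Complex.ofRealCLM.contDiff.comp_contDiffOn (hφ e' he')) hz
  have h2 : ddbar (fun w => (φ (e.symm w) : ℂ)) (e x) =
      ddbar (fun w => (φ (e'.symm (e' (e.symm w))) : ℂ)) (e x) := by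
    ext j k
    simp only [ddbar, Matrix.of_apply, dz_eq_wirt, dzbar_eq_wirt]
    refine wirt_congr ?_
    filter_upwards [(e.symm.trans e').open_source.mem_nhds hz] with w hw
    refine wirt_congr ?_
    filter_upwards [(e.symm.trans e').open_source.mem_nhds hw] with w hw
    simp only [OpenPartialHomeomorph.trans_source, OpenPartialHomeomorph.symm_source,
      mem_inter_iff, mem_preimage] at hw
    rw [e'.left_inv hw.2]
  simp only [ddbarForm, jacobian]
  rw [h2]
  refine Eq.trans h1 ?_
  rw [e.left_inv hx.1]
  rfl

lemma formFamily_ddbarForm [IsManifold 𝓘(ℂ, Fin n → ℂ) ω X] {f : P → X → ℝ}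
    (hf : SmoothFamily n S f) : FormFamily S (fun p => ddbarForm (n := n) (f p)) where
  smooth e he i j := contDiffOn_ddbar_param (F := fun p w => (f p (e.symm w) : ℂ)) e.open_target
    (Complex.ofRealCLM.contDiff.comp_contDiffOn (hf e he)) i j
  glues _ hp := glues_ddbarForm (hf.chartSmooth hp)

lemma IsKahlerForm.formFamily {α : LocalCoeff n X} (h : IsKahlerForm α) :
    FormFamily S (fun _ => α) where
  smooth e he i j := (h.smooth e he i j).comp contDiffOn_snd fun _ hp => hp.2
  glues _ _ := h.glue

lemma Glues.add {α β : LocalCoeff n X} (hα : Glues α) (hβ : Glues β) : Glues (α + β) := by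
  intro e he e' he' x hx
  simp only [Pi.add_apply, hα e he e' he' x hx, hβ e he e' he' x hx, mul_add, add_mul]

lemma Glues.smul {α : LocalCoeff n X} (hα : Glues α) (c : ℝ) : Glues (c • α) := by
  intro e he e' he' x hx
  simp only [Pi.smul_apply, hα e he e' he' x hx, Matrix.mul_smul, Matrix.smul_mul]

lemma FormFamily.add {α β : P → LocalCoeff n X} (hα : FormFamily S α) (hβ : FormFamily S β) :
    FormFamily S (fun p => α p + β p) where
  smooth e he i j := (hα.smooth e he i j).add (hβ.smooth e he i j)
  glues p hp := (hα.glues p hp).add (hβ.glues p hp)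

lemma FormFamily.smul {α : P → LocalCoeff n X} (hα : FormFamily S α) {a : P → ℝ}
    (ha : ContDiff ℝ ∞ a) : FormFamily S (fun p => a p • α p) where
  smooth e he i j := (ha.comp contDiff_fst).contDiffOn.smul (hα.smooth e he i j)
  glues p hp := (hα.glues p hp).smul _

end Charts

/-! ### Global functions obtained by dividing top degree forms by `χⁿ`. -/

section Ratio

variable {n : ℕ} {X : Type*} [TopologicalSpace X] [ChartedSpace (Fin n → ℂ) X]

/-- The coefficients of a form at `x` in the preferred chart. -/
def coeffAt (α : LocalCoeff n X) (x : X) : Matrix (Fin n) (Fin n) ℂ :=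
  α (chartAt (Fin n → ℂ) x) (chartAt (Fin n → ℂ) x x)

/-- The function `gⁿ / χⁿ`. -/
def detRatio (χ g : LocalCoeff n X) (x : X) : ℝ := ((coeffAt g x).det / (coeffAt χ x).det).re

/-- The function `n h ∧ gⁿ⁻¹ / χⁿ`. -/
def detRatio₁ (χ g h : LocalCoeff n X) (x : X) : ℝ :=
  (detDeriv (coeffAt g x) (coeffAt h x) / (coeffAt χ x).det).re

/-- The function `n (n - 1) k ∧ h ∧ gⁿ⁻² / χⁿ`. -/
def detRatio₂ (χ g k h : LocalCoeff n X) (x : X) : ℝ :=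
  (detDeriv₂ (coeffAt g x) (coeffAt k x) (coeffAt h x) / (coeffAt χ x).det).re

variable {χ : LocalCoeff n X}

/-- This product is a factor of `det χ` in the chart `e`, which is nonzero by positivity; no inverse
transition map is needed. -/
lemma det_jacobian_ne_zero (hχ : IsKahlerForm χ) {e e' : OpenPartialHomeomorph X (Fin n → ℂ)}
    (he : e ∈ atlas (Fin n → ℂ) X) (he' : e' ∈ atlas (Fin n → ℂ) X) {x : X}
    (hx : x ∈ e.source ∩ e'.source) :
    (jacobian e e' (e x)).transpose.det *
      (jacobian e e' (e x)).transpose.conjTranspose.det ≠ 0 := by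
  have h1 := hχ.glue e he e' he' x hx
  have h2 : (χ e (e x)).det ≠ 0 := (hχ.posDef e he _ (e.map_source hx.1)).det_pos.ne'
  rw [h1, Matrix.det_mul, Matrix.det_mul] at h2
  intro h3
  apply h2
  rw [mul_right_comm, h3, zero_mul]

variable {g k h : LocalCoeff n X} {e : OpenPartialHomeomorph X (Fin n → ℂ)} {x : X}

/-- Numerator and denominator acquire the same Jacobian factor when passing from the preferred chart
to `e`. -/
lemma detRatio_eq (hχ : IsKahlerForm χ) (he : e ∈ atlas (Fin n → ℂ) X) (hx : x ∈ e.source)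
    (hg : Glues g) :
    detRatio χ g x = ((g e (e x)).det / (χ e (e x)).det).re := by
  have hx' : x ∈ e.source ∩ (chartAt (Fin n → ℂ) x).source := ⟨hx, mem_chart_source _ x⟩
  have he' := chart_mem_atlas (Fin n → ℂ) x
  have h0 := det_jacobian_ne_zero hχ he he' hx'
  rw [hχ.glue e he _ he' x hx', hg e he _ he' x hx', Matrix.det_mul, Matrix.det_mul,
    Matrix.det_mul, Matrix.det_mul, mul_right_comm, mul_right_comm _ (χ _ _).det,
    mul_div_mul_left _ _ h0]
  rfl

lemma detRatio₁_eq (hχ : IsKahlerForm χ) (he : e ∈ atlas (Fin n → ℂ) X) (hx : x ∈ e.source)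
    (hg : Glues g) (hh : Glues h) :
    detRatio₁ χ g h x = (detDeriv (g e (e x)) (h e (e x)) / (χ e (e x)).det).re := by
  have hx' : x ∈ e.source ∩ (chartAt (Fin n → ℂ) x).source := ⟨hx, mem_chart_source _ x⟩
  have he' := chart_mem_atlas (Fin n → ℂ) x
  have h0 := det_jacobian_ne_zero hχ he he' hx'
  rw [hχ.glue e he _ he' x hx', hg e he _ he' x hx', hh e he _ he' x hx', detDeriv_congr,
    Matrix.det_mul, Matrix.det_mul, mul_right_comm _ (χ _ _).det, mul_div_mul_left _ _ h0]
  rfl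

lemma detRatio₂_eq (hχ : IsKahlerForm χ) (he : e ∈ atlas (Fin n → ℂ) X) (hx : x ∈ e.source)
    (hg : Glues g) (hk : Glues k) (hh : Glues h) :
    detRatio₂ χ g k h x =
      (detDeriv₂ (g e (e x)) (k e (e x)) (h e (e x)) / (χ e (e x)).det).re := by
  have hx' : x ∈ e.source ∩ (chartAt (Fin n → ℂ) x).source := ⟨hx, mem_chart_source _ x⟩
  have he' := chart_mem_atlas (Fin n → ℂ) x
  have h0 := det_jacobian_ne_zero hχ he he' hx'
  rw [hχ.glue e he _ he' x hx', hg e he _ he' x hx', hk e he _ he' x hx', hh e he _ he' x hx',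
    detDeriv₂_congr, Matrix.det_mul, Matrix.det_mul, mul_right_comm _ (χ _ _).det,
    mul_div_mul_left _ _ h0]
  rfl

end Ratio

section RatioSmooth

variable {n : ℕ} {X : Type*} [TopologicalSpace X] [ChartedSpace (Fin n → ℂ) X]
  {χ : LocalCoeff n X} {P : Type*} [NormedAddCommGroup P] [NormedSpace ℝ P] {S : Set P}
  {g k h : P → LocalCoeff n X}

lemma contDiffOn_re_div_det (hχ : IsKahlerForm χ)
    {e : OpenPartialHomeomorph X (Fin n → ℂ)} (he : e ∈ atlas (Fin n → ℂ) X)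
    {σ : P × (Fin n → ℂ) → ℂ}
    (hσ : ContDiffOn ℝ ∞ σ (S ×ˢ e.target)) :
    ContDiffOn ℝ ∞ (fun p => (σ p / (χ e p.2).det).re) (S ×ˢ e.target) := by
  have h1 : ContDiffOn ℝ ∞ (fun p : P × (Fin n → ℂ) => (χ e p.2).det) (S ×ˢ e.target) :=
    contDiffOn_det fun i j => (hχ.smooth e he i j).comp contDiffOn_snd fun _ hp => hp.2
  simp only [div_eq_mul_inv]
  exact Complex.reCLM.contDiff.comp_contDiffOn (hσ.mul
    (h1.inv fun p hp => (hχ.posDef e he _ hp.2).det_pos.ne'))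

lemma smoothFamily_detRatio (hχ : IsKahlerForm χ) (hg : FormFamily S g) :
    SmoothFamily n S (fun p => detRatio χ (g p)) := fun e he =>
  (contDiffOn_re_div_det hχ he (contDiffOn_det (hg.smooth e he))).congr fun p hp => by
    beta_reduce
    rw [detRatio_eq hχ he (e.map_target hp.2) (hg.glues _ hp.1), e.right_inv hp.2]

lemma smoothFamily_detRatio₁ (hχ : IsKahlerForm χ) (hg : FormFamily S g) (hh : FormFamily S h) :
    SmoothFamily n S (fun p => detRatio₁ χ (g p) (h p)) := fun e he =>
  (contDiffOn_re_div_det hχ he (contDiffOn_detDeriv (hg.smooth e he) (hh.smooth e he))).congr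
    fun p hp => by
    beta_reduce
    rw [detRatio₁_eq hχ he (e.map_target hp.2) (hg.glues _ hp.1) (hh.glues _ hp.1),
      e.right_inv hp.2]

lemma smoothFamily_detRatio₂ (hχ : IsKahlerForm χ)
    (hg : FormFamily S g) (hk : FormFamily S k) (hh : FormFamily S h) :
    SmoothFamily n S (fun p => detRatio₂ χ (g p) (k p) (h p)) := fun e he =>
  (contDiffOn_re_div_det hχ he (contDiffOn_detDeriv₂ (hg.smooth e he) (hk.smooth e he)
    (hh.smooth e he))).congr fun p hp => by
    beta_reduce
    rw [detRatio₂_eq hχ he (e.map_target hp.2) (hg.glues _ hp.1) (hk.glues _ hp.1)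
      (hh.glues _ hp.1), e.right_inv hp.2]

end RatioSmooth

/-! ### The measure `χⁿ` as glued from charts. -/

section Measurability

variable {n : ℕ} {X : Type*} [TopologicalSpace X] [MeasurableSpace X] [BorelSpace X]

lemma aemeasurable_symm (e : OpenPartialHomeomorph X (Fin n → ℂ)) :
    AEMeasurable e.symm (volume.restrict e.target) :=
  e.continuousOn_symm.aemeasurable e.open_target.measurableSet

lemma aemeasurable_symm_withDensity (e : OpenPartialHomeomorph X (Fin n → ℂ))
    (f : (Fin n → ℂ) → ENNReal) :
    AEMeasurable e.symm ((volume.restrict e.target).withDensity f) :=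
  (aemeasurable_symm e).mono_ac (withDensity_absolutelyContinuous _ _)

/-- The measure on `X` that is `ρ e` times Lebesgue measure in the chart `e`. -/
def chartMeasure (ρ : OpenPartialHomeomorph X (Fin n → ℂ) → (Fin n → ℂ) → ℝ)
    (e : OpenPartialHomeomorph X (Fin n → ℂ)) : Measure X :=
  ((volume.restrict e.target).withDensity fun z => ENNReal.ofReal (ρ e z)).map e.symm

lemma chartMeasure_apply (ρ : OpenPartialHomeomorph X (Fin n → ℂ) → (Fin n → ℂ) → ℝ)
    (e : OpenPartialHomeomorph X (Fin n → ℂ)) {S : Set X} (hS : MeasurableSet S) :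
    chartMeasure ρ e S = ∫⁻ z in e.target ∩ e.symm ⁻¹' S, ENNReal.ofReal (ρ e z) := by
  rw [chartMeasure, Measure.map_apply_of_aemeasurable (aemeasurable_symm_withDensity e _) hS,
    withDensity_apply', Measure.restrict_restrict' e.open_target.measurableSet, inter_comm]

lemma chartMeasure_inter_source (ρ : OpenPartialHomeomorph X (Fin n → ℂ) → (Fin n → ℂ) → ℝ)
    (e : OpenPartialHomeomorph X (Fin n → ℂ)) {S : Set X} (hS : MeasurableSet S) :
    chartMeasure ρ e (S ∩ e.source) = chartMeasure ρ e S := by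
  rw [chartMeasure_apply ρ e hS, chartMeasure_apply ρ e (hS.inter e.open_source.measurableSet)]
  congr 2
  ext z
  simp only [mem_inter_iff, mem_preimage]
  exact ⟨fun h => ⟨h.1, h.2.1⟩, fun h => ⟨h.1, h.2, e.map_target h.1⟩⟩

end Measurability

section Gluing

variable {n : ℕ} {X : Type*} [TopologicalSpace X] [ChartedSpace (Fin n → ℂ) X]

/-- The volume density of a form. -/
def volDensity (g : LocalCoeff n X) (e : OpenPartialHomeomorph X (Fin n → ℂ)) (z : Fin n → ℂ) : ℝ :=
  2 ^ n * (n.factorial : ℝ) * (g e z).det.re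

lemma volDensity_transition {g : LocalCoeff n X} (hg : Glues g)
    {e e' : OpenPartialHomeomorph X (Fin n → ℂ)} (he : e ∈ atlas (Fin n → ℂ) X)
    (he' : e' ∈ atlas (Fin n → ℂ) X) {x : X} (hx : x ∈ e.source ∩ e'.source) :
    volDensity g e (e x) = Complex.normSq (jacobian e e' (e x)).det * volDensity g e' (e' x) := by
  simp only [volDensity]
  rw [hg e he e' he' x hx, Matrix.det_mul, Matrix.det_mul, Matrix.det_conjTranspose,
    Matrix.det_transpose, Complex.star_def,
    mul_right_comm (jacobian e e' (e x)).det, Complex.mul_conj, Complex.re_ofReal_mul]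
  ring

lemma det_im_eq_zero {g : Matrix (Fin n) (Fin n) ℂ} (hg : g.IsHermitian) : g.det.im = 0 := by
  have h1 : (starRingEnd ℂ) g.det = g.det := by
    rw [← Complex.star_def, ← Matrix.det_conjTranspose, hg.eq]
  exact Complex.conj_eq_iff_im.1 h1

lemma continuousOn_volDensity {g : LocalCoeff n X} (hg : IsKahlerForm g)
    {e : OpenPartialHomeomorph X (Fin n → ℂ)} (he : e ∈ atlas (Fin n → ℂ) X) :
    ContinuousOn (volDensity g e) e.target :=
  continuousOn_const.mul (Complex.continuous_re.comp_continuousOn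
    (contDiffOn_det (hg.smooth e he)).continuousOn)

lemma volDensity_pos {g : LocalCoeff n X} (hg : IsKahlerForm g)
    {e : OpenPartialHomeomorph X (Fin n → ℂ)} (he : e ∈ atlas (Fin n → ℂ) X) {z : Fin n → ℂ}
    (hz : z ∈ e.target) : 0 < volDensity g e z := by
  have h1 : 0 < (g e z).det.re := (Complex.lt_def.1 (hg.posDef e he z hz).det_pos).1
  unfold volDensity
  positivity

/-- `det χ` is real and positive, so it leaves the real part and cancels. This turns integrals of
ratios against `χⁿ` into chart integrals of the numerators. -/
lemma volDensity_mul_re_div {χ : LocalCoeff n X} (hχ : IsKahlerForm χ)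
    {e : OpenPartialHomeomorph X (Fin n → ℂ)}
    (he : e ∈ atlas (Fin n → ℂ) X) {z : Fin n → ℂ} (hz : z ∈ e.target) (w : ℂ) :
    volDensity χ e z * (w / (χ e z).det).re = 2 ^ n * (n.factorial : ℝ) * w.re := by
  have h1 : (χ e z).det = ((χ e z).det.re : ℂ) :=
    Complex.ext rfl (det_im_eq_zero (hχ.posDef e he z hz).isHermitian)
  have h2 : (χ e z).det.re ≠ 0 := (Complex.lt_def.1 (hχ.posDef e he z hz).det_pos).1.ne'
  rw [volDensity]
  nth_rewrite 2 [h1]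
  rw [Complex.div_ofReal_re]
  field_simp

lemma continuous_detRatio {χ : LocalCoeff n X} (hχ : IsKahlerForm χ)
    {g : LocalCoeff n X} (hg : IsKahlerForm g) :
    Continuous (detRatio χ g) :=
  ((smoothFamily_detRatio (S := (univ : Set ℝ)) hχ hg.formFamily).chartSmooth
    (mem_univ 0)).continuous

/-- The real determinant of a complex linear map is the norm from `ℂ` to `ℝ` of its complex
determinant. It matches the factor in `volDensity_transition`. -/
lemma abs_det_restrictScalars (f : (Fin n → ℂ) →L[ℂ] Fin n → ℂ) :
    |(f.restrictScalars ℝ).det| =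
      Complex.normSq (LinearMap.toMatrix' (f : (Fin n → ℂ) →ₗ[ℂ] Fin n → ℂ)).det := by
  have h1 : (f.restrictScalars ℝ).det =
      Complex.normSq (LinearMap.det (f : (Fin n → ℂ) →ₗ[ℂ] _)) := by
    rw [← Algebra.norm_complex_apply, ← LinearMap.det_restrictScalars]
    rfl
  rw [h1, LinearMap.det_toMatrix', abs_of_nonneg (Complex.normSq_nonneg _)]

variable [MeasurableSpace X] [BorelSpace X]

variable [IsManifold 𝓘(ℂ, Fin n → ℂ) ω X]

lemma chartMeasure_eq_of_subset {g : LocalCoeff n X} (hg : Glues g)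
    {e e' : OpenPartialHomeomorph X (Fin n → ℂ)} (he : e ∈ atlas (Fin n → ℂ) X)
    (he' : e' ∈ atlas (Fin n → ℂ) X) {S : Set X} (hS : MeasurableSet S)
    (hSe : S ⊆ e.source ∩ e'.source) :
    chartMeasure (volDensity g) e S = chartMeasure (volDensity g) e' S := by
  set A := e.target ∩ e.symm ⁻¹' S with hA
  set T : (Fin n → ℂ) → Fin n → ℂ := fun w => e' (e.symm w) with hT
  have hAO : A ⊆ (e.symm.trans e').source := fun z hz => by
    simpa using ⟨hz.1, (hSe hz.2).2⟩
  have hAm : MeasurableSet A := by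
    have h1 : A = Subtype.val '' {z : e.target | e.symm z ∈ S} := by
      ext z; simp [hA, and_comm]
    rw [h1]
    have h2 : Continuous fun z : e.target => e.symm z :=
      continuousOn_iff_continuous_domRestrict.1 e.continuousOn_symm
    exact e.open_target.measurableSet.subtype_image (h2.measurable hS)
  have hTd : ∀ z ∈ A, HasFDerivWithinAt T ((fderiv ℂ T z).restrictScalars ℝ) A z := by
    intro z hz
    have h1 := (contDiffOn_transition (X := X) he he').contDiffAt
      ((e.symm.trans e').open_source.mem_nhds (hAO hz))
    exact ((h1.differentiableAt (by simp)).hasFDerivAt.restrictScalars ℝ).hasFDerivWithinAt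
  have hTi : InjOn T A := by
    intro z hz w hw h
    have h1 : e.symm z = e.symm w := e'.injOn (hSe hz.2).2 (hSe hw.2).2 h
    exact e.symm.injOn hz.1 hw.1 h1
  have himg : T '' A = e'.target ∩ e'.symm ⁻¹' S := by
    ext w
    constructor
    · rintro ⟨z, hz, rfl⟩
      refine ⟨e'.map_source (hSe hz.2).2, ?_⟩
      simp only [hT, mem_preimage, e'.left_inv (hSe hz.2).2]
      exact hz.2
    · rintro ⟨hw, hwS⟩
      refine ⟨e (e'.symm w), ⟨e.map_source (hSe hwS).1, ?_⟩, ?_⟩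
      · simp only [mem_preimage, e.left_inv (hSe hwS).1]; exact hwS
      · simp only [hT, e.left_inv (hSe hwS).1, e'.right_inv hw]
  rw [chartMeasure_apply _ _ hS, chartMeasure_apply _ _ hS, ← himg,
    lintegral_image_eq_lintegral_abs_det_fderiv_mul volume hAm hTd hTi]
  refine setLIntegral_congr_fun hAm fun z hz => ?_
  have h1 := volDensity_transition hg he he' (hSe hz.2)
  rw [e.right_inv hz.1] at h1
  beta_reduce
  rw [h1, ENNReal.ofReal_mul (Complex.normSq_nonneg _), abs_det_restrictScalars]
  rfl

/-- The local measures glue. -/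
lemma topPower_restrict {g : LocalCoeff n X} (hg : Glues g)
    {e : OpenPartialHomeomorph X (Fin n → ℂ)} (he : e ∈ atlas (Fin n → ℂ) X) :
    (topPower g).restrict e.source = chartMeasure (volDensity g) e := by
  have hdef : topPower g = ⨆ e ∈ atlas (Fin n → ℂ) X, chartMeasure (volDensity g) e := rfl
  have hs := e.open_source.measurableSet
  -- Nothing is known about the supremum away from `e.source`, so it is bounded there by the measure
  -- `⊤`; this term disappears on restricting to `e.source`.
  have hle : topPower g ≤ chartMeasure (volDensity g) e + (⊤ : Measure X).restrict e.sourceᶜ := by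
    rw [hdef]
    refine iSup₂_le fun e' he' => Measure.le_iff.2 fun S hS => ?_
    rw [← measure_inter_add_sdiff S hs, Measure.add_apply]
    refine add_le_add ?_ ?_
    · rw [← chartMeasure_inter_source _ _ (hS.inter hs), ← chartMeasure_eq_of_subset hg he he'
        ((hS.inter hs).inter e'.open_source.measurableSet) (fun x hx => ⟨hx.1.2, hx.2⟩)]
      exact measure_mono fun x hx => hx.1.1
    · rw [Measure.restrict_apply hS]
      exact Measure.le_iff.1 le_top _ (hS.diff hs)
  apply le_antisymm
  · calc (topPower g).restrict e.source
        ≤ (chartMeasure (volDensity g) e + (⊤ : Measure X).restrict e.sourceᶜ).restrict e.source :=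
          Measure.restrict_mono subset_rfl hle
      _ = (chartMeasure (volDensity g) e).restrict e.source := by
          rw [Measure.restrict_add, Measure.restrict_restrict hs]
          simp
      _ ≤ _ := Measure.restrict_le_self
  · refine Measure.le_iff.2 fun S hS => ?_
    rw [Measure.restrict_apply hS, ← chartMeasure_inter_source _ _ hS, hdef]
    exact Measure.le_iff.1 (le_iSup₂ (f := fun e _ => chartMeasure (volDensity g) e) e he) _
      (hS.inter hs)

lemma integral_topPower_of_source {g : LocalCoeff n X} (hg : IsKahlerForm g)
    {e : OpenPartialHomeomorph X (Fin n → ℂ)} (he : e ∈ atlas (Fin n → ℂ) X) {f : X → ℝ}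
    (hf : Continuous f) (h0 : ∀ x, x ∉ e.source → f x = 0) :
    ∫ x, f x ∂(topPower g) = ∫ z in e.target, volDensity g e z * f (e.symm z) := by
  rw [← setIntegral_eq_integral_of_forall_compl_eq_zero h0, topPower_restrict hg.glue he,
    chartMeasure, integral_map (aemeasurable_symm_withDensity e _)
      (hf.stronglyMeasurable.aestronglyMeasurable)]
  rw [integral_withDensity_eq_integral_toReal_smul₀]
  · refine setIntegral_congr_fun e.open_target.measurableSet fun z hz => ?_
    rw [ENNReal.toReal_ofReal (volDensity_pos hg he hz).le, smul_eq_mul]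
  · exact ((continuousOn_volDensity hg he).aemeasurable e.open_target.measurableSet).ennreal_ofReal
  · exact Eventually.of_forall fun z => ENNReal.ofReal_lt_top

lemma isFiniteMeasure_topPower [CompactSpace X] {g : LocalCoeff n X} (hg : IsKahlerForm g) :
    IsFiniteMeasure (topPower g) := by
  refine ⟨isCompact_univ.measure_lt_top_of_nhdsWithin fun x _ => ?_⟩
  rw [nhdsWithin_univ]
  set e := chartAt (Fin n → ℂ) x
  have he : e ∈ atlas (Fin n → ℂ) X := chart_mem_atlas _ x
  have hx : x ∈ e.source := mem_chart_source _ x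
  -- On a compact neighbourhood inside the chart the density is bounded; compactness of `X` then
  -- makes the total mass finite.
  obtain ⟨K, ⟨hKx, hK⟩, hKt⟩ := (compact_basis_nhds (e x)).mem_iff.1
    (e.open_target.mem_nhds (e.map_source hx))
  refine ⟨e.source ∩ e ⁻¹' (interior K), ?_, ?_⟩
  · exact (e.isOpen_inter_preimage isOpen_interior).mem_nhds ⟨hx, mem_interior_iff_mem_nhds.2 hKx⟩
  have hm := (e.isOpen_inter_preimage (isOpen_interior (s := K))).measurableSet
  have h1 : topPower g (e.source ∩ e ⁻¹' (interior K)) =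
      chartMeasure (volDensity g) e (e.source ∩ e ⁻¹' (interior K)) := by
    rw [← topPower_restrict hg.glue he, Measure.restrict_apply hm]
    congr 1
    ext y; simpa using fun h _ => h
  rw [h1, chartMeasure_apply _ _ hm]
  obtain ⟨C, hC⟩ := hK.bddAbove_image ((continuousOn_volDensity hg he).mono hKt)
  calc ∫⁻ z in e.target ∩ e.symm ⁻¹' (e.source ∩ e ⁻¹' (interior K)),
        ENNReal.ofReal (volDensity g e z)
      ≤ ∫⁻ z in K, ENNReal.ofReal (volDensity g e z) := by
        refine lintegral_mono_set fun z hz => ?_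
        have := hz.2.2
        rw [mem_preimage, e.right_inv hz.1] at this
        exact interior_subset this
    _ ≤ ∫⁻ z in K, ENNReal.ofReal C := by
        refine setLIntegral_mono measurable_const fun z hz => ?_
        exact ENNReal.ofReal_le_ofReal (hC (mem_image_of_mem _ hz))
    _ < ⊤ := by
        rw [setLIntegral_const]
        exact ENNReal.mul_lt_top ENNReal.ofReal_lt_top hK.measure_lt_top

end Gluing

/-! ### Partition of unity and change of reference measure. -/

section Partition

variable {n : ℕ} {X : Type*} [TopologicalSpace X] [CompactSpace X] [T2Space X]
  [ChartedSpace (Fin n → ℂ) X] [IsManifold 𝓘(ℂ, Fin n → ℂ) ω X]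

lemma exists_partition : ∃ (ι : Finset X) (ρ : ι → X → ℝ)
    (e : ι → OpenPartialHomeomorph X (Fin n → ℂ))
    (K : ι → Set X),
    (∀ i, e i ∈ atlas (Fin n → ℂ) X) ∧ (∀ i, ChartSmooth n (ρ i)) ∧ (∀ i, IsCompact (K i)) ∧
    (∀ i, K i ⊆ (e i).source) ∧ (∀ i, ∀ x, x ∉ K i → ρ i x = 0) ∧ ∀ x, ∑ i, ρ i x = 1 := by
  have : IsManifold 𝓘(ℝ, Fin n → ℂ) ∞ X := isManifold_real
  obtain ⟨t, ht⟩ := isCompact_univ.elim_finite_subcover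
    (fun x : X => (chartAt (Fin n → ℂ) x).source) (fun x => (chartAt _ x).open_source)
    (fun x _ => mem_iUnion.2 ⟨x, mem_chart_source _ x⟩)
  obtain ⟨f, hf⟩ := SmoothPartitionOfUnity.exists_isSubordinate 𝓘(ℝ, Fin n → ℂ) isClosed_univ
    (fun i : t => (chartAt (Fin n → ℂ) i.1).source) (fun i => (chartAt _ i.1).open_source)
    (fun x hx => by
      obtain ⟨y, hy, hxy⟩ := mem_iUnion₂.1 (ht hx)
      exact mem_iUnion.2 ⟨⟨y, hy⟩, hxy⟩)
  refine ⟨t, fun i => f i, fun i => chartAt _ i.1, fun i => tsupport (f i),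
    fun i => chart_mem_atlas _ _, fun i => IsSmooth.chartSmooth (f i).contMDiff,
    fun i => (isClosed_tsupport _).isCompact, fun i => hf i,
    fun i x hx => image_eq_zero_of_notMem_tsupport hx, fun x => ?_⟩
  rw [← finsum_eq_sum_of_fintype]
  exact f.sum_eq_one (mem_univ x)

end Partition

section Reference

variable {n : ℕ} {X : Type*} [TopologicalSpace X] [CompactSpace X]
  [ChartedSpace (Fin n → ℂ) X] [IsManifold 𝓘(ℂ, Fin n → ℂ) ω X]
  [MeasurableSpace X] [BorelSpace X] {χ : LocalCoeff n X}

lemma integrable_topPower (hχ : IsKahlerForm χ) {f : X → ℝ} (hf : Continuous f) :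
    Integrable f (topPower χ) := by
  have := isFiniteMeasure_topPower hχ
  obtain ⟨C, hC⟩ := isCompact_univ.exists_bound_of_continuousOn hf.continuousOn
  exact Integrable.of_bound hf.stronglyMeasurable.aestronglyMeasurable C
    (Eventually.of_forall fun x => hC x (mem_univ x))

variable [T2Space X]

/-- Change of the reference measure. -/
lemma integral_topPower_eq (hχ : IsKahlerForm χ) {g : LocalCoeff n X} (hg : IsKahlerForm g)
    {f : X → ℝ} (hf : Continuous f) :
    ∫ x, f x ∂(topPower g) = ∫ x, f x * detRatio χ g x ∂(topPower χ) := by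
  obtain ⟨ι, ρ, e, K, he, hρ, hK, hKe, hρK, hsum⟩ := exists_partition (n := n) (X := X)
  have hρe : ∀ i x, x ∉ (e i).source → ρ i x = 0 := fun i x hx => hρK i x fun h => hx (hKe i h)
  have hD := continuous_detRatio hχ hg
  -- Each piece `ρ i * f` lives in one chart, where both measures have explicit densities.
  have hf1 : f = fun x => ∑ i, ρ i x * f x := by
    funext x; rw [← Finset.sum_mul, hsum, one_mul]
  have hf2 : (fun x => f x * detRatio χ g x) = fun x => ∑ i, ρ i x * f x * detRatio χ g x := by
    funext x; rw [← Finset.sum_mul, ← Finset.sum_mul, hsum, one_mul]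
  rw [hf2]
  have hf3 : ∫ x, f x ∂(topPower g) = ∫ x, ∑ i, ρ i x * f x ∂(topPower g) :=
    integral_congr_ae (Eventually.of_forall fun x => congrFun hf1 x)
  rw [hf3]
  rw [integral_finsetSum _ fun i _ => integrable_topPower hg ((hρ i).continuous.fun_mul hf),
    integral_finsetSum _ fun i _ =>
      integrable_topPower hχ (((hρ i).continuous.fun_mul hf).fun_mul hD)]
  refine Finset.sum_congr rfl fun i _ => ?_
  rw [integral_topPower_of_source hg (he i) ((hρ i).continuous.fun_mul hf)
      (fun x hx => by simp [hρe i x hx]),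
    integral_topPower_of_source hχ (he i) (((hρ i).continuous.fun_mul hf).fun_mul hD)
      (fun x hx => by simp [hρe i x hx])]
  refine setIntegral_congr_fun (e i).open_target.measurableSet fun z hz => ?_
  rw [detRatio_eq hχ (he i) ((e i).map_target hz) hg.glue, (e i).right_inv hz]
  have h1 := volDensity_mul_re_div hχ (he i) hz (g (e i) z).det
  have h2 : volDensity g (e i) z = 2 ^ n * (n.factorial : ℝ) * (g (e i) z).det.re := rfl
  rw [h2, ← h1]
  ring

end Reference

/-! ### Algebra of `∂∂̄`, and real closed (1,1)-forms without positivity. -/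

section DdbarAlgebra

variable {n : ℕ} {U : Set (Fin n → ℂ)}

lemma ddbar_congr (hU : IsOpen U) {f g : (Fin n → ℂ) → ℂ} (h : EqOn f g U) {z : Fin n → ℂ}
    (hz : z ∈ U) : ddbar f z = ddbar g z := by
  ext j k
  simp only [ddbar, Matrix.of_apply, dz_eq_wirt, dzbar_eq_wirt]
  refine wirt_congr ?_
  filter_upwards [hU.mem_nhds hz] with w hw
  refine wirt_congr ?_
  filter_upwards [hU.mem_nhds hw] with y hy using h hy

lemma ddbar_const (c : ℂ) (z : Fin n → ℂ) : ddbar (fun _ => c) z = 0 := by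
  ext j k
  have h1 : dzbar k (fun _ : Fin n → ℂ => c) = fun _ => 0 := by
    funext w; rw [dzbar_eq_wirt, wirt_const]
  simp only [ddbar, Matrix.of_apply, h1, dz_eq_wirt, wirt_const, Matrix.zero_apply]

lemma ddbar_sum (hU : IsOpen U) {ι : Type*} {s : Finset ι} {f : ι → (Fin n → ℂ) → ℂ}
    (hf : ∀ i ∈ s, ContDiffOn ℝ ∞ (f i) U) {z : Fin n → ℂ} (hz : z ∈ U) :
    ddbar (fun w => ∑ i ∈ s, f i w) z = ∑ i ∈ s, ddbar (f i) z := by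
  ext j k
  simp only [ddbar, Matrix.sum_apply, Matrix.of_apply, dz_eq_wirt, dzbar_eq_wirt]
  rw [← wirt_sum fun i hi => (contDiffOn_wirt hU (hf i hi) _ _).differentiableAt_of_isOpen hU hz]
  refine wirt_congr ?_
  filter_upwards [hU.mem_nhds hz] with w hw
  exact wirt_sum fun i hi => (hf i hi).differentiableAt_of_isOpen hU hw

lemma ddbar_const_mul (hU : IsOpen U) {f : (Fin n → ℂ) → ℂ} (hf : ContDiffOn ℝ ∞ f U)
    (c : ℂ) {z : Fin n → ℂ} (hz : z ∈ U) :
    ddbar (fun w => c * f w) z = c • ddbar f z := by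
  ext j k
  simp only [ddbar, Matrix.smul_apply, Matrix.of_apply, dz_eq_wirt, dzbar_eq_wirt, smul_eq_mul]
  rw [← wirt_const_mul ((contDiffOn_wirt hU hf _ _).differentiableAt_of_isOpen hU hz)]
  refine wirt_congr ?_
  filter_upwards [hU.mem_nhds hz] with w hw
  exact wirt_const_mul (hf.differentiableAt_of_isOpen hU hw)

lemma ddbar_mul_self (hU : IsOpen U) {f : (Fin n → ℂ) → ℂ} (hf : ContDiffOn ℝ ∞ f U)
    {z : Fin n → ℂ} (hz : z ∈ U) : ddbar (fun w => f w * f w) z =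
      (2 * f z) • ddbar f z + (2 : ℂ) • Matrix.of fun j k => dz j f z * dzbar k f z := by
  ext j k
  have hd := hf.differentiableAt_of_isOpen hU hz
  have hdb : DifferentiableAt ℝ (dzbar k f) z :=
    (contDiffOn_wirt hU hf _ _).differentiableAt_of_isOpen hU hz
  have h1 : dzbar k (fun w => f w * f w) =ᶠ[𝓝 z] fun w => 2 * (f w * dzbar k f w) := by
    filter_upwards [hU.mem_nhds hz] with w hw
    have hdw := hf.differentiableAt_of_isOpen hU hw
    rw [dzbar_eq_wirt, wirt_mul hdw hdw]
    ring
  simp only [ddbar, Matrix.add_apply, Matrix.smul_apply, Matrix.of_apply, smul_eq_mul]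
  rw [dz_eq_wirt, wirt_congr h1, wirt_const_mul (hd.fun_mul hdb), wirt_mul hd hdb]
  ring

lemma conj_dzbar_ofReal {f : (Fin n → ℂ) → ℝ} {z : Fin n → ℂ}
    (hf : DifferentiableAt ℝ (fun w => (f w : ℂ)) z) (k : Fin n) :
    (starRingEnd ℂ) (dzbar k (fun w => (f w : ℂ)) z) = dz k (fun w => (f w : ℂ)) z := by
  rw [← dz_conj hf]
  simp only [Complex.conj_ofReal]

lemma isHermitian_ddbar (hU : IsOpen U) {f : (Fin n → ℂ) → ℝ}
    (hf : ContDiffOn ℝ ∞ (fun w => (f w : ℂ)) U) {z : Fin n → ℂ} (hz : z ∈ U) :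
    (ddbar (fun w => (f w : ℂ)) z).IsHermitian := by
  ext i j
  simp only [Matrix.conjTranspose_apply, ddbar, Matrix.of_apply, Complex.star_def]
  have h0 : ContDiffOn ℝ ∞ (dzbar i fun w => (f w : ℂ)) U := contDiffOn_wirt hU hf _ _
  rw [← dzbar_conj (h0.differentiableAt_of_isOpen hU hz)]
  have h1 : (fun w => (starRingEnd ℂ) (dzbar i (fun w => (f w : ℂ)) w)) =ᶠ[𝓝 z]
      dz i (fun w => (f w : ℂ)) := by
    filter_upwards [hU.mem_nhds hz] with w hw
    exact conj_dzbar_ofReal (hf.differentiableAt_of_isOpen hU hw) i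
  rw [dzbar_eq_wirt, wirt_congr h1, dz_eq_wirt, wirt_comm (hf.contDiffAt (hU.mem_nhds hz))]

lemma closed_ddbar (hU : IsOpen U) {f : (Fin n → ℂ) → ℂ} (hf : ContDiffOn ℝ ∞ f U)
    {z : Fin n → ℂ} (hz : z ∈ U) (i j k : Fin n) :
    dz k (fun w => ddbar f w i j) z = dz i (fun w => ddbar f w k j) z := by
  simp only [ddbar, Matrix.of_apply, dz_eq_wirt]
  exact wirt_comm ((contDiffOn_wirt hU hf _ _).contDiffAt (hU.mem_nhds hz))

end DdbarAlgebra

section ClosedForms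

variable {n : ℕ} {X : Type*} [TopologicalSpace X] [ChartedSpace (Fin n → ℂ) X]

/-- A smooth real closed form of type `(1,1)`. -/
structure IsClosedForm (α : LocalCoeff n X) : Prop where
  smooth : ∀ e ∈ atlas (Fin n → ℂ) X, ∀ i j, ContDiffOn ℝ ∞ (fun z => α e z i j) e.target
  glue : Glues α
  hermitian : ∀ e ∈ atlas (Fin n → ℂ) X, ∀ z ∈ e.target, (α e z).IsHermitian
  closed : ∀ e ∈ atlas (Fin n → ℂ) X, ∀ z ∈ e.target, ∀ i j k,
    dz k (fun w => α e w i j) z = dz i (fun w => α e w k j) z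

lemma IsKahlerForm.isClosedForm {α : LocalCoeff n X} (h : IsKahlerForm α) : IsClosedForm α :=
  ⟨h.smooth, h.glue, fun e he z hz => (h.posDef e he z hz).isHermitian, h.closed⟩

lemma IsClosedForm.isKahlerForm {α : LocalCoeff n X} (h : IsClosedForm α)
    (hp : ∀ e ∈ atlas (Fin n → ℂ) X, ∀ z ∈ e.target, (α e z).PosDef) : IsKahlerForm α :=
  ⟨h.smooth, h.glue, hp, h.closed⟩

lemma IsClosedForm.formFamily {P : Type*} [NormedAddCommGroup P] [NormedSpace ℝ P] {S : Set P}
    {α : LocalCoeff n X} (h : IsClosedForm α) : FormFamily S (fun _ => α) where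
  smooth e he i j := (h.smooth e he i j).comp contDiffOn_snd fun _ hp => hp.2
  glues _ _ := h.glue

lemma IsClosedForm.add {α β : LocalCoeff n X} (hα : IsClosedForm α) (hβ : IsClosedForm β) :
    IsClosedForm (α + β) where
  smooth e he i j := (hα.smooth e he i j).add (hβ.smooth e he i j)
  glue := hα.glue.add hβ.glue
  hermitian e he z hz := (hα.hermitian e he z hz).add (hβ.hermitian e he z hz)
  closed e he z hz i j k := by
    have d {γ : LocalCoeff n X} (hγ : IsClosedForm γ) (i j : Fin n) :
        DifferentiableAt ℝ (fun w => γ e w i j) z :=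
      (hγ.smooth e he i j).differentiableAt_of_isOpen e.open_target hz
    have h1 := hα.closed e he z hz i j k
    have h2 := hβ.closed e he z hz i j k
    simp only [dz_eq_wirt, Pi.add_apply, Matrix.add_apply] at h1 h2 ⊢
    rw [wirt_add (d hα i j) (d hβ i j), wirt_add (d hα k j) (d hβ k j), h1, h2]

lemma IsClosedForm.smul {α : LocalCoeff n X} (hα : IsClosedForm α) (c : ℝ) :
    IsClosedForm (c • α) where
  smooth e he i j := (contDiffOn_const (c := c)).fun_smul (hα.smooth e he i j)
  glue := hα.glue.smul c
  hermitian e he z hz := by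
    have h1 := hα.hermitian e he z hz
    simp only [Pi.smul_apply, Matrix.IsHermitian, Matrix.conjTranspose_smul, h1.eq, star_trivial]
  closed e he z hz i j k := by
    have d (i j : Fin n) : DifferentiableAt ℝ (fun w => α e w i j) z :=
      (hα.smooth e he i j).differentiableAt_of_isOpen e.open_target hz
    have h1 := hα.closed e he z hz i j k
    simp only [dz_eq_wirt, Pi.smul_apply, Matrix.smul_apply, Complex.real_smul] at h1 ⊢
    rw [wirt_const_mul (d i j), wirt_const_mul (d k j), h1]

lemma ChartSmooth.ofReal {f : X → ℝ} (hf : ChartSmooth n f)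
    {e : OpenPartialHomeomorph X (Fin n → ℂ)} (he : e ∈ atlas (Fin n → ℂ) X) :
    ContDiffOn ℝ ∞ (fun w => (f (e.symm w) : ℂ)) e.target :=
  Complex.ofRealCLM.contDiff.comp_contDiffOn (hf e he)

lemma isClosedForm_ddbarForm [IsManifold 𝓘(ℂ, Fin n → ℂ) ω X] {f : X → ℝ}
    (hf : ChartSmooth n f) : IsClosedForm (ddbarForm (n := n) f) where
  smooth e he i j := contDiffOn_ddbar e.open_target (hf.ofReal he) i j
  glue := glues_ddbarForm hf
  hermitian e he _ hz := isHermitian_ddbar e.open_target (hf.ofReal he) hz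
  closed e he _ hz i j k := closed_ddbar e.open_target (hf.ofReal he) hz i j k

lemma ddbarForm_sum {ι : Type*} {s : Finset ι} {f : ι → X → ℝ} (hf : ∀ i, ChartSmooth n (f i))
    {e : OpenPartialHomeomorph X (Fin n → ℂ)} (he : e ∈ atlas (Fin n → ℂ) X) {z : Fin n → ℂ}
    (hz : z ∈ e.target) :
    ddbarForm (fun x => ∑ i ∈ s, f i x) e z = ∑ i ∈ s, ddbarForm (f i) e z := by
  have h := ddbar_sum e.open_target (s := s) (fun i _ => (hf i).ofReal he) hz
  simpa [ddbarForm] using h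

lemma ddbarForm_smul {f : X → ℝ} (hf : ChartSmooth n f) (c : ℝ)
    {e : OpenPartialHomeomorph X (Fin n → ℂ)} (he : e ∈ atlas (Fin n → ℂ) X) {z : Fin n → ℂ}
    (hz : z ∈ e.target) : ddbarForm (c • f) e z = c • ddbarForm f e z := by
  have h := ddbar_const_mul e.open_target (hf.ofReal he) (c : ℂ) hz
  simpa [ddbarForm, Complex.coe_smul] using h

lemma chartAt_mem_target (x : X) : chartAt (Fin n → ℂ) x x ∈ (chartAt (Fin n → ℂ) x).target :=
  (chartAt (Fin n → ℂ) x).map_source (mem_chart_source _ x)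

lemma coeffAt_ddbarForm_smul {f : X → ℝ} (hf : ChartSmooth n f) (c : ℝ) (x : X) :
    coeffAt (ddbarForm (n := n) (c • f)) x = c • coeffAt (ddbarForm f) x :=
  ddbarForm_smul hf c (chart_mem_atlas _ x) (chartAt_mem_target x)

lemma coeffAt_ddbarForm_sum {ι : Type*} {s : Finset ι} {f : ι → X → ℝ}
    (hf : ∀ i, ChartSmooth n (f i)) (x : X) :
    coeffAt (ddbarForm (n := n) (fun y => ∑ i ∈ s, f i y)) x =
      ∑ i ∈ s, coeffAt (ddbarForm (f i)) x :=
  ddbarForm_sum hf (chart_mem_atlas _ x) (chartAt_mem_target x)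

lemma coeffAt_ddbarForm_eq_zero {f : X → ℝ} {x : X} {c : ℝ} (h : f =ᶠ[𝓝 x] fun _ => c) :
    coeffAt (ddbarForm (n := n) f) x = 0 := by
  set e := chartAt (Fin n → ℂ) x
  have hx : x ∈ e.source := mem_chart_source _ x
  have hc : Tendsto e.symm (𝓝 (e x)) (𝓝 x) := by
    have := (e.continuousAt_symm (e.map_source hx)).tendsto
    rwa [e.left_inv hx] at this
  obtain ⟨V, hV, hVo, hxV⟩ := eventually_nhds_iff.1 (hc.eventually h)
  have h1 := ddbar_congr hVo (f := fun w => (f (e.symm w) : ℂ)) (g := fun _ => (c : ℂ))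
    (fun w hw => by simp [hV w hw]) hxV
  rw [ddbar_const] at h1
  exact h1

lemma continuous_detRatio₁ {χ : LocalCoeff n X} (hχ : IsKahlerForm χ)
    {g h : LocalCoeff n X} (hg : IsClosedForm g) (hh : IsClosedForm h) :
    Continuous (detRatio₁ χ g h) :=
  ((smoothFamily_detRatio₁ (S := (univ : Set ℝ)) hχ hg.formFamily hh.formFamily).chartSmooth
    (mem_univ 0)).continuous

end ClosedForms

/-! ### Global symmetry of `v ↦ n √-1 ∂∂̄v ∧ gⁿ⁻¹`. -/

section Symmetry

variable {n : ℕ} {X : Type*} [TopologicalSpace X] [CompactSpace X] [T2Space X]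
  [ChartedSpace (Fin n → ℂ) X] [IsManifold 𝓘(ℂ, Fin n → ℂ) ω X]
  [MeasurableSpace X] [BorelSpace X] {χ : LocalCoeff n X}

/-- Only `u` is supported in the chart. This suffices, because on the right `u` enters through its
second derivatives and these vanish off `K` too. -/
lemma integral_detRatio₁_comm_of_support (hχ : IsKahlerForm χ) {g : LocalCoeff n X}
    (hg : IsClosedForm g) {e : OpenPartialHomeomorph X (Fin n → ℂ)}
    (he : e ∈ atlas (Fin n → ℂ) X) {K : Set X} (hK : IsCompact K) (hKe : K ⊆ e.source)
    {u v : X → ℝ} (hu : ChartSmooth n u) (hv : ChartSmooth n v) (h0 : ∀ x, x ∉ K → u x = 0) :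
    ∫ x, u x * detRatio₁ χ g (ddbarForm v) x ∂(topPower χ) =
      ∫ x, v x * detRatio₁ χ g (ddbarForm u) x ∂(topPower χ) := by
  have hU := isClosedForm_ddbarForm hu
  have hV := isClosedForm_ddbarForm hv
  have c1 := hu.continuous.fun_mul (continuous_detRatio₁ hχ hg hV)
  have c2 := hv.continuous.fun_mul (continuous_detRatio₁ hχ hg hU)
  rw [← sub_eq_zero, ← integral_sub (integrable_topPower hχ c1) (integrable_topPower hχ c2),
    integral_topPower_of_source hχ he (c1.fun_sub c2)]
  · have hKt : IsCompact (e '' K) := hK.image_of_continuousOn (e.continuousOn.mono hKe)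
    have hKs : e '' K ⊆ e.target := by
      rintro _ ⟨x, hx, rfl⟩
      exact e.map_source (hKe hx)
    have h1 := setIntegral_detDeriv_ddbar_comm e.open_target hKt hKs (hg.smooth e he)
      (hg.hermitian e he) (hg.closed e he) (hu.ofReal he) (hv.ofReal he) (fun z hz hzK => by
        rw [h0, Complex.ofReal_zero]
        exact fun h => hzK ⟨_, h, e.right_inv hz⟩)
    have h2 : EqOn (fun z => volDensity χ e z *
        (u (e.symm z) * detRatio₁ χ g (ddbarForm v) (e.symm z) -
          v (e.symm z) * detRatio₁ χ g (ddbarForm u) (e.symm z)))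
        (fun z => 2 ^ n * (n.factorial : ℝ) * ((u (e.symm z) : ℂ) *
          detDeriv (g e z) (ddbar (fun w => (v (e.symm w) : ℂ)) z) - (v (e.symm z) : ℂ) *
          detDeriv (g e z) (ddbar (fun w => (u (e.symm w) : ℂ)) z)).re) e.target := by
      intro z hz
      have e1 := detRatio₁_eq hχ he (e.map_target hz) hg.glue hV.glue
      have e2 := detRatio₁_eq hχ he (e.map_target hz) hg.glue hU.glue
      rw [e.right_inv hz] at e1 e2
      have e3 := volDensity_mul_re_div hχ he hz (detDeriv (g e z) (ddbarForm v e z))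
      have e4 := volDensity_mul_re_div hχ he hz (detDeriv (g e z) (ddbarForm u e z))
      simp only [Complex.sub_re, Complex.re_ofReal_mul]
      rw [e1, e2]
      simp only [ddbarForm] at e3 e4 ⊢
      linear_combination u (e.symm z) * e3 - v (e.symm z) * e4
    rw [setIntegral_congr_fun e.open_target.measurableSet h2, integral_const_mul]
    have h3 := integral_re h1.1
    simp only [RCLike.re_to_complex] at h3
    rw [h3, h1.2]; simp
  · intro x hx
    have hxK : x ∉ K := fun h => hx (hKe h)
    have h1 : u =ᶠ[𝓝 x] fun _ => 0 := by
      filter_upwards [hK.isClosed.isOpen_compl.mem_nhds hxK] with y hy using h0 y hy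
    simp [h0 x hxK, detRatio₁, coeffAt_ddbarForm_eq_zero h1]

lemma integral_detRatio₁_comm (hχ : IsKahlerForm χ) {g : LocalCoeff n X} (hg : IsClosedForm g)
    {u v : X → ℝ} (hu : ChartSmooth n u) (hv : ChartSmooth n v) :
    ∫ x, u x * detRatio₁ χ g (ddbarForm v) x ∂(topPower χ) =
      ∫ x, v x * detRatio₁ χ g (ddbarForm u) x ∂(topPower χ) := by
  obtain ⟨ι, ρ, e, K, he, hρ, hK, hKe, hρK, hsum⟩ := exists_partition (n := n) (X := X)
  have hρu : ∀ i, ChartSmooth n (fun x => ρ i x * u x) := fun i => (hρ i).mul hu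
  have h1 : ∀ x, u x * detRatio₁ χ g (ddbarForm v) x =
      ∑ i, (ρ i x * u x) * detRatio₁ χ g (ddbarForm v) x := fun x => by
    rw [← Finset.sum_mul, ← Finset.sum_mul, hsum, one_mul]
  -- On this side the partition must be placed inside `∂∂̄`, so that both sides are cut by the same
  -- functions `ρ i * u`.
  have h2 : ∀ x, v x * detRatio₁ χ g (ddbarForm u) x =
      ∑ i, v x * detRatio₁ χ g (ddbarForm fun x => ρ i x * u x) x := fun x => by
    have h3 : u = fun x => ∑ i, ρ i x * u x := by
      funext x; rw [← Finset.sum_mul, hsum, one_mul]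
    have h4 := coeffAt_ddbarForm_sum (s := Finset.univ) hρu x
    rw [← h3] at h4
    simp only [detRatio₁]
    rw [h4, detDeriv_sum, Finset.sum_div, Complex.re_sum, Finset.mul_sum]
  simp only [h1, h2]
  rw [integral_finsetSum _ fun i _ => integrable_topPower hχ ((hρu i).continuous.fun_mul
      (continuous_detRatio₁ hχ hg (isClosedForm_ddbarForm hv))),
    integral_finsetSum _ fun i _ => integrable_topPower hχ (hv.continuous.fun_mul
      (continuous_detRatio₁ hχ hg (isClosedForm_ddbarForm (hρu i))))]
  exact Finset.sum_congr rfl fun i _ => integral_detRatio₁_comm_of_support hχ hg (he i) (hK i)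
    (hKe i) (hρu i) hv fun x hx => by simp [hρK i x hx]

end Symmetry

/-! ### Integrals with parameters, and derivatives of the densities along paths of potentials. -/

section Parametric

variable {n : ℕ} {X : Type*} [TopologicalSpace X] [CompactSpace X]
  [ChartedSpace (Fin n → ℂ) X] [MeasurableSpace X] [BorelSpace X]
  {P : Type*} [NormedAddCommGroup P] [NormedSpace ℝ P] {S : Set P}

lemma SmoothFamily.continuousOn_integral {μ : Measure X} [IsFiniteMeasure μ] {f : P → X → ℝ}
    (hf : SmoothFamily n S f) : ContinuousOn (fun p => ∫ x, f p x ∂μ) S :=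
  continuousOn_integral_of_compact_support isCompact_univ hf.continuousOn
    (fun _ x _ hx => absurd (mem_univ x) hx)

lemma SmoothFamily.hasDerivAt_integral {μ : Measure X} [IsFiniteMeasure μ] {I : Set ℝ}
    (hI : IsOpen I) {f f' : ℝ → X → ℝ} (hf : SmoothFamily n I f) (hf' : SmoothFamily n I f')
    (hd : ∀ t ∈ I, ∀ x, HasDerivAt (fun s => f s x) (f' t x) t) {t : ℝ} (ht : t ∈ I) :
    HasDerivAt (fun s => ∫ x, f s x ∂μ) (∫ x, f' t x ∂μ) t := by
  obtain ⟨r, hr, hrI⟩ := Metric.nhds_basis_closedBall.mem_iff.1 (hI.mem_nhds ht)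
  have hK : IsCompact (Metric.closedBall t r ×ˢ (univ : Set X)) :=
    (isCompact_closedBall t r).prod isCompact_univ
  obtain ⟨C, hC⟩ := hK.exists_bound_of_continuousOn
    (hf'.continuousOn.mono (prod_mono hrI subset_rfl))
  have hc : ∀ s ∈ I, Continuous (f s) := fun s hs => (hf.chartSmooth hs).continuous
  have hc' : ∀ s ∈ I, Continuous (f' s) := fun s hs => (hf'.chartSmooth hs).continuous
  obtain ⟨C₀, hC₀⟩ := isCompact_univ.exists_bound_of_continuousOn (hc t ht).continuousOn
  refine (hasDerivAt_integral_of_dominated_loc_of_deriv_le (bound := fun _ => C)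
    (Metric.closedBall_mem_nhds t hr) ?_ ?_ ?_ ?_ (integrable_const _) ?_).2
  · filter_upwards [hI.mem_nhds ht] with s hs
    exact (hc s hs).stronglyMeasurable.aestronglyMeasurable
  · exact Integrable.of_bound (hc t ht).stronglyMeasurable.aestronglyMeasurable C₀
      (Eventually.of_forall fun x => hC₀ x (mem_univ x))
  · exact (hc' t ht).stronglyMeasurable.aestronglyMeasurable
  · exact Eventually.of_forall fun x s hs => hC (s, x) ⟨hs, mem_univ x⟩
  · exact Eventually.of_forall fun x s hs => hd s (hrI hs) x

end Parametric

section Paths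

variable {n : ℕ} {X : Type*} [TopologicalSpace X] [ChartedSpace (Fin n → ℂ) X]
  {χ Ω : LocalCoeff n X}

lemma hasDerivAt_coeffAt_deform (χ : LocalCoeff n X) {I : Set ℝ} (hI : IsOpen I)
    {φ φ' : ℝ → X → ℝ} (hφ : SmoothFamily n I φ)
    (hd : ∀ t ∈ I, ∀ x, HasDerivAt (fun s => φ s x) (φ' t x) t) {t : ℝ} (ht : t ∈ I) (x : X)
    (i j : Fin n) : HasDerivAt (fun s => coeffAt (deform χ (φ s)) x i j)
      (coeffAt (ddbarForm (n := n) (φ' t)) x i j) t := by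
  set e := chartAt (Fin n → ℂ) x
  have h1 := hasDerivAt_ddbar_param (F := fun s w => (φ s (e.symm w) : ℂ)) hI e.open_target
    (Complex.ofRealCLM.contDiff.comp_contDiffOn (hφ e (chart_mem_atlas _ x))) i j ht
    (chartAt_mem_target x)
  have h2 : (fun w => deriv (fun s => (φ s (e.symm w) : ℂ)) t) =
      fun w => (φ' t (e.symm w) : ℂ) := by
    funext w
    exact (hd t ht (e.symm w)).ofReal_comp.deriv
  rw [h2] at h1
  exact h1.const_add (χ e (e x) i j)

lemma hasDerivAt_re_div {f : ℝ → ℂ} {f' : ℂ} {t : ℝ} (hf : HasDerivAt f f' t) (d : ℂ) :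
    HasDerivAt (fun s => (f s / d).re) (f' / d).re t :=
  Complex.reCLM.hasFDerivAt.comp_hasDerivAt t (hf.div_const d)

lemma hasDerivAt_detRatio {I : Set ℝ} (hI : IsOpen I) {φ φ' : ℝ → X → ℝ}
    (hφ : SmoothFamily n I φ) (hd : ∀ t ∈ I, ∀ x, HasDerivAt (fun s => φ s x) (φ' t x) t)
    {t : ℝ} (ht : t ∈ I) (x : X) :
    HasDerivAt (fun s => detRatio χ (deform χ (φ s)) x)
      (detRatio₁ χ (deform χ (φ t)) (ddbarForm (φ' t)) x) t :=
  hasDerivAt_re_div (hasDerivAt_det fun i j => hasDerivAt_coeffAt_deform χ hI hφ hd ht x i j) _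

lemma hasDerivAt_detRatio₁ {I : Set ℝ} (hI : IsOpen I) {φ φ' : ℝ → X → ℝ}
    (hφ : SmoothFamily n I φ) (hd : ∀ t ∈ I, ∀ x, HasDerivAt (fun s => φ s x) (φ' t x) t)
    {t : ℝ} (ht : t ∈ I) (x : X) :
    HasDerivAt (fun s => detRatio₁ χ (deform χ (φ s)) Ω x)
      (detRatio₂ χ (deform χ (φ t)) Ω (ddbarForm (φ' t)) x) t := by
  have h1 := hasDerivAt_detDeriv
    (fun i j => hasDerivAt_coeffAt_deform χ hI hφ hd ht x i j)
    (h := fun _ => coeffAt Ω x) (h' := 0) (fun _ _ => hasDerivAt_const _ _)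
  rw [detDeriv_zero, add_zero, detDeriv₂_comm] at h1
  exact hasDerivAt_re_div h1 _

/-- The density of `n ω ∧ gⁿ⁻¹ - c gⁿ` with respect to `χⁿ`. -/
def jDensity (χ Ω : LocalCoeff n X) (c : ℝ) (g : LocalCoeff n X) (x : X) : ℝ :=
  detRatio₁ χ g Ω x - c * detRatio χ g x

/-- The differential of `jDensity` in the direction `h`. -/
def jDensity₁ (χ Ω : LocalCoeff n X) (c : ℝ) (g h : LocalCoeff n X) (x : X) : ℝ :=
  detRatio₂ χ g Ω h x - c * detRatio₁ χ g h x

lemma hasDerivAt_jDensity {c : ℝ} {I : Set ℝ} (hI : IsOpen I) {φ φ' : ℝ → X → ℝ}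
    (hφ : SmoothFamily n I φ) (hd : ∀ t ∈ I, ∀ x, HasDerivAt (fun s => φ s x) (φ' t x) t)
    {t : ℝ} (ht : t ∈ I) (x : X) :
    HasDerivAt (fun s => jDensity χ Ω c (deform χ (φ s)) x)
      (jDensity₁ χ Ω c (deform χ (φ t)) (ddbarForm (φ' t)) x) t :=
  (hasDerivAt_detRatio₁ hI hφ hd ht x).sub ((hasDerivAt_detRatio hI hφ hd ht x).const_mul c)

variable {P : Type*} [NormedAddCommGroup P] [NormedSpace ℝ P] {S : Set P}

lemma smoothFamily_jDensity (hχ : IsKahlerForm χ) (hΩ : IsClosedForm Ω) (c : ℝ)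
    {g : P → LocalCoeff n X} (hg : FormFamily S g) :
    SmoothFamily n S (fun p => jDensity χ Ω c (g p)) :=
  (smoothFamily_detRatio₁ hχ hg hΩ.formFamily).sub
    ((smoothFamily_param contDiff_const).mul (smoothFamily_detRatio hχ hg))

lemma smoothFamily_jDensity₁ (hχ : IsKahlerForm χ) (hΩ : IsClosedForm Ω) (c : ℝ)
    {g h : P → LocalCoeff n X} (hg : FormFamily S g) (hh : FormFamily S h) :
    SmoothFamily n S (fun p => jDensity₁ χ Ω c (g p) (h p)) :=
  (smoothFamily_detRatio₂ hχ hg hΩ.formFamily hh).sub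
    ((smoothFamily_param contDiff_const).mul (smoothFamily_detRatio₁ hχ hg hh))

lemma formFamily_deform [IsManifold 𝓘(ℂ, Fin n → ℂ) ω X] (hχ : IsKahlerForm χ) {φ : P → X → ℝ}
    (hφ : SmoothFamily n S φ) : FormFamily S (fun p => deform χ (φ p)) :=
  hχ.formFamily.add (formFamily_ddbarForm hφ)

lemma isClosedForm_deform [IsManifold 𝓘(ℂ, Fin n → ℂ) ω X] (hχ : IsKahlerForm χ) {φ : X → ℝ}
    (hφ : ChartSmooth n φ) : IsClosedForm (deform χ φ) :=
  hχ.isClosedForm.add (isClosedForm_ddbarForm hφ)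

lemma jDensity₁_smul {c : ℝ} {g : LocalCoeff n X} {f : X → ℝ} (hf : ChartSmooth n f) (a : ℝ)
    (x : X) : jDensity₁ χ Ω c g (ddbarForm (a • f)) x = a * jDensity₁ χ Ω c g (ddbarForm f) x := by
  simp only [jDensity₁, detRatio₁, detRatio₂, coeffAt_ddbarForm_smul hf]
  rw [detDeriv_smul, detDeriv₂_comm, detDeriv₂_smul_left, detDeriv₂_comm, mul_div_assoc,
    mul_div_assoc, Complex.re_ofReal_mul, Complex.re_ofReal_mul]
  ring

lemma continuous_jDensity₁ (hχ : IsKahlerForm χ) (hΩ : IsClosedForm Ω) (c : ℝ)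
    {g h : LocalCoeff n X} (hg : IsClosedForm g) (hh : IsClosedForm h) :
    Continuous (jDensity₁ χ Ω c g h) :=
  ((smoothFamily_jDensity₁ (S := (univ : Set ℝ)) hχ hΩ c hg.formFamily hh.formFamily).chartSmooth
    (mem_univ 0)).continuous

lemma SmoothFamily.scale {S : Set ℝ} {φ : ℝ → X → ℝ} (hφ : SmoothFamily n S φ) :
    SmoothFamily n (S ×ˢ (univ : Set ℝ)) (fun p : ℝ × ℝ => p.2 • φ p.1) :=
  (smoothFamily_param contDiff_snd).mul (hφ.comp contDiff_fst fun _ hp => hp.1)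

end Paths

/-! ### Closedness of the 1-form, and its primitive along rays. -/

section Variation

variable {n : ℕ} {X : Type*} [TopologicalSpace X] [CompactSpace X]
  [ChartedSpace (Fin n → ℂ) X] [IsManifold 𝓘(ℂ, Fin n → ℂ) ω X]
  [MeasurableSpace X] [BorelSpace X] {χ Ω : LocalCoeff n X}

/-- The 1-form `ψ ↦ ∫ ψ (n ω ∧ χ_φⁿ⁻¹ - c χ_φⁿ)`, for arbitrary smooth `φ`. -/
def jPoly (χ Ω : LocalCoeff n X) (c : ℝ) (φ ψ : X → ℝ) : ℝ :=
  ∫ x, ψ x * jDensity χ Ω c (deform χ φ) x ∂(topPower χ)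

lemma hasDerivAt_jPoly (hχ : IsKahlerForm χ) (hΩ : IsClosedForm Ω) (c : ℝ) {I : Set ℝ}
    (hI : IsOpen I) {φ φ' ψ ψ' : ℝ → X → ℝ} (hφ : SmoothFamily n I φ) (hφ' : SmoothFamily n I φ')
    (hψ : SmoothFamily n I ψ) (hψ' : SmoothFamily n I ψ')
    (hdφ : ∀ t ∈ I, ∀ x, HasDerivAt (fun s => φ s x) (φ' t x) t)
    (hdψ : ∀ t ∈ I, ∀ x, HasDerivAt (fun s => ψ s x) (ψ' t x) t) {t : ℝ} (ht : t ∈ I) :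
    HasDerivAt (fun s => jPoly χ Ω c (φ s) (ψ s))
      (∫ x, (ψ' t x * jDensity χ Ω c (deform χ (φ t)) x +
        ψ t x * jDensity₁ χ Ω c (deform χ (φ t)) (ddbarForm (φ' t)) x) ∂(topPower χ)) t := by
  have := isFiniteMeasure_topPower hχ
  have hg := formFamily_deform hχ hφ
  have hD := smoothFamily_jDensity hχ hΩ c hg
  have hD' := smoothFamily_jDensity₁ hχ hΩ c hg (formFamily_ddbarForm hφ')
  exact SmoothFamily.hasDerivAt_integral hI
    (f' := fun t x => ψ' t x * jDensity χ Ω c (deform χ (φ t)) x +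
        ψ t x * jDensity₁ χ Ω c (deform χ (φ t)) (ddbarForm (φ' t)) x)
    (hψ.mul hD) ((hψ'.mul hD).add (hψ.mul hD'))
    (fun s hs x => (hdψ s hs x).mul (hasDerivAt_jDensity hI hφ hdφ hs x)) ht

/-- The functional with differential `jPoly`. -/
def jPrimitive (χ Ω : LocalCoeff n X) (c : ℝ) (φ : X → ℝ) : ℝ :=
  ∫ s in (0 : ℝ)..1, jPoly χ Ω c (s • φ) φ

/-- Here `S` need not be open: this is what carries convexity from the open time interval to the end
`t = 0`. -/
lemma continuousOn_jPrimitive (hχ : IsKahlerForm χ) (hΩ : IsClosedForm Ω) (c : ℝ) {S : Set ℝ}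
    {φ : ℝ → X → ℝ} (hφ : SmoothFamily n S φ) :
    ContinuousOn (fun t => jPrimitive χ Ω c (φ t)) S := by
  have := isFiniteMeasure_topPower hχ
  have h1 : SmoothFamily n (S ×ˢ (univ : Set ℝ)) (fun (p : ℝ × ℝ) x => φ p.1 x) :=
    hφ.comp contDiff_fst fun _ hp => hp.1
  have h2 : ContinuousOn (fun p : ℝ × ℝ => jPoly χ Ω c (p.2 • φ p.1) (φ p.1))
      (S ×ˢ (univ : Set ℝ)) :=
    (h1.mul (smoothFamily_jDensity hχ hΩ c
      (formFamily_deform hχ hφ.scale))).continuousOn_integral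
  rw [continuousOn_iff_continuous_domRestrict]
  refine intervalIntegral.continuous_parametric_intervalIntegral_of_continuous'
    (f := fun (t : S) s => jPoly χ Ω c (s • φ t) (φ t)) ?_ 0 1
  exact h2.comp_continuous (f := fun p : S × ℝ => ((p.1 : ℝ), p.2)) (by fun_prop)
    fun p => ⟨p.1.2, mem_univ _⟩

variable [T2Space X]

/-- The derivative at `s = 0` of the symmetry of `detRatio₁` for the form `g + s ω`. That form need
not be positive, but it is closed for every `s`, which is all that the symmetry requires. -/
lemma integral_detRatio₂_comm (hχ : IsKahlerForm χ) (hΩ : IsClosedForm Ω) {g : LocalCoeff n X}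
    (hg : IsClosedForm g) {u v : X → ℝ} (hu : ChartSmooth n u) (hv : ChartSmooth n v) :
    ∫ x, u x * detRatio₂ χ g Ω (ddbarForm v) x ∂(topPower χ) =
      ∫ x, v x * detRatio₂ χ g Ω (ddbarForm u) x ∂(topPower χ) := by
  have := isFiniteMeasure_topPower hχ
  have hfam : FormFamily (univ : Set ℝ) (fun s : ℝ => g + s • Ω) :=
    hg.formFamily.add (hΩ.formFamily.smul contDiff_id)
  have key : ∀ {u v : X → ℝ}, ChartSmooth n u → ChartSmooth n v →
      HasDerivAt (fun s : ℝ => ∫ x, u x * detRatio₁ χ (g + s • Ω) (ddbarForm v) x ∂(topPower χ))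
        (∫ x, u x * detRatio₂ χ g Ω (ddbarForm v) x ∂(topPower χ)) 0 := by
    intro u v hu hv
    have hV := isClosedForm_ddbarForm hv
    have h1 := SmoothFamily.hasDerivAt_integral (μ := topPower χ) isOpen_univ
      (f := fun s x => u x * detRatio₁ χ (g + s • Ω) (ddbarForm v) x)
      (f' := fun s x => u x * detRatio₂ χ (g + s • Ω) Ω (ddbarForm v) x)
      (hu.smoothFamily.mul (smoothFamily_detRatio₁ hχ hfam hV.formFamily))
      (hu.smoothFamily.mul (smoothFamily_detRatio₂ hχ hfam hΩ.formFamily hV.formFamily))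
      (fun t _ x => by
        have h2 := hasDerivAt_detDeriv (hasDerivAt_add_smul (coeffAt g x) (coeffAt Ω x) t)
          (h := fun _ => coeffAt (ddbarForm v) x) (h' := 0) (fun _ _ => hasDerivAt_const _ _)
        rw [detDeriv_zero, add_zero] at h2
        exact (hasDerivAt_re_div h2 _).const_mul (u x)) (mem_univ 0)
    simpa using h1
  have h1 := key hu hv
  have h2 : ∀ s : ℝ, ∫ x, u x * detRatio₁ χ (g + s • Ω) (ddbarForm v) x ∂(topPower χ) =
      ∫ x, v x * detRatio₁ χ (g + s • Ω) (ddbarForm u) x ∂(topPower χ) := fun s =>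
    integral_detRatio₁_comm hχ (hg.add (hΩ.smul s)) hu hv
  simp only [h2] at h1
  exact h1.unique (key hv hu)

/-- The differential of the 1-form `ψ ↦ ∫ ψ (n ω ∧ χ_φⁿ⁻¹ - c χ_φⁿ)` is symmetric. -/
lemma integral_jDensity₁_comm (hχ : IsKahlerForm χ) (hΩ : IsClosedForm Ω) (c : ℝ)
    {g : LocalCoeff n X} (hg : IsClosedForm g) {u v : X → ℝ} (hu : ChartSmooth n u)
    (hv : ChartSmooth n v) :
    ∫ x, u x * jDensity₁ χ Ω c g (ddbarForm v) x ∂(topPower χ) =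
      ∫ x, v x * jDensity₁ χ Ω c g (ddbarForm u) x ∂(topPower χ) := by
  have key : ∀ {u v : X → ℝ}, ChartSmooth n u → ChartSmooth n v →
      ∫ x, u x * jDensity₁ χ Ω c g (ddbarForm v) x ∂(topPower χ) =
        ∫ x, u x * detRatio₂ χ g Ω (ddbarForm v) x ∂(topPower χ) -
          c * ∫ x, u x * detRatio₁ χ g (ddbarForm v) x ∂(topPower χ) := by
    intro u v hu hv
    have hV := isClosedForm_ddbarForm hv
    have c2 : Continuous (detRatio₂ χ g Ω (ddbarForm v)) :=
      ((smoothFamily_detRatio₂ (S := (univ : Set ℝ)) hχ hg.formFamily hΩ.formFamily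
        hV.formFamily).chartSmooth (mem_univ 0)).continuous
    rw [← integral_const_mul, ← integral_sub (integrable_topPower hχ (hu.continuous.fun_mul c2))
      ((integrable_topPower hχ
        (hu.continuous.fun_mul (continuous_detRatio₁ hχ hg hV))).const_mul c)]
    congr 1
    funext x
    simp only [jDensity₁]
    ring
  rw [key hu hv, key hv hu, integral_detRatio₂_comm hχ hΩ hg hu hv,
    integral_detRatio₁_comm hχ hg hu hv]

/-- The differential of `jPrimitive` along a path. -/
lemma hasDerivAt_jPrimitive (hχ : IsKahlerForm χ) (hΩ : IsClosedForm Ω) (c : ℝ) {I : Set ℝ}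
    (hI : IsOpen I) {φ φ' : ℝ → X → ℝ} (hφ : SmoothFamily n I φ) (hφ' : SmoothFamily n I φ')
    (hd : ∀ t ∈ I, ∀ x, HasDerivAt (fun s => φ s x) (φ' t x) t) {t : ℝ} (ht : t ∈ I) :
    HasDerivAt (fun t => jPrimitive χ Ω c (φ t)) (jPoly χ Ω c (φ t) (φ' t)) t := by
  have := isFiniteMeasure_topPower hχ
  -- The `t`-derivative of the integrand at the point `s` of the ray.
  set F' : ℝ → ℝ → ℝ := fun t s => ∫ x, (φ' t x * jDensity χ Ω c (deform χ (s • φ t)) x +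
        φ t x * jDensity₁ χ Ω c (deform χ (s • φ t)) (ddbarForm (s • φ' t)) x) ∂(topPower χ)
  have hfst : ∀ {f : ℝ → X → ℝ}, SmoothFamily n I f →
      SmoothFamily n (I ×ˢ (univ : Set ℝ)) (fun (p : ℝ × ℝ) x => f p.1 x) := fun hf =>
    hf.comp contDiff_fst fun _ hp => hp.1
  have hdens := smoothFamily_jDensity hχ hΩ c (formFamily_deform hχ hφ.scale)
  have hdens₁ := smoothFamily_jDensity₁ hχ hΩ c (formFamily_deform hχ hφ.scale)
    (formFamily_ddbarForm hφ'.scale)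
  have hFc : ContinuousOn (fun p : ℝ × ℝ => jPoly χ Ω c (p.2 • φ p.1) (φ p.1))
      (I ×ˢ (univ : Set ℝ)) := ((hfst hφ).mul hdens).continuousOn_integral
  have hF'c : ContinuousOn (fun p : ℝ × ℝ => F' p.1 p.2) (I ×ˢ (univ : Set ℝ)) :=
    (((hfst hφ').mul hdens).add ((hfst hφ).mul hdens₁)).continuousOn_integral
  have hslice : ∀ {G : ℝ × ℝ → ℝ}, ContinuousOn G (I ×ˢ (univ : Set ℝ)) → ∀ t ∈ I,
      Continuous fun s => G (t, s) := fun hG t ht =>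
    hG.comp_continuous (Continuous.prodMk_right t) fun s => ⟨ht, mem_univ s⟩
  have hsc : ∀ (s : ℝ) {f : ℝ → X → ℝ}, SmoothFamily n I f →
      SmoothFamily n I (fun t => s • f t) := fun s f hf =>
    (smoothFamily_param (contDiff_const (c := s))).mul hf
  have hdF : ∀ t ∈ I, ∀ s, HasDerivAt (fun t => jPoly χ Ω c (s • φ t) (φ t)) (F' t s) t :=
    fun t ht s => hasDerivAt_jPoly hχ hΩ c hI (hsc s hφ) (hsc s hφ') hφ hφ'
      (fun t ht x => (hd t ht x).const_mul s) hd ht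
  obtain ⟨r, hr, hrI⟩ := Metric.nhds_basis_closedBall.mem_iff.1 (hI.mem_nhds ht)
  obtain ⟨C, hC⟩ := ((isCompact_closedBall t r).prod
    (isCompact_Icc (a := (0 : ℝ)) (b := 1))).exists_bound_of_continuousOn
    (hF'c.mono (prod_mono hrI (subset_univ _)))
  have h1 := (intervalIntegral.hasDerivAt_integral_of_dominated_loc_of_deriv_le (μ := volume)
    (a := 0) (b := 1) (bound := fun _ => C) (F := fun t s => jPoly χ Ω c (s • φ t) (φ t))
    (F' := F') (Metric.closedBall_mem_nhds t hr)
    (by filter_upwards [hI.mem_nhds ht] with t ht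
        exact (hslice hFc t ht).aestronglyMeasurable)
    ((hslice hFc t ht).intervalIntegrable _ _) (hslice hF'c t ht).aestronglyMeasurable
    (Eventually.of_forall fun s hs t ht => hC (t, s) ⟨ht, by
      rw [uIoc_of_le zero_le_one] at hs; exact Ioc_subset_Icc_self hs⟩)
    intervalIntegrable_const
    (Eventually.of_forall fun s _ t ht => hdF t (hrI ht) s)).2
  refine h1.congr_deriv ?_
  have hs1 := hφ.chartSmooth ht
  have hs2 := hφ'.chartSmooth ht
  -- Symmetry moves `∂∂̄` from `φ' t` to `φ t`. The `t`-derivative then becomes an exact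
  -- `s`-derivative, and its integral over `[0, 1]` is the value at `s = 1`.
  have hT : ∀ s, HasDerivAt (fun s => s * jPoly χ Ω c (s • φ t) (φ' t)) (F' t s) s := by
    intro s
    have hline : ∀ {f : X → ℝ}, ChartSmooth n f →
        SmoothFamily n (univ : Set ℝ) (fun s : ℝ => s • f) := fun hf =>
      (smoothFamily_param contDiff_id).mul hf.smoothFamily
    have hlin := hline hs1
    have h2 := (hasDerivAt_id s).mul (hasDerivAt_jPoly hχ hΩ c isOpen_univ hlin
      (φ' := fun _ => φ t) hs1.smoothFamily (ψ := fun _ => φ' t) (ψ' := fun _ _ => 0)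
      hs2.smoothFamily (chartSmooth_const 0).smoothFamily
      (fun s _ x => by simpa using (hasDerivAt_id s).mul_const (φ t x))
      (fun s _ x => hasDerivAt_const _ _) (mem_univ s))
    refine h2.congr_deriv ?_
    have hg := isClosedForm_deform hχ (hlin.chartSmooth (mem_univ s))
    have cD : Continuous (jDensity χ Ω c (deform χ (s • φ t))) :=
      ((smoothFamily_jDensity (S := (univ : Set ℝ)) hχ hΩ c hg.formFamily).chartSmooth
        (mem_univ 0)).continuous
    have c2 := continuous_jDensity₁ hχ hΩ c hg (isClosedForm_ddbarForm hs2)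
    have e1 : F' t s = (∫ x, φ' t x * jDensity χ Ω c (deform χ (s • φ t)) x ∂(topPower χ)) +
        s * ∫ x, φ t x * jDensity₁ χ Ω c (deform χ (s • φ t)) (ddbarForm (φ' t)) x
          ∂(topPower χ) := by
      rw [← integral_const_mul, ← integral_add
        (integrable_topPower hχ (hs2.continuous.fun_mul cD))
        ((integrable_topPower hχ (hs1.continuous.fun_mul c2)).const_mul s)]
      refine integral_congr_ae (Eventually.of_forall fun x => ?_)
      simp only [jDensity₁_smul hs2]
      ring
    rw [e1, integral_jDensity₁_comm hχ hΩ c hg hs1 hs2]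
    simp [jPoly]
  rw [intervalIntegral.integral_eq_sub_of_hasDerivAt (fun s _ => hT s)
    ((hslice hF'c t ht).intervalIntegrable _ _)]
  simp

end Variation

/-! ### Positive definite matrices. -/

section PositiveMatrices

variable {n : ℕ} {g k : Matrix (Fin n) (Fin n) ℂ}

lemma re_mul_div_of_isHermitian (hg : g.IsHermitian) (hk : k.IsHermitian) (t : ℂ) :
    (g.det * t / k.det).re = (g.det / k.det).re * t.re := by
  have h1 : g.det = (g.det.re : ℂ) := Complex.ext rfl (det_im_eq_zero hg)
  have h2 : k.det = (k.det.re : ℂ) := Complex.ext rfl (det_im_eq_zero hk)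
  rw [h1, h2, mul_div_right_comm, ← Complex.ofReal_div, Complex.re_ofReal_mul, Complex.ofReal_re]

lemma re_det_div_det_pos (hg : g.PosDef) (hk : k.PosDef) : 0 < (g.det / k.det).re := by
  have h2 : k.det = (k.det.re : ℂ) := Complex.ext rfl (det_im_eq_zero hk.isHermitian)
  rw [h2, Complex.div_ofReal_re]
  exact div_pos (Complex.lt_def.1 hg.det_pos).1 (Complex.lt_def.1 hk.det_pos).1

lemma trace_mul_vecMulVec_star (g : Matrix (Fin n) (Fin n) ℂ) (a : Fin n → ℂ) :
    (g * Matrix.vecMulVec a (star a)).trace = dotProduct (star a) (g.mulVec a) := by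
  rw [Matrix.mul_vecMulVec, Matrix.trace_vecMulVec, dotProduct_comm]

lemma _root_.Matrix.PosDef.isUnit_det (hg : g.PosDef) : IsUnit g.det :=
  isUnit_iff_ne_zero.2 hg.det_pos.ne'

/-- The positivity behind the convexity of the functional: the trace of `g⁻¹ w g⁻¹` against a
form of rank one is nonnegative. -/
lemma detDeriv₂_vecMulVec_le {w : Matrix (Fin n) (Fin n) ℂ} (hg : g.PosDef) (hk : k.PosDef)
    (hw : w.PosDef) (a : Fin n → ℂ) :
    (detDeriv₂ g w (Matrix.vecMulVec a (star a)) / k.det).re ≤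
      (g⁻¹ * w).trace.re * (detDeriv g (Matrix.vecMulVec a (star a)) / k.det).re := by
  rw [detDeriv_of_isUnit hg.isUnit_det, detDeriv₂_of_isUnit hg.isUnit_det,
    re_mul_div_of_isHermitian hg.isHermitian hk.isHermitian,
    re_mul_div_of_isHermitian hg.isHermitian hk.isHermitian, ← mul_assoc (g⁻¹ * w),
    trace_mul_vecMulVec_star, trace_mul_vecMulVec_star]
  have h1 : 0 ≤ dotProduct (star a) (g⁻¹.mulVec a) :=
    hg.inv.posSemidef.dotProduct_mulVec_nonneg a
  have h2 : 0 ≤ dotProduct (star a) ((g⁻¹ * w * g⁻¹).mulVec a) := by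
    -- `g⁻¹ w g⁻¹` is a congruence of `w`, because `g⁻¹` is Hermitian.
    have h3 := hw.posSemidef.conjTranspose_mul_mul_same g⁻¹
    rw [hg.inv.isHermitian.eq] at h3
    exact h3.dotProduct_mulVec_nonneg a
  have h4 := (Complex.le_def.1 h1).2
  have h5 := (Complex.le_def.1 h2).1
  have h6 := re_det_div_det_pos hg hk
  simp only [Complex.zero_im, Complex.zero_re] at h4 h5
  -- Since `a* g⁻¹ a` is real, the product of traces has the product of real parts as its real part.
  -- The two sides then differ by a positive multiple of `a* g⁻¹ w g⁻¹ a`.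
  rw [Complex.sub_re, Complex.mul_re, ← h4]
  nlinarith

/-- Compactness of the unit sphere makes positivity of the quadratic form uniform in `v`, and
scaling covers the other nonzero vectors. The Hermitian condition makes the form real. -/
lemma eventually_posDef {Y : Type*} [TopologicalSpace Y] {M : Y → Matrix (Fin n) (Fin n) ℂ}
    {y : Y} (hM : ContinuousAt M y) (hy : (M y).PosDef)
    (hH : ∀ᶠ p in 𝓝 y, (M p).IsHermitian) : ∀ᶠ p in 𝓝 y, (M p).PosDef := by
  have h1 : ∀ᶠ p in 𝓝 y, ∀ v ∈ Metric.sphere (0 : Fin n → ℂ) 1,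
      0 < (dotProduct (star v) ((M p).mulVec v)).re := by
    refine (isCompact_sphere _ _).eventually_forall_of_forall_eventually fun v hv => ?_
    have hv0 : v ≠ 0 := by
      rintro rfl
      simp at hv
    have hc : ContinuousAt (fun q : Y × (Fin n → ℂ) =>
        (dotProduct (star q.2) ((M q.1).mulVec q.2)).re) (y, v) := by
      have hM' : ContinuousAt (fun q : Y × (Fin n → ℂ) => M q.1) (y, v) :=
        ContinuousAt.comp (f := Prod.fst) hM continuousAt_fst
      have hq : ContinuousAt (fun q : Y × (Fin n → ℂ) => (M q.1, q.2)) (y, v) :=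
        hM'.prodMk continuousAt_snd
      have hF : Continuous fun q : Matrix (Fin n) (Fin n) ℂ × (Fin n → ℂ) =>
          (dotProduct (star q.2) (q.1.mulVec q.2)).re :=
        Complex.continuous_re.comp (continuous_snd.star.dotProduct
          (continuous_fst.matrix_mulVec continuous_snd))
      exact ContinuousAt.comp (f := fun q : Y × (Fin n → ℂ) => (M q.1, q.2)) hF.continuousAt hq
    exact hc.eventually_const_lt (Complex.lt_def.1 (hy.dotProduct_mulVec_pos hv0)).1
  filter_upwards [h1, hH] with p hp hHp
  refine Matrix.PosDef.of_dotProduct_mulVec_pos hHp fun v hv => ?_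
  have him : (dotProduct (star v) ((M p).mulVec v)).im = 0 := hHp.im_star_dotProduct_mulVec_self v
  have h2 := hp ((‖v‖⁻¹ : ℝ) • v) (by
    rw [mem_sphere_zero_iff_norm, norm_smul, norm_inv, norm_norm, inv_mul_cancel₀ (by simpa)])
  rw [Matrix.mulVec_smul, dotProduct_smul, star_smul, smul_dotProduct, star_trivial,
    Complex.smul_re, Complex.smul_re, smul_smul, smul_eq_mul] at h2
  have h3 : 0 < (dotProduct (star v) ((M p).mulVec v)).re :=
    pos_of_mul_pos_right h2 (by positivity)
  exact Complex.lt_def.2 ⟨h3, him.symm⟩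

end PositiveMatrices

/-! ### The space of Kähler potentials: star-shaped about `0` and open along lines. -/

section KahlerPotentials

variable {n : ℕ} {X : Type*} [TopologicalSpace X] [ChartedSpace (Fin n → ℂ) X]
  {χ Ω g : LocalCoeff n X}

lemma IsKahlerForm.posDef_coeffAt (hg : IsKahlerForm g) (x : X) : (coeffAt g x).PosDef :=
  hg.posDef _ (chart_mem_atlas _ x) _ (chartAt_mem_target x)

lemma traceForm_eq_detRatio₁ (hg : IsKahlerForm g) (Ω : LocalCoeff n X) (x : X) :
    traceForm g Ω x = detRatio₁ g g Ω x := by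
  have h := hg.posDef_coeffAt x
  rw [detRatio₁, detDeriv_of_isUnit h.isUnit_det, mul_div_cancel_left₀ _ h.det_pos.ne']
  rfl

lemma continuous_traceForm (hg : IsKahlerForm g) (hΩ : IsClosedForm Ω) :
    Continuous (traceForm g Ω) := by
  rw [show traceForm g Ω = detRatio₁ g g Ω from funext (traceForm_eq_detRatio₁ hg Ω)]
  exact continuous_detRatio₁ hg hg.isClosedForm hΩ

lemma jDensity_eq (hχ : IsKahlerForm χ) (hg : IsKahlerForm g) (Ω : LocalCoeff n X) (c : ℝ)
    (x : X) : jDensity χ Ω c g x = (traceForm g Ω x - c) * detRatio χ g x := by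
  have h := hg.posDef_coeffAt x
  rw [jDensity, detRatio₁, detDeriv_of_isUnit h.isUnit_det,
    re_mul_div_of_isHermitian h.isHermitian (hχ.posDef_coeffAt x).isHermitian]
  simp only [detRatio, traceForm, coeffAt]
  ring

lemma posDef_transition (hχ : IsKahlerForm χ) (hg : Glues g)
    {e e' : OpenPartialHomeomorph X (Fin n → ℂ)} (he : e ∈ atlas (Fin n → ℂ) X)
    (he' : e' ∈ atlas (Fin n → ℂ) X) {x : X} (hx : x ∈ e.source ∩ e'.source)
    (h : (g e' (e' x)).PosDef) : (g e (e x)).PosDef := by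
  rw [hg e he e' he' x hx]
  refine h.mul_mul_conjTranspose_same (Matrix.vecMul_injective_of_isUnit ?_)
  exact (Matrix.isUnit_iff_isUnit_det _).2
    (isUnit_iff_ne_zero.2 (left_ne_zero_of_mul (det_jacobian_ne_zero hχ he he' hx)))

lemma IsSmooth.const_smul {φ : X → ℝ} (hφ : IsSmooth n φ) (s : ℝ) : IsSmooth n (s • φ) := by
  have h : ContMDiff 𝓘(ℝ, Fin n → ℂ) 𝓘(ℝ, ℝ) ∞ (fun _ : X => s) := contMDiff_const
  exact h.smul hφ

variable [IsManifold 𝓘(ℂ, Fin n → ℂ) ω X]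

lemma isKahlerForm_deform (hχ : IsKahlerForm χ) {φ : X → ℝ} (hφ : φ ∈ potentials χ) :
    IsKahlerForm (deform χ φ) :=
  (isClosedForm_deform hχ hφ.1.chartSmooth).isKahlerForm hφ.2

/-- `χ_{sφ}` is the convex combination `(1 - s) χ + s χ_φ`. -/
lemma smul_mem_potentials (hχ : IsKahlerForm χ) {φ : X → ℝ} (hφ : φ ∈ potentials χ) {s : ℝ}
    (hs : s ∈ Icc (0 : ℝ) 1) : s • φ ∈ potentials χ := by
  refine ⟨IsSmooth.const_smul hφ.1 s, fun e he z hz => ?_⟩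
  have h1 : deform χ (s • φ) e z = (1 - s) • χ e z + s • deform χ φ e z := by
    have h2 := ddbarForm_smul hφ.1.chartSmooth s he hz
    simp only [deform_eq, Pi.add_apply, h2]
    module
  rw [h1]
  rcases hs.1.eq_or_lt with rfl | h0
  · simpa using hχ.posDef e he z hz
  · exact Matrix.PosDef.posSemidef_add
      ((hχ.posDef e he z hz).posSemidef.smul (sub_nonneg.2 hs.2)) ((hφ.2 e he z hz).smul h0)

/-- `jFunctional` is identified with the smooth primitive only on potentials, so differentiating it
at `φ` requires a full neighbourhood of `s = 0` inside that space. Compactness of `X` makes this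
neighbourhood uniform. -/
lemma eventually_add_smul_mem_potentials [CompactSpace X] (hχ : IsKahlerForm χ) {φ ψ : X → ℝ}
    (hφ : φ ∈ potentials χ) (hψ : IsSmooth n ψ) :
    ∀ᶠ s : ℝ in 𝓝 0, φ + s • ψ ∈ potentials χ := by
  have hsm : ∀ s : ℝ, IsSmooth n (φ + s • ψ) := fun s => hφ.1.add (IsSmooth.const_smul hψ s)
  have hcl : ∀ s : ℝ, IsClosedForm (deform χ (φ + s • ψ)) := fun s =>
    isClosedForm_deform hχ (hsm s).chartSmooth
  have hpath : SmoothFamily n (univ : Set ℝ) (fun s : ℝ => φ + s • ψ) :=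
    hφ.1.chartSmooth.smoothFamily.add
      ((smoothFamily_param contDiff_id).mul hψ.chartSmooth.smoothFamily)
  have h1 : ∀ᶠ s : ℝ in 𝓝 0, ∀ x ∈ (univ : Set X), (coeffAt (deform χ (φ + s • ψ)) x).PosDef := by
    refine isCompact_univ.eventually_forall_of_forall_eventually fun x _ => ?_
    set e := chartAt (Fin n → ℂ) x
    have he : e ∈ atlas (Fin n → ℂ) X := chart_mem_atlas _ x
    have hx : x ∈ e.source := mem_chart_source _ x
    have hs : ∀ᶠ q : ℝ × X in 𝓝 (0, x), q.2 ∈ e.source :=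
      continuousAt_snd.eventually (e.open_source.mem_nhds hx)
    have h2 : ∀ᶠ q : ℝ × X in 𝓝 (0, x), (deform χ (φ + q.1 • ψ) e (e q.2)).PosDef := by
      refine eventually_posDef ?_ ?_ ?_
      · have h3 : ContinuousAt (fun q : ℝ × X => (q.1, e q.2)) (0, x) :=
          continuousAt_fst.prodMk (ContinuousAt.comp (f := Prod.snd) (e.continuousAt hx)
            continuousAt_snd)
        refine continuousAt_pi.2 fun i => continuousAt_pi.2 fun j => ?_
        have h4 := ((formFamily_deform hχ hpath).smooth e he i j).continuousOn.continuousAt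
          ((isOpen_univ.prod e.open_target).mem_nhds
            (⟨mem_univ (0 : ℝ), e.map_source hx⟩ : ((0 : ℝ), e x) ∈ univ ×ˢ e.target))
        exact ContinuousAt.comp (f := fun q : ℝ × X => (q.1, e q.2)) h4 h3
      · simpa using hφ.2 e he _ (e.map_source hx)
      · filter_upwards [hs] with q hq using (hcl q.1).hermitian e he _ (e.map_source hq)
    -- The preferred chart jumps with the point, so positivity is proved in the fixed chart `e` and
    -- then transferred.
    filter_upwards [h2, hs] with q hq hqs
    exact posDef_transition hχ (hcl q.1).glue (chart_mem_atlas _ _) he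
      ⟨mem_chart_source _ _, hqs⟩ hq
  filter_upwards [h1] with s hs
  refine ⟨hsm s, fun e he z hz => ?_⟩
  have hz' := e.map_target hz
  have := posDef_transition hχ (hcl s).glue he (chart_mem_atlas _ (e.symm z))
    ⟨hz', mem_chart_source _ _⟩ (hs _ (mem_univ _))
  rwa [e.right_inv hz] at this

end KahlerPotentials

/-! ### Uniqueness of the functional. -/

section Uniqueness

variable {n : ℕ} {X : Type*} [TopologicalSpace X] [ChartedSpace (Fin n → ℂ) X]
  [IsManifold 𝓘(ℂ, Fin n → ℂ) ω X] [MeasurableSpace X] {χ Ω : LocalCoeff n X}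

lemma IsJFunctional.hasDerivAt_smul {J : (X → ℝ) → ℝ} (hχ : IsKahlerForm χ)
    (hJ : IsJFunctional χ Ω J) {φ : X → ℝ} (hφ : φ ∈ potentials χ) {s : ℝ}
    (hs : s ∈ Icc (0 : ℝ) 1) :
    HasDerivAt (fun s : ℝ => J (s • φ)) (jForm χ Ω (s • φ) φ) s := by
  -- The derivative at `0` along the line through `s • φ` in direction `φ` is the derivative at `s`
  -- along the ray.
  have h1 := hJ.deriv (s • φ) (smul_mem_potentials hχ hφ hs) φ hφ.1
  rw [← sub_self s] at h1
  have h2 := h1.comp_sub_const s s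
  refine h2.congr_of_eventuallyEq (Eventually.of_forall fun t => ?_)
  simp only [← add_smul, add_sub_cancel]

theorem IsJFunctional.eqOn {J J' : (X → ℝ) → ℝ} (hχ : IsKahlerForm χ)
    (hJ : IsJFunctional χ Ω J) (hJ' : IsJFunctional χ Ω J') : EqOn J J' (potentials χ) := by
  intro φ hφ
  have hd : ∀ s ∈ Icc (0 : ℝ) 1, HasDerivAt (fun s : ℝ => J (s • φ) - J' (s • φ)) 0 s :=
    fun s hs => by
      simpa using (hJ.hasDerivAt_smul hχ hφ hs).fun_sub (hJ'.hasDerivAt_smul hχ hφ hs)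
  have h1 := constant_of_has_deriv_right_zero
    (fun s hs => (hd s hs).continuousAt.continuousWithinAt)
    (fun s hs => (hd s (Ico_subset_Icc_self hs)).hasDerivWithinAt) 1 (right_mem_Icc.2 zero_le_one)
  simp only [one_smul, zero_smul, hJ.zero, hJ'.zero, sub_self] at h1
  exact sub_eq_zero.1 h1

end Uniqueness

/-! ### `jFunctional` has the prescribed differential. -/

section Functional

variable {n : ℕ} {X : Type*} [TopologicalSpace X] [CompactSpace X] [T2Space X]
  [ChartedSpace (Fin n → ℂ) X] [IsManifold 𝓘(ℂ, Fin n → ℂ) ω X]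
  [MeasurableSpace X] [BorelSpace X] {χ Ω : LocalCoeff n X}

/-- Passing from the measure `χ_φⁿ` to `χⁿ` brings in the factor `detRatio`, which turns the trace
into the polynomial density. -/
lemma jForm_eq_jPoly (hχ : IsKahlerForm χ) (hΩ : IsClosedForm Ω) {φ ψ : X → ℝ}
    (hφ : φ ∈ potentials χ) (hψ : Continuous ψ) :
    jForm χ Ω φ ψ = jPoly χ Ω (slope χ Ω) φ ψ := by
  have hg := isKahlerForm_deform hχ hφ
  rw [jForm, integral_topPower_eq hχ hg
    (hψ.fun_mul ((continuous_traceForm hg hΩ).fun_sub continuous_const))]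
  simp only [jPoly, jDensity_eq hχ hg, mul_assoc]

lemma jFunctional_eq_jPrimitive (hχ : IsKahlerForm χ) (hΩ : IsClosedForm Ω) {φ : X → ℝ}
    (hφ : φ ∈ potentials χ) : jFunctional χ Ω φ = jPrimitive χ Ω (slope χ Ω) φ := by
  refine intervalIntegral.integral_congr fun s hs => ?_
  rw [uIcc_of_le zero_le_one] at hs
  exact jForm_eq_jPoly hχ hΩ (smul_mem_potentials hχ hφ hs) hφ.1.chartSmooth.continuous

theorem isJFunctional_jFunctional (hχ : IsKahlerForm χ) (hΩ : IsClosedForm Ω) :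
    IsJFunctional χ Ω (jFunctional χ Ω) where
  zero := by simp [jFunctional, jForm]
  deriv φ hφ ψ hψ := by
    have hψ' := hψ.chartSmooth
    have hpath : SmoothFamily n (univ : Set ℝ) (fun s : ℝ => φ + s • ψ) :=
      hφ.1.chartSmooth.smoothFamily.add ((smoothFamily_param contDiff_id).mul hψ'.smoothFamily)
    have h1 := hasDerivAt_jPrimitive hχ hΩ (slope χ Ω) isOpen_univ hpath (φ' := fun _ => ψ)
      hψ'.smoothFamily (fun s _ x => by
        simpa using ((hasDerivAt_id s).mul_const (ψ x)).const_add (φ x)) (mem_univ 0)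
    simp only [zero_smul, add_zero] at h1
    rw [← jForm_eq_jPoly hχ hΩ hφ hψ'.continuous] at h1
    refine h1.congr_of_eventuallyEq ?_
    filter_upwards [eventually_add_smul_mem_potentials hχ hφ hψ] with s hs
    exact jFunctional_eq_jPrimitive hχ hΩ hs

end Functional

/-! ### Time derivatives of smooth families. -/

section TimeDerivative

variable {n : ℕ} {X : Type*} [TopologicalSpace X] [ChartedSpace (Fin n → ℂ) X] {I : Set ℝ}
  {f : ℝ → X → ℝ}

lemma SmoothFamily.hasDerivAt (hI : IsOpen I) (hf : SmoothFamily n I f) {t : ℝ} (ht : t ∈ I)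
    (x : X) : HasDerivAt (fun s => f s x) (deriv (fun s => f s x) t) t := by
  set e := chartAt (Fin n → ℂ) x
  have hx : x ∈ e.source := mem_chart_source _ x
  have h1 := (hf e (chart_mem_atlas _ x)).differentiableAt_of_isOpen (hI.prod e.open_target)
    (⟨ht, e.map_source hx⟩ : (t, e x) ∈ I ×ˢ e.target)
  have h2 : DifferentiableAt ℝ (fun s => f s (e.symm (e x))) t :=
    DifferentiableAt.comp (f := fun s : ℝ => (s, e x)) t h1 (by fun_prop)
  rw [e.left_inv hx] at h2
  exact h2.hasDerivAt

lemma SmoothFamily.deriv (hI : IsOpen I) (hf : SmoothFamily n I f) :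
    SmoothFamily n I (fun t x => deriv (fun s => f s x) t) := by
  intro e he
  have hO := hI.prod e.open_target
  have h1 : ContDiffOn ℝ ∞ (fun p : ℝ × (Fin n → ℂ) =>
      fderiv ℝ (fun p : ℝ × (Fin n → ℂ) => f p.1 (e.symm p.2)) p (1, 0)) (I ×ˢ e.target) :=
    ((hf e he).fderiv_of_isOpen hO (by simp)).clm_apply contDiffOn_const
  refine h1.congr fun p hp => ?_
  have h2 := ((hf e he).differentiableAt_of_isOpen hO hp).hasFDerivAt
  have h3 := HasFDerivAt.comp_hasDerivAt (f := fun s : ℝ => (s, p.2)) p.1 h2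
    ((hasDerivAt_id p.1).prodMk (hasDerivAt_const p.1 p.2))
  exact h3.deriv

end TimeDerivative

/-! ### The gradient term of `∂∂̄(u²)` and the pointwise inequality. -/

section GradientForm

variable {n : ℕ} {X : Type*} [TopologicalSpace X] [ChartedSpace (Fin n → ℂ) X]
  {χ Ω g : LocalCoeff n X}

/-- The witness is `a = ∂u`; as `u` is real, `∂̄u` is its conjugate, so the gradient term has rank
one and is positive semidefinite. -/
lemma exists_coeffAt_ddbarForm_sq {u : X → ℝ} (hu : ChartSmooth n u) (x : X) :
    ∃ a : Fin n → ℂ, coeffAt (ddbarForm fun y => u y * u y) x =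
      (2 * u x) • coeffAt (ddbarForm u) x + (2 : ℝ) • Matrix.vecMulVec a (star a) := by
  set e := chartAt (Fin n → ℂ) x
  have hx : x ∈ e.source := mem_chart_source _ x
  have hc := hu.ofReal (chart_mem_atlas (Fin n → ℂ) x)
  have h1 := ddbar_mul_self e.open_target hc (e.map_source hx)
  refine ⟨fun j => dz j (fun w => (u (e.symm w) : ℂ)) (e x), ?_⟩
  have h2 : coeffAt (ddbarForm fun y => u y * u y) x =
      ddbar (fun w => (u (e.symm w) : ℂ) * (u (e.symm w) : ℂ)) (e x) := by
    simp only [coeffAt, ddbarForm, Complex.ofReal_mul]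
    rfl
  rw [h2, h1, e.left_inv hx]
  have h3 : (Matrix.of fun j k => dz j (fun w => (u (e.symm w) : ℂ)) (e x) *
      dzbar k (fun w => (u (e.symm w) : ℂ)) (e x)) =
      Matrix.vecMulVec (fun j => dz j (fun w => (u (e.symm w) : ℂ)) (e x))
        (star fun j => dz j (fun w => (u (e.symm w) : ℂ)) (e x)) := by
    ext j k
    have h4 := conj_dzbar_ofReal
      (hc.differentiableAt_of_isOpen e.open_target (e.map_source hx)) k
    simp only [Matrix.of_apply, Matrix.vecMulVec_apply, Pi.star_apply, Complex.star_def]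
    rw [← h4, Complex.conj_conj]
  rw [h3]
  congr 1
  rw [← Complex.coe_smul]
  push_cast
  rfl

/-- Pointwise positivity of the second variation along the flow, after integration by parts. -/
lemma second_variation_nonneg (hχ : IsKahlerForm χ) (hg : IsKahlerForm g) (hΩ : IsKahlerForm Ω)
    (c : ℝ) {u : X → ℝ} (hu : ChartSmooth n u) {x : X} (hux : u x = c - traceForm g Ω x) :
    0 ≤ 2 * u x * jDensity₁ χ Ω c g (ddbarForm u) x + u x * u x * detRatio₁ χ g (ddbarForm u) x
      - jDensity₁ χ Ω c g (ddbarForm fun y => u y * u y) x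
      - (u x * detRatio₁ χ g (ddbarForm fun y => u y * u y) x -
        u x * u x * detRatio₁ χ g (ddbarForm u) x) := by
  obtain ⟨a, ha⟩ := exists_coeffAt_ddbarForm_sq hu x
  have key := detDeriv₂_vecMulVec_le (hg.posDef_coeffAt x) (hχ.posDef_coeffAt x)
    (hΩ.posDef_coeffAt x) a
  -- The flow equation enters only here: the coefficient `c - u` left by the expansion is exactly
  -- the trace in `key`.
  have htr : ((coeffAt g x)⁻¹ * coeffAt Ω x).trace.re = c - u x := by
    rw [hux, sub_sub_cancel]; rfl
  rw [htr] at key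
  have e1 : ∀ (r s : ℝ) (h k : Matrix (Fin n) (Fin n) ℂ),
      (detDeriv (coeffAt g x) (r • h + s • k) / (coeffAt χ x).det).re =
      r * (detDeriv (coeffAt g x) h / (coeffAt χ x).det).re +
      s * (detDeriv (coeffAt g x) k / (coeffAt χ x).det).re := by
    intro r s h k
    rw [detDeriv_add, detDeriv_smul, detDeriv_smul, add_div, mul_div_assoc, mul_div_assoc,
      Complex.add_re, Complex.re_ofReal_mul, Complex.re_ofReal_mul]
  have e2 : ∀ (r s : ℝ) (h k : Matrix (Fin n) (Fin n) ℂ),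
      (detDeriv₂ (coeffAt g x) (coeffAt Ω x) (r • h + s • k) / (coeffAt χ x).det).re =
      r * (detDeriv₂ (coeffAt g x) (coeffAt Ω x) h / (coeffAt χ x).det).re +
      s * (detDeriv₂ (coeffAt g x) (coeffAt Ω x) k / (coeffAt χ x).det).re := by
    intro r s h k
    simp only [detDeriv₂_comm _ (coeffAt Ω x)]
    rw [detDeriv₂_add_left, detDeriv₂_smul_left, detDeriv₂_smul_left, add_div, mul_div_assoc,
      mul_div_assoc, Complex.add_re, Complex.re_ofReal_mul, Complex.re_ofReal_mul]
  -- All terms with `∂∂̄u` cancel; what remains is twice the difference of the two sides of `key`.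
  simp only [jDensity₁, detRatio₁, detRatio₂, ha, e1, e2]
  linarith

end GradientForm

/-! ### Convexity along the flow. -/

section Convexity

variable {n : ℕ} {X : Type*} [TopologicalSpace X] [CompactSpace X] [T2Space X]
  [ChartedSpace (Fin n → ℂ) X] [IsManifold 𝓘(ℂ, Fin n → ℂ) ω X]
  [MeasurableSpace X] [BorelSpace X] {χ Ω : LocalCoeff n X}

lemma integral_second_variation_nonneg (hχ : IsKahlerForm χ) (hΩ : IsKahlerForm Ω)
    {g : LocalCoeff n X} (hg : IsKahlerForm g) (c : ℝ) {u : X → ℝ} (hu : ChartSmooth n u)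
    (hux : ∀ x, u x = c - traceForm g Ω x) :
    0 ≤ ∫ x, (2 * u x * jDensity₁ χ Ω c g (ddbarForm u) x +
      u x * u x * detRatio₁ χ g (ddbarForm u) x) ∂(topPower χ) := by
  have hgc := hg.isClosedForm
  have hu2 : ChartSmooth n (fun x => u x * u x) := hu.mul hu
  have cu := hu.continuous
  have c1 := continuous_jDensity₁ hχ hΩ.isClosedForm c hgc (isClosedForm_ddbarForm hu)
  have c2 := continuous_detRatio₁ hχ hgc (isClosedForm_ddbarForm hu)
  have c3 := continuous_jDensity₁ hχ hΩ.isClosedForm c hgc (isClosedForm_ddbarForm hu2)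
  have c4 := continuous_detRatio₁ hχ hgc (isClosedForm_ddbarForm hu2)
  -- Symmetry against the constant function `1`, whose `∂∂̄` vanishes.
  have z1 : ∫ x, jDensity₁ χ Ω c g (ddbarForm fun y => u y * u y) x ∂(topPower χ) = 0 := by
    have h1 := integral_jDensity₁_comm hχ hΩ.isClosedForm c hgc
      (chartSmooth_const (n := n) (X := X) 1) hu2
    simp only [one_mul] at h1
    rw [h1]
    have h2 : ∀ x : X, coeffAt (ddbarForm (n := n) fun _ : X => (1 : ℝ)) x = 0 := fun x =>
      coeffAt_ddbarForm_eq_zero (EventuallyEq.refl _ _)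
    have h3 : ∀ x, jDensity₁ χ Ω c g (ddbarForm fun _ : X => (1 : ℝ)) x = 0 := fun x => by
      simp only [jDensity₁, detRatio₁, detRatio₂, h2]
      rw [detDeriv₂_comm, detDeriv_zero]
      simp [detDeriv₂]
    simp [h3]
  have z2 := integral_detRatio₁_comm hχ hgc hu hu2
  -- The subtracted quantities integrate to zero by `z1` and `z2`; they are chosen so that the new
  -- integrand is pointwise nonnegative.
  have h1 : ∫ x, (2 * u x * jDensity₁ χ Ω c g (ddbarForm u) x +
      u x * u x * detRatio₁ χ g (ddbarForm u) x) ∂(topPower χ) =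
      ∫ x, (2 * u x * jDensity₁ χ Ω c g (ddbarForm u) x
        + u x * u x * detRatio₁ χ g (ddbarForm u) x
        - jDensity₁ χ Ω c g (ddbarForm fun y => u y * u y) x
        - (u x * detRatio₁ χ g (ddbarForm fun y => u y * u y) x -
          u x * u x * detRatio₁ χ g (ddbarForm u) x)) ∂(topPower χ) := by
    rw [integral_sub (integrable_topPower hχ (by fun_prop)) (integrable_topPower hχ (by fun_prop)),
      integral_sub (integrable_topPower hχ (by fun_prop)) (integrable_topPower hχ (by fun_prop)),
      integral_sub (f := fun x => u x * detRatio₁ χ g (ddbarForm fun y => u y * u y) x)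
        (integrable_topPower hχ (by fun_prop)) (integrable_topPower hχ (by fun_prop)), z1, z2]
    ring
  rw [h1]
  exact integral_nonneg fun x => second_variation_nonneg hχ hg hΩ c hu (hux x)

lemma ordConnected_timeInterval (T : EReal) : (timeInterval T).OrdConnected :=
  ⟨fun _ hs _ ht _ hr =>
    ⟨hs.1.trans hr.1, (EReal.coe_le_coe_iff.2 hr.2).trans_lt ht.2⟩⟩

theorem IsJFlow.convexOn (hχ : IsKahlerForm χ) (hΩ : IsKahlerForm Ω) {T : EReal}
    {φ : ℝ → X → ℝ} (hφ : IsJFlow χ Ω T φ) :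
    ConvexOn ℝ (timeInterval T) (fun t => jFunctional χ Ω (φ t)) := by
  set S := timeInterval T
  set c := slope χ Ω
  -- Derivatives are taken in the interior, where the one-sided time derivatives of the flow are
  -- two-sided.
  set I := interior S
  have hI : IsOpen I := isOpen_interior
  have hIS : I ⊆ S := interior_subset
  have hS : SmoothFamily n S φ := smoothFamily_of_contMDiffOn hφ.smooth
  have hs : SmoothFamily n I φ := fun e he => (hS e he).mono (prod_mono hIS subset_rfl)
  set φ' : ℝ → X → ℝ := fun t x => deriv (fun s => φ s x) t
  have hs' : SmoothFamily n I φ' := hs.deriv hI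
  set φ'' : ℝ → X → ℝ := fun t x => deriv (fun s => φ' s x) t
  have hs'' : SmoothFamily n I φ'' := hs'.deriv hI
  have hd : ∀ t ∈ I, ∀ x, HasDerivAt (fun s => φ s x) (φ' t x) t := fun t ht x =>
    hs.hasDerivAt hI ht x
  have hd' : ∀ t ∈ I, ∀ x, HasDerivAt (fun s => φ' s x) (φ'' t x) t := fun t ht x =>
    hs'.hasDerivAt hI ht x
  have hK : ∀ t ∈ S, IsKahlerForm (deform χ (φ t)) := fun t ht =>
    isKahlerForm_deform hχ (hφ.mem t ht)
  have hflow : ∀ t ∈ I, ∀ x, φ' t x = c - traceForm (deform χ (φ t)) Ω x := fun t ht x =>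
    (hd t ht x).unique
      ((hφ.flow t (hIS ht) x).hasDerivAt (mem_interior_iff_mem_nhds.1 ht))
  have hdens : ∀ t ∈ I, ∀ x, jDensity χ Ω c (deform χ (φ t)) x =
      -(φ' t x * detRatio χ (deform χ (φ t)) x) := fun t ht x => by
    rw [jDensity_eq hχ (hK t (hIS ht)), hflow t ht x]
    ring
  -- The time derivative of `hdens`, computed in two ways.
  have hvar : ∀ t ∈ I, ∀ x, jDensity₁ χ Ω c (deform χ (φ t)) (ddbarForm (φ' t)) x =
      -(φ'' t x * detRatio χ (deform χ (φ t)) x +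
        φ' t x * detRatio₁ χ (deform χ (φ t)) (ddbarForm (φ' t)) x) := fun t ht x => by
    refine (hasDerivAt_jDensity hI hs hd ht x).unique
      (((hd' t ht x).mul (hasDerivAt_detRatio hI hs hd ht x)).neg.congr_of_eventuallyEq ?_)
    filter_upwards [hI.mem_nhds ht] with s hs using hdens s hs x
  have hJ : ∀ t ∈ I, HasDerivAt (fun t => jPrimitive χ Ω c (φ t)) (jPoly χ Ω c (φ t) (φ' t)) t :=
    fun t ht => hasDerivAt_jPrimitive hχ hΩ.isClosedForm c hI hs hs' hd ht
  have hJ' : ∀ t ∈ I, HasDerivAt (deriv fun t => jPrimitive χ Ω c (φ t))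
      (∫ x, (φ'' t x * jDensity χ Ω c (deform χ (φ t)) x +
        φ' t x * jDensity₁ χ Ω c (deform χ (φ t)) (ddbarForm (φ' t)) x) ∂(topPower χ)) t := by
    intro t ht
    refine (hasDerivAt_jPoly hχ hΩ.isClosedForm c hI hs hs' hs' hs'' hd hd'
      ht).congr_of_eventuallyEq ?_
    filter_upwards [hI.mem_nhds ht] with s hs using (hJ s hs).deriv
  have hconv : ConvexOn ℝ S (fun t => jPrimitive χ Ω c (φ t)) := by
    refine convexOn_of_deriv2_nonneg (ordConnected_timeInterval T).convex
      (continuousOn_jPrimitive hχ hΩ.isClosedForm c hS)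
      (fun t ht => (hJ t ht).differentiableAt.differentiableWithinAt)
      (fun t ht => (hJ' t ht).differentiableAt.differentiableWithinAt) fun t ht => ?_
    have h1 := integral_second_variation_nonneg hχ hΩ (hK t (hIS ht)) c (hs'.chartSmooth ht)
      (hflow t ht)
    simp only [Function.iterate_succ, Function.iterate_zero, Function.comp_apply, id_eq]
    rw [(hJ' t ht).deriv]
    refine h1.trans_eq (integral_congr_ae (Eventually.of_forall fun x => ?_))
    have h2 := hdens t ht x
    have h3 := hvar t ht x
    simp only
    -- Eliminates the second time derivative: the two relations give `φ'' D = φ' D₁ + φ'² R₁`, with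
    -- `D`, `D₁` and `R₁` the values of `jDensity`, `jDensity₁` and `detRatio₁`.
    linear_combination φ' t x * h3 - φ'' t x * h2
  exact hconv.congr fun t ht => (jFunctional_eq_jPrimitive hχ hΩ.isClosedForm (hφ.mem t ht)).symm

end Convexity

end JFlow

end

end Development

theorem mainTheorem10 {n : ℕ} {X : Type*} [TopologicalSpace X] [CompactSpace X] [T2Space X]
    [ChartedSpace (Fin n → ℂ) X] [IsManifold 𝓘(ℂ, Fin n → ℂ) ω X]
    [MeasurableSpace X] [BorelSpace X] (χ Ω : JFlow.LocalCoeff n X)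
    (hχ : JFlow.IsKahlerForm χ) (hΩ : JFlow.IsKahlerForm Ω) :
    JFlow.IsJFunctional χ Ω (JFlow.jFunctional χ Ω) ∧
    (∀ J : (X → ℝ) → ℝ, JFlow.IsJFunctional χ Ω J →
      EqOn J (JFlow.jFunctional χ Ω) (JFlow.potentials χ)) ∧
    ∀ (T : EReal) (φ : ℝ → X → ℝ), JFlow.IsJFlow χ Ω T φ →
      ConvexOn ℝ (JFlow.timeInterval T) (fun t => JFlow.jFunctional χ Ω (φ t)) :=
  have hJ := JFlow.isJFunctional_jFunctional hχ hΩ.isClosedForm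
  ⟨hJ, fun _ hJ' => hJ'.eqOn hχ hJ, fun _ _ hφ => hφ.convexOn hχ hΩ⟩
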